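/- **Theorem.** For a finite simple graph $G$ and integers $g,h\ge 0$, say that $G$ is *$(g,h)$-biembeddable* if its edge set can be partitioned into the edge sets of two subgraphs, one of which is embeddable in $S_g$ and the other in $S_h$, where $S_g$ denotes the closed connected orientable surface of genus $g$. The *bigenus* $\beta(G)$ is the smallest $g$ such that $G$ is $(g,g)$-biembeddable. (Embeddings are described by rotation systems: a rotation system assigns to each vertex a cyclic permutation of the arcs leaving it; for a connected graph it determines a cellular embedding in the surface $S_g$ with $|V|-|E|+|F|=2-2g$, where $F$ is the set of faces obtained by face tracing, a single vertex having one face. A graph is embeddable in $S_g$ if it has a rotation system for which the genera of its components add up to at most $g$.) Let $s\ge 0$ be an integer and $b(s)=24s^2+29s+8$. Then $\beta(K_{24s+21})=b(s)$, and for every $k=0,1,\dots,s+1$ the complete graph $K_{24s+21}$ is $$\bigl(b(s)-(8s+7)k,\; b(s)+(8s+7)k\bigr)\text{-biembeddable}.$$ Moreover, the two subgraphs can be chosen to be connected spanning subgraphs with cellular embeddings in exactly these two surfaces in which every face is a triangle. -/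

import Mathlib

namespace GraphSurface

universe u

variable {V : Type u}

/-- A rotation system of a simple graph `G`: for every vertex, a cyclic permutation of the arcs
(darts) leaving it.  The permutations are collected into one permutation `rot` of all arcs, which
preserves initial vertices and acts transitively on the arcs leaving any given vertex. -/
structure RotationSystem (G : SimpleGraph V) where
  rot : Equiv.Perm G.Dart
  rot_fst : ∀ d : G.Dart, (rot d).fst = d.fst
  rot_cyclic : ∀ d d' : G.Dart, d.fst = d'.fst → rot.SameCycle d d'

/-- Reversal of arcs, as a permutation. -/
def arcReversal (G : SimpleGraph V) : Equiv.Perm G.Dart where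
  toFun d := d.symm
  invFun d := d.symm
  left_inv d := d.symm_symm
  right_inv d := d.symm_symm

namespace RotationSystem

variable {G : SimpleGraph V}

/-- Face tracing: the arc that follows `d = (u, v)` on its face-boundary walk is the successor of
the reversed arc `(v, u)` in the rotation at `v`. -/
def faceStep (R : RotationSystem G) : Equiv.Perm G.Dart :=
  (arcReversal G).trans R.rot

/-- The number of faces: every cycle of the face-tracing permutation is the boundary of a face,
and every isolated vertex (a point on its own sphere) has one further face around it. -/
noncomputable def numFaces (R : RotationSystem G) : ℕ :=
  Nat.card (Quotient (Equiv.Perm.SameCycle.setoid R.faceStep)) +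
    Nat.card {v : V // ∀ w, ¬ G.Adj v w}

/-- `|V| - |E| + |F|`. -/
noncomputable def eulerChar (R : RotationSystem G) : ℤ :=
  (Nat.card V : ℤ) - (Nat.card G.edgeSet : ℤ) + (R.numFaces : ℤ)

/-- The rotation system is a cellular embedding of the (connected) graph `G` in the orientable
surface `S_g`, whose genus is given by the Euler equation `|V| - |E| + |F| = 2 - 2g`. -/
def IsCellularEmbeddingIn (R : RotationSystem G) (g : ℕ) : Prop :=
  G.Connected ∧ R.eulerChar = 2 - 2 * (g : ℤ)

/-- The rotation system restricts to a cellular embedding of each connected component in a closed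
orientable surface, and the genera of these surfaces add up to `g`: summing the Euler equations
of the `c` components gives `|V| - |E| + |F| = 2c - 2g`. -/
def HasTotalGenus (R : RotationSystem G) (g : ℕ) : Prop :=
  R.eulerChar = 2 * (Nat.card G.ConnectedComponent : ℤ) - 2 * (g : ℤ)

/-- Every face is a triangle: its boundary walk consists of exactly three arcs. -/
def IsTriangular (R : RotationSystem G) : Prop :=
  ∀ d : G.Dart, Function.minimalPeriod R.faceStep d = 3

end RotationSystem

/-- The finite graph `G`, connected or not, can be drawn without crossings in the orientable
surface `S_g` (faces need not be disks): it has a rotation system of total genus at most `g`.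
The connected sum of the surfaces of the components, with further handles added inside a face,
is then `S_g`. -/
def EmbedsIn (G : SimpleGraph V) (g : ℕ) : Prop :=
  ∃ (R : RotationSystem G) (g' : ℕ), g' ≤ g ∧ R.HasTotalGenus g'

/-- `G` is decomposed into the edge-disjoint subgraphs `G₁` and `G₂`. -/
def IsEdgeDecomposition (G G₁ G₂ : SimpleGraph V) : Prop :=
  G₁.edgeSet ∪ G₂.edgeSet = G.edgeSet ∧ Disjoint G₁.edgeSet G₂.edgeSet

/-- `G` is `(g, h)`-biembeddable: it has an edge decomposition into two subgraphs, one of which is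
embeddable in `S_g` and the other in `S_h`. -/
def IsBiembeddable (G : SimpleGraph V) (g h : ℕ) : Prop :=
  ∃ G₁ G₂ : SimpleGraph V, IsEdgeDecomposition G G₁ G₂ ∧ EmbedsIn G₁ g ∧ EmbedsIn G₂ h

/-- `G` has an edge decomposition into two (connected, spanning) subgraphs which triangulate
`S_g` and `S_h`, that is, have cellular embeddings there in which every face is a triangle. -/
def HasTriangularBiembedding (G : SimpleGraph V) (g h : ℕ) : Prop :=
  ∃ G₁ G₂ : SimpleGraph V, IsEdgeDecomposition G G₁ G₂ ∧
    (∃ R₁ : RotationSystem G₁, R₁.IsCellularEmbeddingIn g ∧ R₁.IsTriangular) ∧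
    (∃ R₂ : RotationSystem G₂, R₂.IsCellularEmbeddingIn h ∧ R₂.IsTriangular)

/-- The bigenus `β(G)`: the smallest `g` such that `G` is biembeddable in `S_g`. -/
noncomputable def bigenus (G : SimpleGraph V) : ℕ :=
  sInf {g : ℕ | IsBiembeddable G g g}

end GraphSurface

namespace GraphSurface

/-! The lower bound is Euler's formula. A graph on n ≥ 3 vertices with total genus g has at most 3n
− 6 + 6g edges; adding this for the two parts of K_n, n = 24s + 21, gives exactly b(s). Two
triangulations attain equality, so everything rests on decomposing K_n into two connected
triangulations of the prescribed genera.

Put m = 8s + 7, take Z_m × {0, 1, 2} as vertex set and let Z_m act by translation. The arcs of K_n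
form 9m − 3 orbits, so 3m − 1 base triangles have just enough sides to represent each orbit once.
Hence covering all orbits already implies that no side is repeated (`arcs_nodup_of_cover`). What
remains is closure under reversal, connected links and connected graphs.

The base triangles come from four label paths in Z_m: P₀, P₁ for the first graph and Q₁, Q₂ for the
second. A consecutive pair (p, q) produces two triangles on the two sides of an arc of difference q
− p inside one class (a rung). Shared ends and a few extra triangles complete the pattern, and the
parities of the lengths make every vertex link connected (`link_openFaces`, `link_closedFaces`). By
`hasTriangularBiembedding_of_paths` it is then enough that the paths cover all labels between the
classes and all differences inside them, much as in a graceful labelling.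

Only P₁ and Q₁ vary with k. For j = s + 1 − k they have 2j + 1 and 4s + 4 − 2j entries, and moving
two entries from one to the other moves genus m between the surfaces. The paths are glued from
zigzags a, b, a − d, b + d, …, whose differences form an arithmetic progression. For P₁ and Q₁ three
zigzags of step 3 are cut at the common index j and rejoined, the junctions restoring exactly the
differences lost by the cuts. The few pairs (s, j) that this misses are given by explicit paths. -/

open Equiv.Perm

/-! ### Cycles of a permutation and their lengths. -/

section Cycles

variable {α : Type*} [Finite α]

theorem natCard_sameCycle (σ : Equiv.Perm α) (x : α) :
    Nat.card {y // σ.SameCycle x y} = Function.minimalPeriod σ x := by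
  classical
  have := Fintype.ofFinite α
  have h := MulAction.minimalPeriod_eq_card (α := Equiv.Perm α) (β := α) (a := σ) (b := x)
  rw [← Nat.card_eq_fintype_card] at h
  have h2 : Function.minimalPeriod σ x = Function.minimalPeriod (σ • ·) x := rfl
  rw [h2, h]
  apply Nat.card_congr
  refine Equiv.subtypeEquivRight fun y => ?_
  constructor
  · rintro ⟨i, hi⟩
    exact ⟨⟨σ ^ i, Subgroup.mem_zpowers_iff.2 ⟨i, rfl⟩⟩, hi⟩
  · rintro ⟨⟨_, hg⟩, hi⟩
    obtain ⟨i, rfl⟩ := Subgroup.mem_zpowers_iff.1 hg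
    exact ⟨i, hi⟩

theorem natCard_eq_sum_cycles (σ : Equiv.Perm α)
    [Fintype (Quotient (SameCycle.setoid σ))] :
    Nat.card α = ∑ q : Quotient (SameCycle.setoid σ), Function.minimalPeriod σ q.out := by
  classical
  rw [Nat.card_congr (Equiv.sigmaFiberEquiv (Quotient.mk (SameCycle.setoid σ))).symm,
    Nat.card_sigma]
  refine Finset.sum_congr rfl fun q _ => ?_
  rw [← natCard_sameCycle]
  refine Nat.card_congr (Equiv.subtypeEquivRight fun y => ?_)
  constructor
  · intro h
    have : Quotient.mk (SameCycle.setoid σ) q.out = Quotient.mk _ y := by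
      rw [Quotient.out_eq, h]
    exact Quotient.exact this
  · intro h
    have : Quotient.mk (SameCycle.setoid σ) q.out = Quotient.mk _ y := Quotient.sound h
    rw [Quotient.out_eq] at this
    exact this.symm

end Cycles

/-! ### Faces of rotation systems. -/

variable {V : Type*} {G : SimpleGraph V}

theorem natCard_dart [Finite V] : Nat.card G.Dart = 2 * Nat.card G.edgeSet := by
  classical
  have := Fintype.ofFinite V
  rw [Nat.card_eq_fintype_card, Nat.card_eq_fintype_card, SimpleGraph.dart_card_eq_twice_card_edges,
    ← SimpleGraph.edgeFinset_card]

namespace RotationSystem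

variable (R : RotationSystem G)

theorem faceStep_apply (d : G.Dart) : R.faceStep d = R.rot d.symm := rfl

theorem faceStep_fst (d : G.Dart) : (R.faceStep d).fst = d.snd := by
  rw [faceStep_apply, R.rot_fst]; rfl

theorem IsTriangular.three_mul_card [Finite V] {R : RotationSystem G} (h : R.IsTriangular) :
    3 * Nat.card (Quotient (SameCycle.setoid R.faceStep)) = Nat.card G.Dart := by
  classical
  have : Finite G.Dart := by have := Fintype.ofFinite V; infer_instance
  have := Fintype.ofFinite (Quotient (SameCycle.setoid R.faceStep))
  rw [natCard_eq_sum_cycles R.faceStep, Finset.sum_congr rfl fun q _ => h q.out]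
  simp [mul_comm]

theorem minimalPeriod_pos [Finite V] (d : G.Dart) : 0 < Function.minimalPeriod R.faceStep d := by
  have : Finite G.Dart := by have := Fintype.ofFinite V; classical infer_instance
  rw [← natCard_sameCycle]
  have : Nonempty {y // R.faceStep.SameCycle d y} := ⟨⟨d, SameCycle.refl _ _⟩⟩
  exact Nat.card_pos

/-- The next arc on a face starts where the present one ends, so a face of length one would be a
loop. -/
theorem minimalPeriod_ne_one (d : G.Dart) : Function.minimalPeriod R.faceStep d ≠ 1 := by
  intro h
  have h1 := Function.minimalPeriod_eq_one_iff_isFixedPt.1 h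
  have h2 := R.faceStep_fst d
  rw [h1] at h2
  exact d.adj.ne h2

/-- A dart on a face of length two spans a component with two vertices. -/
theorem eq_of_minimalPeriod_eq_two {d : G.Dart} (h : Function.minimalPeriod R.faceStep d = 2)
    {v w : V} (hv : v = d.fst ∨ v = d.snd) (hw : G.Adj v w) : w = d.fst ∨ w = d.snd := by
  have h2 : R.faceStep (R.faceStep d) = d := by
    have := Function.isPeriodicPt_minimalPeriod R.faceStep d
    rw [h] at this
    exact this
  have hs : (R.faceStep d).snd = d.fst := by rw [← R.faceStep_fst, h2]
  have h3 : R.faceStep d = d.symm := by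
    refine SimpleGraph.Dart.ext _ _ ?_
    exact Prod.ext (R.faceStep_fst d) hs
  -- A fixed point of a cyclic rotation is the only arc at its vertex. On a face of length two this
  -- holds at both ends.
  have key : ∀ d' : G.Dart, R.rot d' = d' → ∀ w, G.Adj d'.fst w → w = d'.snd := by
    intro d' hd' w hw
    obtain ⟨i, hi⟩ := R.rot_cyclic d' ⟨(d'.fst, w), hw⟩ rfl
    rw [Function.IsFixedPt.perm_zpow hd' i] at hi
    rw [hi]
  rcases hv with rfl | rfl
  · right
    refine key d ?_ w hw
    have : R.rot d.symm.symm = d := by rw [← faceStep_apply, ← h3, h2]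
    simpa using this
  · left
    exact key d.symm h3 w hw

end RotationSystem

/-! ### The edge bound, for connected and disconnected graphs. -/

theorem reachable_mem {S : Set V} (hS : ∀ v ∈ S, ∀ w, G.Adj v w → w ∈ S) {v w : V}
    (hv : v ∈ S) (h : G.Reachable v w) : w ∈ S := by
  obtain ⟨p⟩ := h
  induction p with
  | nil => exact hv
  | cons hadj _ ih => exact ih (hS _ hv _ hadj)

/-- The edge bound of an embedded graph. -/
theorem RotationSystem.HasTotalGenus.card_edgeSet_le [Finite V] {R : RotationSystem G} {g : ℕ}
    (h : R.HasTotalGenus g) (hn : 3 ≤ Nat.card V) :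
    Nat.card G.edgeSet + 6 ≤ 3 * Nat.card V + 6 * g := by
  classical
  have := Fintype.ofFinite V
  have : Finite G.Dart := inferInstance
  have := Fintype.ofFinite (Quotient (SameCycle.setoid R.faceStep))
  set Q := Quotient (SameCycle.setoid R.faceStep)
  set I := {v : V // ∀ w, ¬ G.Adj v w}
  let S := {q : Q // Function.minimalPeriod R.faceStep q.out = 2}
  -- There are no faces of length one, so only faces of length two fall short of three, each by one.
  have hcount : 3 * Nat.card Q ≤ Nat.card G.Dart + Nat.card S := by
    rw [natCard_eq_sum_cycles R.faceStep, Nat.card_eq_fintype_card (α := S), Fintype.card_subtype,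
      Finset.card_filter, ← Finset.sum_add_distrib, Nat.card_eq_fintype_card]
    calc 3 * Fintype.card Q = ∑ q : Q, 3 := by simp [mul_comm]
      _ ≤ _ := by
        refine Finset.sum_le_sum fun q _ => ?_
        have h0 := R.minimalPeriod_pos q.out
        have h1 := R.minimalPeriod_ne_one q.out
        split_ifs <;> omega
  -- A face of length two belongs to a component K₂, both of whose arcs lie on that face. Such faces
  -- and isolated vertices can therefore be charged to distinct components.
  let φ : S ⊕ I → G.ConnectedComponent :=
    Sum.elim (fun q => G.connectedComponentMk q.1.out.fst) (fun v => G.connectedComponentMk v.1)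
  have hclS : ∀ q : S, ∀ w, G.Reachable q.1.out.fst w → w = q.1.out.fst ∨ w = q.1.out.snd := by
    intro q w hw
    exact reachable_mem (S := {w | w = q.1.out.fst ∨ w = q.1.out.snd})
      (fun v hv w hw => R.eq_of_minimalPeriod_eq_two q.2 hv hw) (Or.inl rfl) hw
  have hclI : ∀ v : I, ∀ w, G.Reachable v.1 w → w = v.1 := by
    intro v w hw
    exact reachable_mem (S := {w | w = v.1})
      (fun u hu w hw => by subst hu; exact absurd hw (v.2 w)) rfl hw
  have hφ : Function.Injective φ := by
    rintro (q | v) (q' | v') hqq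
    · have hr : G.Reachable q.1.out.fst q'.1.out.fst := SimpleGraph.ConnectedComponent.exact hqq
      have h1 := hclS q _ hr
      have h2 := hclS q _ (hr.trans q'.1.out.adj.reachable)
      have hne := q'.1.out.adj.ne
      have hcase : q'.1.out = q.1.out ∨ q'.1.out = q.1.out.symm := by
        rcases h1 with h1 | h1 <;> rcases h2 with h2 | h2
        · exact absurd (h1.trans h2.symm) hne
        · exact Or.inl (SimpleGraph.Dart.ext _ _ (Prod.ext h1 h2))
        · exact Or.inr (SimpleGraph.Dart.ext _ _ (Prod.ext h1 h2))
        · exact absurd (h1.trans h2.symm) hne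
      have hsc : R.faceStep.SameCycle q.1.out q'.1.out := by
        rcases hcase with hc | hc
        · rw [hc]
        · refine ⟨1, ?_⟩
          rw [hc, zpow_one]
          have h2 : R.faceStep (R.faceStep q.1.out) = q.1.out := by
            have := Function.isPeriodicPt_minimalPeriod R.faceStep q.1.out
            rw [q.2] at this
            exact this
          refine SimpleGraph.Dart.ext _ _ (Prod.ext (R.faceStep_fst _) ?_)
          change (R.faceStep q.1.out).snd = q.1.out.fst
          rw [← R.faceStep_fst, h2]
      have : q.1 = q'.1 := by
        rw [← Quotient.out_eq q.1, ← Quotient.out_eq q'.1]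
        exact Quotient.sound hsc
      rw [Subtype.ext this]
    · have hr : G.Reachable q.1.out.fst v'.1 := SimpleGraph.ConnectedComponent.exact hqq
      have h1 := hclI v' _ hr.symm
      exact absurd (h1 ▸ q.1.out.adj) (v'.2 _)
    · have hr : G.Reachable v.1 q'.1.out.fst := SimpleGraph.ConnectedComponent.exact hqq
      have h1 := hclI v _ hr
      exact absurd (h1 ▸ q'.1.out.adj) (v.2 _)
    · have hr : G.Reachable v.1 v'.1 := SimpleGraph.ConnectedComponent.exact hqq
      rw [Subtype.ext (hclI v _ hr)]
  have hle : Nat.card S + Nat.card I ≤ Nat.card G.ConnectedComponent := by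
    rw [← Nat.card_sum]
    exact Nat.card_le_card_of_injective φ hφ
  have hV : Nonempty V := by
    have : 0 < Nat.card V := by omega
    exact (Nat.card_pos_iff.1 this).1
  have hc : Nat.card G.ConnectedComponent = 1 → Nat.card S = 0 ∧ Nat.card I = 0 := by
    intro hc1
    have hsub : Subsingleton G.ConnectedComponent := (Nat.card_eq_one_iff_unique.1 hc1).1
    have hreach : ∀ v w, G.Reachable v w := fun v w =>
      SimpleGraph.ConnectedComponent.exact (Subsingleton.elim _ _)
    constructor
    · have : IsEmpty S := by
        refine ⟨fun q => ?_⟩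
        have : Nat.card V ≤ Nat.card ({q.1.out.fst, q.1.out.snd} : Set V) := by
          refine Nat.card_le_card_of_injective
            (fun w => (⟨w, hclS q w (hreach _ _)⟩ : ({q.1.out.fst, q.1.out.snd} : Set V))) ?_
          intro x y hxy
          exact congrArg (fun z => z.1) hxy
        have h2 : Nat.card ({q.1.out.fst, q.1.out.snd} : Set V) ≤ 2 := by
          rw [Nat.card_coe_set_eq]
          exact (Set.ncard_insert_le _ _).trans (by simp)
        omega
      exact Nat.card_of_isEmpty
    · have : IsEmpty I := by
        refine ⟨fun v => ?_⟩
        have : Subsingleton V := ⟨fun x y => by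
          rw [hclI v x (hreach _ _), hclI v y (hreach _ _)]⟩
        have := (Finite.card_le_one_iff_subsingleton (α := V)).2 this
        omega
      exact Nat.card_of_isEmpty
  have hcpos : 0 < Nat.card G.ConnectedComponent := by
    have : Nonempty G.ConnectedComponent := hV.map G.connectedComponentMk
    exact Nat.card_pos
  have hE := natCard_dart (G := G)
  unfold RotationSystem.HasTotalGenus RotationSystem.eulerChar RotationSystem.numFaces at h
  change (Nat.card V : ℤ) - Nat.card G.edgeSet + ((Nat.card Q + Nat.card I : ℕ) : ℤ) = _ at h
  push_cast at h
  -- Three times the Euler equation gives |E| ≤ 3|V| + 6g − 6c + |S| + 3|I|. For c = 1 both defects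
  -- vanish; for c ≥ 2 they are at most 3c in total, which leaves −3c ≤ −6.
  by_cases h1 : Nat.card G.ConnectedComponent = 1
  · obtain ⟨hS, hI⟩ := hc h1
    omega
  · omega

/-! ### Triangular rotation systems from oriented triangles. -/

/-- A family `F` of oriented triangles, `F a b c` meaning that `a → b → c → a` is the boundary of a
face, in which every arc lies on at most one triangle, the arcs are closed under reversal, and the
triangles around every vertex form a single cycle. -/
structure IsFaceSystem {V : Type*} (F : V → V → V → Prop) : Prop where
  rotate : ∀ {a b c}, F a b c → F b c a
  ne : ∀ {a b c}, F a b c → a ≠ b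
  unique : ∀ {a b c d}, F a b c → F a b d → c = d
  reverse : ∀ {a b c}, F a b c → ∃ d, F b a d
  link : ∀ {v a b c d}, F v a c → F v b d → Relation.EqvGen (fun x y => F x v y) a b

namespace IsFaceSystem

variable {V W : Type*} {F : V → V → V → Prop}

/-- The graph formed by the arcs of a face system. -/
def graph (h : IsFaceSystem F) : SimpleGraph V where
  Adj a b := ∃ c, F a b c
  symm := ⟨fun _ _ ⟨_, hc⟩ => h.reverse hc⟩
  loopless := ⟨fun _ ⟨_, hc⟩ => h.ne hc rfl⟩

theorem comap (h : IsFaceSystem F) (e : W ≃ V) :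
    IsFaceSystem (fun a b c => F (e a) (e b) (e c)) where
  rotate := h.rotate
  ne hF hab := h.ne hF (congrArg e hab)
  unique h1 h2 := e.injective (h.unique h1 h2)
  reverse hF := by
    obtain ⟨d, hd⟩ := h.reverse hF
    exact ⟨e.symm d, by simpa using hd⟩
  link := by
    intro v a b c d h1 h2
    have key : ∀ x y, Relation.EqvGen (fun x y => F x (e v) y) x y →
        Relation.EqvGen (fun x y => F (e x) (e v) (e y)) (e.symm x) (e.symm y) := by
      intro x y hxy
      induction hxy with
      | rel x y hxy => exact .rel _ _ (by simpa using hxy)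
      | refl x => exact .refl _
      | symm x y _ ih => exact .symm _ _ ih
      | trans x y z _ _ ih1 ih2 => exact .trans _ _ _ ih1 ih2
    simpa using key _ _ (h.link h1 h2)

variable (h : IsFaceSystem F)

/-- The third vertex of the face on the left of an arc. -/
noncomputable def apex (d : h.graph.Dart) : V := d.adj.choose

theorem apex_spec (d : h.graph.Dart) : F d.fst d.snd (h.apex d) := d.adj.choose_spec

theorem apex_eq {d : h.graph.Dart} {c : V} (hc : F d.fst d.snd c) : h.apex d = c :=
  h.unique (h.apex_spec d) hc

/-- The rotation system whose faces are the triangles of a face system. -/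
noncomputable def rotationSystem : RotationSystem h.graph where
  rot :=
    -- Around `v`, the successor of `u` is the third vertex of the triangle on `u → v`; with this
    -- choice face tracing runs along the sides of that triangle. The inverse uses the triangle on
    -- `v → u`.
    { toFun := fun d => ⟨(d.fst, h.apex d.symm), ⟨_, h.rotate (h.apex_spec d.symm)⟩⟩
      invFun := fun d => ⟨(d.fst, h.apex d),
        h.reverse (h.rotate (h.rotate (h.apex_spec d)))⟩
      left_inv := fun d => by
        refine SimpleGraph.Dart.ext _ _ (Prod.ext rfl ?_)
        exact h.apex_eq (h.rotate (h.apex_spec d.symm))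
      right_inv := fun d => by
        refine SimpleGraph.Dart.ext _ _ (Prod.ext rfl ?_)
        exact h.apex_eq (h.rotate (h.rotate (h.apex_spec d))) }
  rot_fst _ := rfl
  rot_cyclic := by
    intro d d' hd
    set σ : Equiv.Perm h.graph.Dart := _
    change σ.SameCycle d d'
    have hσ : ∀ d : h.graph.Dart, (σ d).toProd = (d.fst, h.apex d.symm) := fun _ => rfl
    obtain ⟨c, hc⟩ := d.adj
    obtain ⟨c', hc'⟩ := d'.adj
    have hl := h.link hc (by rw [hd]; exact hc' : F d.fst d'.snd c')
    -- One step in the link is one turn of the rotation. The alternative `a = b` accounts for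
    -- reflexivity at vertices that are not neighbours of `v`.
    have key : ∀ v a b, Relation.EqvGen (fun x y => F x v y) a b →
        (a = b ∨ ∃ (ha : h.graph.Adj v a) (hb : h.graph.Adj v b),
          σ.SameCycle ⟨(v, a), ha⟩ ⟨(v, b), hb⟩) := by
      intro v a b hab
      induction hab with
      | rel x y hxy =>
        right
        refine ⟨h.reverse hxy, ⟨_, h.rotate hxy⟩, 1, ?_⟩
        refine SimpleGraph.Dart.ext _ _ ?_
        rw [zpow_one, hσ]
        exact Prod.ext rfl (h.apex_eq hxy)
      | refl x => exact Or.inl rfl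
      | symm x y _ ih =>
        rcases ih with rfl | ⟨ha, hb, hs⟩
        · exact Or.inl rfl
        · exact Or.inr ⟨hb, ha, hs.symm⟩
      | trans x y z _ _ ih1 ih2 =>
        rcases ih1 with rfl | ⟨ha, hb, hs⟩
        · exact ih2
        · rcases ih2 with rfl | ⟨ha', hb', hs'⟩
          · exact Or.inr ⟨ha, hb, hs⟩
          · exact Or.inr ⟨ha, hb', hs.trans hs'⟩
    rcases key _ _ _ hl with heq | ⟨ha, hb, hs⟩
    · have : d = d' := SimpleGraph.Dart.ext _ _ (Prod.ext hd heq)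
      rw [this]
    · have h2 : (⟨(d.fst, d'.snd), hb⟩ : h.graph.Dart) = d' :=
        SimpleGraph.Dart.ext _ _ (Prod.ext hd rfl)
      rw [← h2]
      exact hs

theorem rotationSystem_faceStep (d : h.graph.Dart) :
    (h.rotationSystem.faceStep d).toProd = (d.snd, h.apex d) := by
  rw [RotationSystem.faceStep_apply]
  exact Prod.ext rfl (h.apex_eq (by simpa using h.apex_spec d))

/-- Three steps of face tracing return to the start, so the period divides 3, and it is not 1. -/
theorem isTriangular : h.rotationSystem.IsTriangular := by
  intro d
  set f := h.rotationSystem.faceStep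
  have h1 := h.rotationSystem_faceStep
  have h2 : ∀ d, (f (f d)).toProd = (h.apex d, d.fst) := by
    intro d
    rw [h1]
    have hd := h1 d
    have ha : (f d).snd = h.apex d := congrArg Prod.snd hd
    refine Prod.ext ha (h.apex_eq ?_)
    have hb : (f d).fst = d.snd := congrArg Prod.fst hd
    rw [ha, hb]
    exact h.rotate (h.apex_spec d)
  have h3 : f (f (f d)) = d := by
    refine SimpleGraph.Dart.ext _ _ ?_
    rw [h2, show h.apex (f d) = d.fst from ?_]
    · exact Prod.ext rfl (congrArg Prod.fst (h1 d))
    · refine h.apex_eq ?_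
      rw [congrArg Prod.fst (h1 d), congrArg Prod.snd (h1 d)]
      exact h.rotate (h.apex_spec d)
  have hp : Function.IsPeriodicPt f 3 d := h3
  have hdvd := hp.minimalPeriod_dvd
  rcases (Nat.dvd_prime Nat.prime_three).1 hdvd with h4 | h4
  · exact absurd h4 (h.rotationSystem.minimalPeriod_ne_one d)
  · exact h4

end IsFaceSystem

/-- With D arcs there are D/2 edges and D/3 faces, so six times the Euler characteristic is 6|V| −
D. Connectivity and a second vertex exclude isolated vertices, which would count as extra faces. -/
theorem RotationSystem.IsTriangular.isCellularEmbeddingIn {V : Type*} [Finite V] [Nontrivial V]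
    {G : SimpleGraph V}
    {R : RotationSystem G} (h : R.IsTriangular) (hc : G.Connected) {g : ℕ}
    (hg : (6 * Nat.card V : ℤ) - Nat.card G.Dart = 12 - 12 * (g : ℤ)) :
    R.IsCellularEmbeddingIn g := by
  refine ⟨hc, ?_⟩
  have h1 := h.three_mul_card
  have h2 := natCard_dart (G := G)
  have hI : IsEmpty {v : V // ∀ w, ¬ G.Adj v w} := by
    refine ⟨fun v => ?_⟩
    obtain ⟨w, hw⟩ := hc.preconnected.exists_adj_of_nontrivial v.1
    exact v.2 w hw
  unfold RotationSystem.eulerChar RotationSystem.numFaces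
  rw [Nat.card_of_isEmpty (α := {v : V // ∀ w, ¬ G.Adj v w})]
  push_cast
  omega

theorem RotationSystem.IsCellularEmbeddingIn.embedsIn {V : Type*} {G : SimpleGraph V}
    {R : RotationSystem G} {g : ℕ} (h : R.IsCellularEmbeddingIn g) : EmbedsIn G g := by
  refine ⟨R, g, le_rfl, ?_⟩
  have : Nat.card G.ConnectedComponent = 1 := by
    have := h.1.preconnected.subsingleton_connectedComponent
    have := h.1.nonempty
    exact Nat.card_eq_one_iff_unique.2 ⟨inferInstance, this.map G.connectedComponentMk⟩
  unfold RotationSystem.HasTotalGenus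
  rw [h.2, this]
  push_cast
  ring

theorem HasTriangularBiembedding.isBiembeddable {V : Type*} {G : SimpleGraph V} {g h : ℕ}
    (H : HasTriangularBiembedding G g h) : IsBiembeddable G g h := by
  obtain ⟨G₁, G₂, hd, ⟨R₁, h₁, -⟩, ⟨R₂, h₂, -⟩⟩ := H
  exact ⟨G₁, G₂, hd, h₁.embedsIn, h₂.embedsIn⟩

/-- Two face systems which share the arcs of the complete graph on `V` give a triangular
biembedding. -/
theorem hasTriangularBiembedding_of_isFaceSystem {V W : Type*} [Finite V] [Nontrivial V]
    (e : W ≃ V)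
    {F₁ F₂ : V → V → V → Prop} (h₁ : IsFaceSystem F₁) (h₂ : IsFaceSystem F₂)
    (hcover : ∀ a b, a ≠ b → h₁.graph.Adj a b ∨ h₂.graph.Adj a b)
    (hdisj : ∀ a b, h₁.graph.Adj a b → ¬ h₂.graph.Adj a b)
    (hc₁ : h₁.graph.Connected) (hc₂ : h₂.graph.Connected) {g₁ g₂ : ℕ}
    (hg₁ : (6 * Nat.card V : ℤ) - Nat.card h₁.graph.Dart = 12 - 12 * (g₁ : ℤ))
    (hg₂ : (6 * Nat.card V : ℤ) - Nat.card h₂.graph.Dart = 12 - 12 * (g₂ : ℤ)) :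
    HasTriangularBiembedding (SimpleGraph.completeGraph W) g₁ g₂ := by
  have : Finite W := Finite.of_equiv V e.symm
  have : Nontrivial W := e.nontrivial
  have hcard : Nat.card W = Nat.card V := Nat.card_congr e
  have part : ∀ {F : V → V → V → Prop} (h : IsFaceSystem F) (g : ℕ), h.graph.Connected →
      (6 * Nat.card V : ℤ) - Nat.card h.graph.Dart = 12 - 12 * (g : ℤ) →
      ∃ R : RotationSystem (h.comap e).graph, R.IsCellularEmbeddingIn g ∧ R.IsTriangular := by
    intro F h g hc hg
    let ι : (h.comap e).graph ≃g h.graph :=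
      { toEquiv := e
        map_rel_iff' := by
          intro a b
          constructor
          · rintro ⟨c, hc⟩
            exact ⟨e.symm c, by simpa using hc⟩
          · rintro ⟨c, hc⟩
            exact ⟨e c, hc⟩ }
    have hdart : Nat.card (h.comap e).graph.Dart = Nat.card h.graph.Dart := by
      rw [natCard_dart, natCard_dart, Nat.card_congr ι.mapEdgeSet]
    refine ⟨_, RotationSystem.IsTriangular.isCellularEmbeddingIn
      (h.comap e).isTriangular ?_ ?_, (h.comap e).isTriangular⟩
    · exact ι.connected_iff.2 hc
    · rw [hdart, hcard]
      exact hg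
  have hadj : ∀ {F : V → V → V → Prop} (h : IsFaceSystem F) (a b : W),
      (h.comap e).graph.Adj a b ↔ h.graph.Adj (e a) (e b) := by
    intro F h a b
    constructor
    · rintro ⟨c, hc⟩
      exact ⟨e c, hc⟩
    · rintro ⟨c, hc⟩
      exact ⟨e.symm c, by simpa using hc⟩
  refine ⟨(h₁.comap e).graph, (h₂.comap e).graph, ⟨?_, ?_⟩, part h₁ g₁ hc₁ hg₁, part h₂ g₂ hc₂ hg₂⟩
  · ext x
    induction x using Sym2.ind with
    | _ a b =>
      simp only [Set.mem_union, SimpleGraph.mem_edgeSet, SimpleGraph.completeGraph,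
        SimpleGraph.top_adj]
      constructor
      · rintro (hab | hab) rfl
        · exact hab.ne rfl
        · exact hab.ne rfl
      · intro hab
        rw [hadj h₁, hadj h₂]
        exact hcover _ _ (e.injective.ne hab)
  · rw [Set.disjoint_left]
    intro x
    induction x using Sym2.ind with
    | _ a b =>
      rw [SimpleGraph.mem_edgeSet, SimpleGraph.mem_edgeSet, hadj h₁, hadj h₂]
      exact hdisj _ _

/-! ### The lower bound for the bigenus. -/

theorem EmbedsIn.card_edgeSet_le {V : Type*} [Finite V] {G : SimpleGraph V} {g : ℕ}
    (h : EmbedsIn G g) (hn : 3 ≤ Nat.card V) :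
    Nat.card G.edgeSet + 6 ≤ 3 * Nat.card V + 6 * g := by
  obtain ⟨R, g', hg, hR⟩ := h
  have := hR.card_edgeSet_le hn
  omega

theorem IsBiembeddable.card_edgeSet_le {V : Type*} [Finite V] {G : SimpleGraph V} {g h : ℕ}
    (H : IsBiembeddable G g h) (hn : 3 ≤ Nat.card V) :
    Nat.card G.edgeSet + 12 ≤ 6 * Nat.card V + 6 * (g + h) := by
  obtain ⟨G₁, G₂, ⟨hu, hd⟩, h₁, h₂⟩ := H
  have e₁ := h₁.card_edgeSet_le hn
  have e₂ := h₂.card_edgeSet_le hn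
  have : Nat.card G.edgeSet ≤ Nat.card G₁.edgeSet + Nat.card G₂.edgeSet := by
    rw [← hu]
    simp only [Nat.card_coe_set_eq]
    exact Set.ncard_union_le _ _
  omega

/-- The bound |E| + 12 ≤ 6n + 12g is an equality at g = b(s) for n = 24s + 21, so no rounding is
involved. -/
theorem bigenus_completeGraph (s : ℕ)
    (H : IsBiembeddable (SimpleGraph.completeGraph (Fin (24 * s + 21)))
      (24 * s ^ 2 + 29 * s + 8) (24 * s ^ 2 + 29 * s + 8)) :
    bigenus (SimpleGraph.completeGraph (Fin (24 * s + 21))) = 24 * s ^ 2 + 29 * s + 8 := by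
  refine le_antisymm (Nat.sInf_le H) (le_csInf ⟨_, H⟩ fun g hg => ?_)
  have h1 := IsBiembeddable.card_edgeSet_le hg (by simp)
  have h2 : Nat.card (SimpleGraph.completeGraph (Fin (24 * s + 21))).edgeSet =
      (24 * s + 21).choose 2 := by
    rw [Nat.card_eq_fintype_card, ← SimpleGraph.edgeFinset_card]
    simpa [SimpleGraph.completeGraph] using
      SimpleGraph.card_edgeFinset_top_eq_card_choose_two (V := Fin (24 * s + 21))
  have h3 : (24 * s + 21).choose 2 = (24 * s + 21) * (12 * s + 10) := by
    rw [Nat.choose_two_right, show 24 * s + 21 - 1 = 2 * (12 * s + 10) by omega,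
      show (24 * s + 21) * (2 * (12 * s + 10)) = 2 * ((24 * s + 21) * (12 * s + 10)) by ring,
      Nat.mul_div_cancel_left _ two_pos]
  rw [h2, h3, Nat.card_eq_fintype_card, Fintype.card_fin] at h1
  nlinarith [h1]

/-! ### Translation-invariant families of triangles on Z_m × {0, 1, 2}. -/

section Develop

variable {m : ℕ}

/-- The arc from `a` to `b`, up to translation. -/
def arcOf (a b : ZMod m × Fin 3) : Fin 3 × ZMod m × Fin 3 := (a.2, b.1 - a.1, b.2)

/-- The three corners of the triangles of a list, each written with its vertex in the middle. -/
def corners (L : List ((ZMod m × Fin 3) × (ZMod m × Fin 3) × (ZMod m × Fin 3))) :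
    List ((ZMod m × Fin 3) × (ZMod m × Fin 3) × (ZMod m × Fin 3)) :=
  L ++ L.map (fun T => (T.2.1, T.2.2, T.1)) ++ L.map (fun T => (T.2.2, T.1, T.2.1))

/-- The arcs on the boundaries of the triangles of a list, up to translation. -/
def arcs (L : List ((ZMod m × Fin 3) × (ZMod m × Fin 3) × (ZMod m × Fin 3))) :
    List (Fin 3 × ZMod m × Fin 3) :=
  (corners L).map fun T => arcOf T.1 T.2.1

/-- The translates of the triangles of a list. -/
def Develops (L : List ((ZMod m × Fin 3) × (ZMod m × Fin 3) × (ZMod m × Fin 3)))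
    (a b c : ZMod m × Fin 3) : Prop :=
  ∃ T ∈ corners L, arcOf a b = arcOf T.1 T.2.1 ∧ arcOf b c = arcOf T.2.1 T.2.2

/-- Two neighbours of a vertex of class `k` follow each other in its link. -/
def LinkStep (L : List ((ZMod m × Fin 3) × (ZMod m × Fin 3) × (ZMod m × Fin 3))) (k : Fin 3)
    (u w : ZMod m × Fin 3) : Prop :=
  ∃ T ∈ corners L, T.2.1.2 = k ∧ u = (T.1.1 - T.2.1.1, T.1.2) ∧ w = (T.2.2.1 - T.2.1.1, T.2.2.2)

variable {L L₁ L₂ : List ((ZMod m × Fin 3) × (ZMod m × Fin 3) × (ZMod m × Fin 3))}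

theorem length_arcs : (arcs L).length = 3 * L.length := by
  simp [arcs, corners]; ring

theorem corners_append (T) : T ∈ corners (L₁ ++ L₂) ↔ T ∈ corners L₁ ∨ T ∈ corners L₂ := by
  simp only [corners, List.mem_append, List.map_append]
  tauto

theorem corners_rotate {T} (h : T ∈ corners L) : (T.2.1, T.2.2, T.1) ∈ corners L := by
  simp only [corners, List.mem_append, List.mem_map] at h ⊢
  rcases h with (h | ⟨S, h, rfl⟩) | ⟨S, h, rfl⟩
  · exact Or.inl (Or.inr ⟨_, h, rfl⟩)
  · exact Or.inr ⟨_, h, rfl⟩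
  · exact Or.inl (Or.inl h)

theorem mem_arcs_of_corner {T} (h : T ∈ corners L) : arcOf T.1 T.2.1 ∈ arcs L :=
  List.mem_map.2 ⟨T, h, rfl⟩

theorem mem_arcs_append (o) : o ∈ arcs (L₁ ++ L₂) ↔ o ∈ arcs L₁ ∨ o ∈ arcs L₂ := by
  simp only [arcs, List.mem_map, corners_append]
  constructor
  · rintro ⟨T, h | h, rfl⟩
    · exact Or.inl ⟨T, h, rfl⟩
    · exact Or.inr ⟨T, h, rfl⟩
  · rintro (⟨T, h, rfl⟩ | ⟨T, h, rfl⟩)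
    · exact ⟨T, Or.inl h, rfl⟩
    · exact ⟨T, Or.inr h, rfl⟩

theorem arcs_append_perm : (arcs (L₁ ++ L₂)).Perm (arcs L₁ ++ arcs L₂) := by
  rw [arcs, arcs, arcs, ← List.map_append]
  apply List.Perm.map
  simp only [corners, List.map_append]
  rw [List.perm_iff_count]
  intro a
  simp only [List.count_append]
  omega

theorem develops_iff_mem_arcs {a b : ZMod m × Fin 3} :
    (∃ c, Develops L a b c) ↔ arcOf a b ∈ arcs L := by
  constructor
  · rintro ⟨c, T, hT, h, -⟩
    rw [h]
    exact mem_arcs_of_corner hT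
  · intro h
    obtain ⟨T, hT, h⟩ := List.mem_map.1 h
    refine ⟨(b.1 + (T.2.2.1 - T.2.1.1), T.2.2.2), T, hT, h.symm, ?_⟩
    have h2 : T.2.1.2 = b.2 := congrArg (fun x => x.2.2) h
    simp [arcOf, h2]

theorem linkStep_of_develops {a v b : ZMod m × Fin 3} :
    Develops L a v b ↔ LinkStep L v.2 (a.1 - v.1, a.2) (b.1 - v.1, b.2) := by
  simp only [Develops, LinkStep, arcOf, Prod.mk.injEq]
  refine exists_congr fun T => and_congr_right fun _ => ?_
  constructor
  · rintro ⟨⟨h1, h2, h3⟩, -, h4, h5⟩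
    exact ⟨h3.symm, ⟨by rw [← neg_sub, h2, neg_sub], h1⟩, h4, h5⟩
  · rintro ⟨h3, ⟨h2, h1⟩, h4, h5⟩
    exact ⟨⟨h1, by rw [← neg_sub, h2, neg_sub], h3.symm⟩, h3.symm, h4, h5⟩

theorem eqvGen_develops {v : ZMod m × Fin 3} {u w : ZMod m × Fin 3}
    (h : Relation.EqvGen (LinkStep L v.2) u w) :
    Relation.EqvGen (fun x y => Develops L x v y) (u.1 + v.1, u.2) (w.1 + v.1, w.2) := by
  induction h with
  | rel x y hxy =>
    refine .rel _ _ (linkStep_of_develops.2 ?_)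
    simpa using hxy
  | refl x => exact .refl _
  | symm x y _ ih => exact .symm _ _ ih
  | trans x y z _ _ ih1 ih2 => exact .trans _ _ _ ih1 ih2

/-- The triangles of a list generate a face system if their arcs are distinct and closed under
reversal, and the links are connected. -/
theorem isFaceSystem_develops (hnd : (arcs L).Nodup)
    (hloop : ∀ c, (c, 0, c) ∉ arcs L)
    (hrev : ∀ c x d, (c, x, d) ∈ arcs L → (d, -x, c) ∈ arcs L)
    (hlink : ∀ k, ∃ u, ∀ x d, (k, x, d) ∈ arcs L → Relation.EqvGen (LinkStep L k) (x, d) u) :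
    IsFaceSystem (Develops L) where
  rotate := by
    rintro a b c ⟨T, hT, h1, h2⟩
    refine ⟨_, corners_rotate hT, h2, ?_⟩
    simp only [arcOf, Prod.mk.injEq] at h1 h2 ⊢
    refine ⟨h2.2.2, ?_, h1.1⟩
    have : a.1 - c.1 = -((b.1 - a.1) + (c.1 - b.1)) := by ring
    rw [this, h1.2.1, h2.2.1]
    ring
  ne := by
    rintro a b c ⟨T, hT, h1, -⟩ rfl
    apply hloop a.2
    have := mem_arcs_of_corner hT
    rw [← h1] at this
    simpa [arcOf] using this
  unique := by
    rintro a b c d ⟨T, hT, h1, h2⟩ ⟨S, hS, h3, h4⟩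
    -- Since the arcs are distinct, a corner is determined by its first arc.
    have : T = S := List.inj_on_of_nodup_map hnd hT hS (h1.symm.trans h3)
    subst this
    have h5 := h2.trans h4.symm
    simp only [arcOf, Prod.mk.injEq, true_and] at h5
    exact Prod.ext (sub_left_injective h5.1) h5.2
  reverse := by
    intro a b c h
    rw [develops_iff_mem_arcs]
    have h1 := hrev _ _ _ (develops_iff_mem_arcs.1 ⟨c, h⟩)
    simpa [arcOf] using h1
  link := by
    intro v a b c d h1 h2
    obtain ⟨u, hu⟩ := hlink v.2
    have e1 := hu _ _ (develops_iff_mem_arcs.1 ⟨c, h1⟩)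
    have e2 := hu _ _ (develops_iff_mem_arcs.1 ⟨d, h2⟩)
    have := eqvGen_develops (e1.trans _ _ _ (e2.symm))
    simpa using this

/-- Translation acts freely, so an arc amounts to the first coordinate of its tail together with its
class up to translation. -/
theorem natCard_dart_develops (h : IsFaceSystem (Develops L)) (hnd : (arcs L).Nodup) :
    Nat.card h.graph.Dart = m * (3 * L.length) := by
  let E : h.graph.Dart ≃ ZMod m × {o // o ∈ arcs L} :=
    { toFun := fun d => (d.fst.1, ⟨arcOf d.fst d.snd, develops_iff_mem_arcs.1 d.adj⟩)
      invFun := fun x => ⟨((x.1, x.2.1.1), (x.1 + x.2.1.2.1, x.2.1.2.2)),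
        develops_iff_mem_arcs.2 (by simpa [arcOf] using x.2.2)⟩
      left_inv := fun d => by
        refine SimpleGraph.Dart.ext _ _ ?_
        simp [arcOf]
      right_inv := fun x => by
        simp [arcOf] }
  rw [Nat.card_congr E, Nat.card_prod, Nat.card_zmod, ← length_arcs]
  congr 1
  rw [← List.toFinset_card_of_nodup hnd, Nat.card_eq_fintype_card,
    ← Fintype.card_coe]
  exact Fintype.card_congr (Equiv.subtypeEquivRight fun x => by simp)

theorem card_arcs [NeZero m] :
    (Finset.univ.filter fun o : Fin 3 × ZMod m × Fin 3 => ¬ (o.1 = o.2.2 ∧ o.2.1 = 0)).card =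
      9 * m - 3 := by
  classical
  have h1 : (Finset.univ.filter fun o : Fin 3 × ZMod m × Fin 3 => o.1 = o.2.2 ∧ o.2.1 = 0).card
      = 3 := by
    have : (Finset.univ.filter fun o : Fin 3 × ZMod m × Fin 3 => o.1 = o.2.2 ∧ o.2.1 = 0) =
        Finset.univ.image fun c : Fin 3 => (c, (0 : ZMod m), c) := by
      ext ⟨a, b, c⟩
      simp only [Finset.mem_filter, Finset.mem_univ, true_and, Finset.mem_image, Prod.mk.injEq]
      constructor
      · rintro ⟨rfl, rfl⟩
        exact ⟨a, rfl, rfl, rfl⟩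
      · rintro ⟨x, rfl, rfl, rfl⟩
        exact ⟨rfl, rfl⟩
    rw [this, Finset.card_image_of_injective _ fun a b h => congrArg Prod.fst h]
    simp
  have h2 := Finset.card_filter_add_card_filter_not (s := (Finset.univ : Finset (Fin 3 × ZMod m × Fin 3)))
    (fun o => o.1 = o.2.2 ∧ o.2.1 = 0)
  rw [h1] at h2
  simp only [Finset.card_univ, Fintype.card_prod, Fintype.card_fin, ZMod.card] at h2
  omega

/-- If the triangles of a list are just numerous enough to contain all arcs, then every arc lies on
one of them. -/
theorem arcs_nodup_of_cover [NeZero m] (hlen : L.length + 1 = 3 * m)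
    (hcov : ∀ c x d, ¬ (c = d ∧ x = 0) → (c, x, d) ∈ arcs L) :
    (arcs L).Nodup ∧ ∀ c, (c, 0, c) ∉ arcs L := by
  classical
  set S := Finset.univ.filter fun o : Fin 3 × ZMod m × Fin 3 => ¬ (o.1 = o.2.2 ∧ o.2.1 = 0)
  have hS : S ⊆ (arcs L).toFinset := by
    rintro ⟨c, x, d⟩ h
    rw [List.mem_toFinset]
    exact hcov c x d (by simpa [S] using h)
  -- Pigeonhole: a list that contains a set of its own length has no repetitions and no other
  -- members. Thus repeated arcs and loops are both excluded.
  have hl : (arcs L).length = S.card := by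
    rw [length_arcs, card_arcs]
    omega
  have h1 := Finset.card_le_card hS
  have h2 := (arcs L).toFinset_card_le
  constructor
  · rw [← Multiset.coe_nodup, ← Multiset.toFinset_card_eq_card_iff_nodup]
    simp only [Multiset.coe_card]
    exact le_antisymm h2 (hl ▸ h1)
  · intro c hc
    have : S = (arcs L).toFinset := Finset.eq_of_subset_of_card_le hS (hl ▸ h2)
    have h3 : (c, (0 : ZMod m), c) ∈ S := by
      rw [this, List.mem_toFinset]
      exact hc
    simp [S] at h3

/-- Two lists of triangles which share the arcs of a complete graph give a triangular
biembedding. -/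
theorem hasTriangularBiembedding_of_lists [NeZero m] {W : Type*} (e : W ≃ ZMod m × Fin 3)
    (hlen : L₁.length + L₂.length + 1 = 3 * m)
    (hcov : ∀ c x d, ¬ (c = d ∧ x = 0) → (c, x, d) ∈ arcs L₁ ∨ (c, x, d) ∈ arcs L₂)
    (hrev₁ : ∀ c x d, (c, x, d) ∈ arcs L₁ → (d, -x, c) ∈ arcs L₁)
    (hrev₂ : ∀ c x d, (c, x, d) ∈ arcs L₂ → (d, -x, c) ∈ arcs L₂)
    (hlink₁ : ∀ k, ∃ u, ∀ x d, (k, x, d) ∈ arcs L₁ → Relation.EqvGen (LinkStep L₁ k) (x, d) u)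
    (hlink₂ : ∀ k, ∃ u, ∀ x d, (k, x, d) ∈ arcs L₂ → Relation.EqvGen (LinkStep L₂ k) (x, d) u)
    (hconn₁ : ∀ h : IsFaceSystem (Develops L₁), h.graph.Connected)
    (hconn₂ : ∀ h : IsFaceSystem (Develops L₂), h.graph.Connected)
    {g₁ g₂ : ℕ}
    (hg₁ : (18 * m : ℤ) - m * (3 * L₁.length) = 12 - 12 * (g₁ : ℤ))
    (hg₂ : (18 * m : ℤ) - m * (3 * L₂.length) = 12 - 12 * (g₂ : ℤ)) :
    HasTriangularBiembedding (SimpleGraph.completeGraph W) g₁ g₂ := by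
  obtain ⟨hnd, hloop⟩ := arcs_nodup_of_cover (L := L₁ ++ L₂) (by simpa using hlen)
    fun c x d h => (mem_arcs_append _).2 (hcov c x d h)
  -- Distinctness in the joint list also makes the two graphs edge-disjoint.
  have hnd' : (arcs L₁ ++ arcs L₂).Nodup := arcs_append_perm.nodup_iff.1 hnd
  obtain ⟨hn₁, hn₂, hdisj⟩ := List.nodup_append'.1 hnd'
  have h₁ : IsFaceSystem (Develops L₁) := isFaceSystem_develops hn₁
    (fun c hc => hloop c ((mem_arcs_append _).2 (Or.inl hc))) hrev₁ hlink₁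
  have h₂ : IsFaceSystem (Develops L₂) := isFaceSystem_develops hn₂
    (fun c hc => hloop c ((mem_arcs_append _).2 (Or.inr hc))) hrev₂ hlink₂
  have hcard : Nat.card (ZMod m × Fin 3) = m * 3 := by
    rw [Nat.card_prod, Nat.card_zmod, Nat.card_eq_fintype_card, Fintype.card_fin]
  refine hasTriangularBiembedding_of_isFaceSystem e h₁ h₂ ?_ ?_ (hconn₁ h₁) (hconn₂ h₂) ?_ ?_
  · intro a b hab
    have := hcov a.2 (b.1 - a.1) b.2 (by
      rintro ⟨h1, h2⟩
      exact hab (Prod.ext (sub_eq_zero.1 h2).symm h1))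
    exact this.imp develops_iff_mem_arcs.2 develops_iff_mem_arcs.2
  · intro a b h1 h2
    exact hdisj (develops_iff_mem_arcs.1 h1) (develops_iff_mem_arcs.1 h2)
  · rw [natCard_dart_develops h₁ hn₁, hcard]
    push_cast
    linarith
  · rw [natCard_dart_develops h₂ hn₂, hcard]
    push_cast
    linarith

end Develop

/-! ### Label paths, and propagation of a relation along chains and ladders. -/

section Pairs

variable {α β : Type*}

/-- The pairs of consecutive entries of a list. -/
def pairs : List α → List (α × α)
  | a :: b :: l => (a, b) :: pairs (b :: l)
  | _ => []

@[simp] theorem pairs_nil : pairs ([] : List α) = [] := rfl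
@[simp] theorem pairs_singleton (a : α) : pairs [a] = [] := rfl
@[simp] theorem pairs_cons_cons (a b : α) (l : List α) :
    pairs (a :: b :: l) = (a, b) :: pairs (b :: l) := rfl

theorem length_pairs (l : List α) : (pairs l).length = l.length - 1 := by
  induction l with
  | nil => rfl
  | cons a l ih =>
    cases l with
    | nil => rfl
    | cons b l => simpa using ih

theorem mem_of_mem_pairs {l : List α} {p q : α} (h : (p, q) ∈ pairs l) : p ∈ l ∧ q ∈ l := by
  induction l with
  | nil => simp at h
  | cons a l ih =>
    cases l with
    | nil => simp at h
    | cons b l =>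
      rw [pairs_cons_cons, List.mem_cons] at h
      rcases h with h | h
      · simp only [Prod.mk.injEq] at h
        simp [h.1, h.2]
      · exact ⟨List.mem_cons_of_mem _ (ih h).1, List.mem_cons_of_mem _ (ih h).2⟩

theorem eq_or_pairs_fst {l : List α} {x g : α} (hg : l.getLast? = some g) (hx : x ∈ l) :
    x = g ∨ ∃ q, (x, q) ∈ pairs l := by
  induction l with
  | nil => simp at hx
  | cons a l ih =>
    cases l with
    | nil => simp at hg hx; left; rw [hx, hg]
    | cons b l =>
      rcases List.mem_cons.1 hx with rfl | hx
      · exact Or.inr ⟨b, by simp⟩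
      · rcases ih (by simpa using hg) hx with h | ⟨q, hq⟩
        · exact Or.inl h
        · exact Or.inr ⟨q, by simp [hq]⟩

theorem eq_or_pairs_snd {l : List α} {x e : α} (he : l.head? = some e) (hx : x ∈ l) :
    x = e ∨ ∃ p, (p, x) ∈ pairs l := by
  induction l generalizing e with
  | nil => simp at hx
  | cons a l ih =>
    rcases List.mem_cons.1 hx with rfl | hx
    · left; simpa using he
    · right
      cases l with
      | nil => simp at hx
      | cons b l =>
        rcases ih (e := b) rfl hx with h | ⟨p, hp⟩
        · exact ⟨a, by simp [h]⟩
        · exact ⟨p, by simp [hp]⟩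

theorem exists_pairs_of_head {l : List α} {e : α} (he : l.head? = some e) (h : 2 ≤ l.length) :
    ∃ q, (e, q) ∈ pairs l := by
  match l, he, h with
  | a :: b :: l, he, _ =>
    simp only [List.head?_cons, Option.some.injEq] at he
    exact ⟨b, by simp [he]⟩

theorem exists_pairs_of_getLast {l : List α} {g : α} (hg : l.getLast? = some g)
    (h : 2 ≤ l.length) : ∃ p, (p, g) ∈ pairs l := by
  induction l with
  | nil => simp at h
  | cons a l ih =>
    match l, hg, h, ih with
    | [b], hg, _, _ =>
      have : b = g := by simpa using hg
      exact ⟨a, by simp [this]⟩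
    | b :: c :: l, hg, _, ih =>
      obtain ⟨p, hp⟩ := ih (by simpa using hg) (by simp)
      exact ⟨p, by rw [pairs_cons_cons]; exact List.mem_cons_of_mem _ hp⟩

theorem mem_of_head {l : List α} {e : α} (he : l.head? = some e) : e ∈ l :=
  List.mem_of_head? he

theorem mem_of_last {l : List α} {e : α} (he : l.getLast? = some e) : e ∈ l :=
  List.mem_of_getLast? he

variable {r : β → β → Prop} (hr : Equivalence r)
include hr

/-- Models the part of a link in which a path contributes a single side. -/
theorem chain_rel {l : List α} {U : α → β} (h : ∀ p q, (p, q) ∈ pairs l → r (U p) (U q)) {e x : α}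
    (he : l.head? = some e) (hx : x ∈ l) : r (U x) (U e) := by
  induction l generalizing e with
  | nil => simp at hx
  | cons a l ih =>
    have : a = e := by simpa using he
    subst this
    rcases List.mem_cons.1 hx with rfl | hx
    · exact hr.refl _
    · cases l with
      | nil => simp at hx
      | cons b l =>
        exact hr.trans (ih (fun p q hpq => h p q (by simp [hpq])) rfl hx)
          (hr.symm (h a b (by simp)))

/-- Models the link in the class of the rungs. Each rung is crossed once in each direction, so every
pair of the path swaps the two sides of the ladder, and two crossing strands result. -/
theorem ladder_rel {l : List α} {U D : α → β}
    (h : ∀ p q, (p, q) ∈ pairs l → r (U p) (D q) ∧ r (U q) (D p)) {e x : α}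
    (he : l.head? = some e) (hx : x ∈ l) :
    (r (U x) (U e) ∧ r (D x) (D e)) ∨ (r (U x) (D e) ∧ r (D x) (U e)) := by
  induction l generalizing e with
  | nil => simp at hx
  | cons a l ih =>
    have : a = e := by simpa using he
    subst this
    rcases List.mem_cons.1 hx with rfl | hx
    · exact Or.inl ⟨hr.refl _, hr.refl _⟩
    · cases l with
      | nil => simp at hx
      | cons b l =>
        obtain ⟨h1, h2⟩ := h a b (by simp)
        rcases ih (fun p q hpq => h p q (by simp [hpq])) rfl hx with ⟨h3, h4⟩ | ⟨h3, h4⟩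
        · exact Or.inr ⟨hr.trans h3 h2, hr.trans h4 (hr.symm h1)⟩
        · exact Or.inl ⟨hr.trans h3 (hr.symm h1), hr.trans h4 h2⟩

/-- A path with an odd number of entries swaps the sides an even number of times. The parity
therefore decides which ends of the two strands correspond. -/
theorem ladder_last {l : List α} {U D : α → β}
    (h : ∀ p q, (p, q) ∈ pairs l → r (U p) (D q) ∧ r (U q) (D p)) {e g : α}
    (he : l.head? = some e) (hg : l.getLast? = some g) :
    (Odd l.length → r (U g) (U e) ∧ r (D g) (D e)) ∧
      (Even l.length → r (U g) (D e) ∧ r (D g) (U e)) := by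
  induction l generalizing e with
  | nil => simp at he
  | cons a l ih =>
    have : a = e := by simpa using he
    subst this
    cases l with
    | nil =>
      have : a = g := by simpa using hg
      subst this
      exact ⟨fun _ => ⟨hr.refl _, hr.refl _⟩, fun h => by simp at h⟩
    | cons b l =>
      obtain ⟨h1, h2⟩ := h a b (by simp)
      obtain ⟨h3, h4⟩ := ih (fun p q hpq => h p q (by simp [hpq])) rfl (by simpa using hg)
      constructor
      · intro hl
        obtain ⟨h5, h6⟩ := h4 (by
          rw [List.length_cons] at hl
          exact (Nat.odd_add_one.1 hl |> Nat.not_odd_iff_even.1))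
        exact ⟨hr.trans h5 (hr.symm h1), hr.trans h6 h2⟩
      · intro hl
        obtain ⟨h5, h6⟩ := h3 (by
          rw [List.length_cons] at hl
          exact (Nat.even_add_one.1 hl |> Nat.not_even_iff_odd.1))
        exact ⟨hr.trans h5 h2, hr.trans h6 (hr.symm h1)⟩

end Pairs

/-! ### Triangles with two vertices in one class; a connectivity criterion. -/

section Strips

variable {m : ℕ}

/-- A triangle with one vertex of class `c` and two of class `d`. -/
def farFace (c d : Fin 3) (p q : ZMod m) :
    (ZMod m × Fin 3) × (ZMod m × Fin 3) × (ZMod m × Fin 3) := ((0, c), (p, d), (q, d))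

/-- A triangle with two vertices of class `c` and one of class `d`. -/
def nearFace (c d : Fin 3) (p q : ZMod m) :
    (ZMod m × Fin 3) × (ZMod m × Fin 3) × (ZMod m × Fin 3) := ((0, c), (p, d), (p - q, c))

variable {L : List ((ZMod m × Fin 3) × (ZMod m × Fin 3) × (ZMod m × Fin 3))}

theorem corner_of_mem {x y z} (h : (x, y, z) ∈ L) :
    (x, y, z) ∈ corners L ∧ (y, z, x) ∈ corners L ∧ (z, x, y) ∈ corners L := by
  have h1 : (x, y, z) ∈ corners L := by simp [corners, h]
  have h2 := corners_rotate h1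
  exact ⟨h1, h2, corners_rotate h2⟩

theorem arcs_of_mem {x y z} (h : (x, y, z) ∈ L) :
    arcOf x y ∈ arcs L ∧ arcOf y z ∈ arcs L ∧ arcOf z x ∈ arcs L := by
  obtain ⟨h1, h2, h3⟩ := corner_of_mem h
  exact ⟨mem_arcs_of_corner h1, mem_arcs_of_corner h2, mem_arcs_of_corner h3⟩

theorem link_of_mem {x y z} (h : (x, y, z) ∈ L) :
    Relation.EqvGen (LinkStep L x.2) (z.1 - x.1, z.2) (y.1 - x.1, y.2) ∧
    Relation.EqvGen (LinkStep L y.2) (x.1 - y.1, x.2) (z.1 - y.1, z.2) ∧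
    Relation.EqvGen (LinkStep L z.2) (y.1 - z.1, y.2) (x.1 - z.1, x.2) := by
  obtain ⟨h1, h2, h3⟩ := corner_of_mem h
  exact ⟨.rel _ _ ⟨_, h3, rfl, rfl, rfl⟩, .rel _ _ ⟨_, h1, rfl, rfl, rfl⟩,
    .rel _ _ ⟨_, h2, rfl, rfl, rfl⟩⟩

theorem arcs_farFace {c d : Fin 3} {p q : ZMod m} (h : farFace c d p q ∈ L) :
    (c, p, d) ∈ arcs L ∧ (d, q - p, d) ∈ arcs L ∧ (d, -q, c) ∈ arcs L := by
  simpa [arcOf] using arcs_of_mem h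

theorem arcs_nearFace {c d : Fin 3} {p q : ZMod m} (h : nearFace c d p q ∈ L) :
    (c, p, d) ∈ arcs L ∧ (d, -q, c) ∈ arcs L ∧ (c, q - p, c) ∈ arcs L := by
  simpa [arcOf] using arcs_of_mem h

/-- At the vertex of class `c` the face moves along the path; at its two vertices of class `d` it
leads to the rung, seen from either end. For `nearFace` the roles of the classes are exchanged. -/
theorem link_farFace {c d : Fin 3} {p q : ZMod m} (h : farFace c d p q ∈ L) :
    Relation.EqvGen (LinkStep L c) (p, d) (q, d) ∧
    Relation.EqvGen (LinkStep L d) (-p, c) (q - p, d) ∧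
    Relation.EqvGen (LinkStep L d) (p - q, d) (-q, c) := by
  obtain ⟨h1, h2, h3⟩ := link_of_mem h
  exact ⟨.symm _ _ (by simpa using h1), by simpa using h2, by simpa using h3⟩

theorem link_nearFace {c d : Fin 3} {p q : ZMod m} (h : nearFace c d p q ∈ L) :
    Relation.EqvGen (LinkStep L d) (-p, c) (-q, c) ∧
    Relation.EqvGen (LinkStep L c) (p - q, c) (p, d) ∧
    Relation.EqvGen (LinkStep L c) (q, d) (q - p, c) := by
  obtain ⟨h1, h2, h3⟩ := link_of_mem h
  exact ⟨by simpa using h2, by simpa using h1, by simpa using h3⟩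

/-- The arcs of a translation invariant graph with three classes of vertices, given by its labels
`A`, `B`, `C` from classes `0` to `1`, `1` to `2` and `2` to `0`, and by the
differences `R c` inside the classes. -/
inductive ArcSpec (A B C : ZMod m → Prop) (R : Fin 3 → ZMod m → Prop) :
    Fin 3 → ZMod m → Fin 3 → Prop
  | a01 {p} : A p → ArcSpec A B C R 0 p 1
  | a10 {p} : A p → ArcSpec A B C R 1 (-p) 0
  | a12 {p} : B p → ArcSpec A B C R 1 p 2
  | a21 {p} : B p → ArcSpec A B C R 2 (-p) 1
  | a20 {p} : C p → ArcSpec A B C R 2 p 0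
  | a02 {p} : C p → ArcSpec A B C R 0 (-p) 2
  | rung {c p} : R c p → ArcSpec A B C R c p c
  | rung' {c p} : R c p → ArcSpec A B C R c (-p) c

theorem ArcSpec.reverse {A B C : ZMod m → Prop} {R : Fin 3 → ZMod m → Prop} {c x d}
    (h : ArcSpec A B C R c x d) : ArcSpec A B C R d (-x) c := by
  cases h with
  | a01 h => exact .a10 h
  | a10 h => rw [neg_neg]; exact .a01 h
  | a12 h => exact .a21 h
  | a21 h => rw [neg_neg]; exact .a12 h
  | a20 h => exact .a02 h
  | a02 h => rw [neg_neg]; exact .a20 h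
  | rung h => exact .rung' h
  | rung' h => rw [neg_neg]; exact .rung h

theorem mem_arcs_iff {o} : o ∈ arcs L ↔
    ∃ x y z, (x, y, z) ∈ L ∧ (o = arcOf x y ∨ o = arcOf y z ∨ o = arcOf z x) := by
  constructor
  · intro h
    obtain ⟨T, hT, rfl⟩ := List.mem_map.1 h
    simp only [corners, List.mem_append, List.mem_map] at hT
    rcases hT with (hS | ⟨S, hS, rfl⟩) | ⟨S, hS, rfl⟩
    · exact ⟨_, _, _, hS, Or.inl rfl⟩
    · exact ⟨_, _, _, hS, Or.inr (Or.inl rfl)⟩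
    · exact ⟨_, _, _, hS, Or.inr (Or.inr rfl)⟩
  · rintro ⟨x, y, z, h, rfl | rfl | rfl⟩
    · exact (arcs_of_mem h).1
    · exact (arcs_of_mem h).2.1
    · exact (arcs_of_mem h).2.2

/-- A translation invariant graph is connected if one of its classes has the difference one
and vertices of this class have neighbours in the two other classes. -/
theorem connected_of_arcs [NeZero m] (h : IsFaceSystem (Develops L)) {c d e : Fin 3}
    (hcde : ∀ k, k = c ∨ k = d ∨ k = e) {x y z : ZMod m}
    (hx : x = 1 ∨ x = -1) (h1 : (c, x, c) ∈ arcs L) (h2 : (c, y, d) ∈ arcs L)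
    (h3 : (c, z, e) ∈ arcs L) : h.graph.Connected := by
  have adj : ∀ {c x d} t, (c, x, d) ∈ arcs L → h.graph.Adj (t, c) (t + x, d) := by
    intro c x d t ht
    exact develops_iff_mem_arcs.2 (by simpa [arcOf] using ht)
  have hstep : ∀ t, h.graph.Reachable (t, c) (t + 1, c) := by
    intro t
    rcases hx with rfl | rfl
    · exact (adj t h1).reachable
    · have := (adj (t + 1) h1).reachable
      rw [add_neg_cancel_right] at this
      exact this.symm
  have hnat : ∀ n : ℕ, h.graph.Reachable (0, c) ((n : ZMod m), c) := by
    intro n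
    induction n with
    | zero => simp
    | succ n ih => push_cast; exact ih.trans (hstep _)
  have hc : ∀ t, h.graph.Reachable (0, c) (t, c) := by
    intro t
    rw [← ZMod.natCast_zmod_val t]
    exact hnat _
  have hall : ∀ v, h.graph.Reachable (0, c) v := by
    rintro ⟨t, k⟩
    rcases hcde k with rfl | rfl | rfl
    · exact hc t
    · have := (adj (t - y) h2).reachable
      rw [sub_add_cancel] at this
      exact (hc _).trans this
    · have := (adj (t - z) h3).reachable
      rw [sub_add_cancel] at this
      exact (hc _).trans this
  have : Nonempty (ZMod m × Fin 3) := ⟨(0, c)⟩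
  exact ⟨fun u v => (hall u).symm.trans (hall v)⟩

end Strips

/-! ### The two patterns of base triangles. -/

section Template

variable {m : ℕ}

/-- The differences of consecutive entries of a list. -/
def IsRung (l : List (ZMod m)) (x : ZMod m) : Prop := ∃ p q, (p, q) ∈ pairs l ∧ x = q - p

/-- The triangles generating the first graph. -/
def openFaces (P₀ P₁ : List (ZMod m)) (e f g : ZMod m) :
    List ((ZMod m × Fin 3) × (ZMod m × Fin 3) × (ZMod m × Fin 3)) :=
  (pairs P₁).map (fun x => farFace 0 1 x.1 x.2) ++
  ((pairs P₀).map (fun x => nearFace 0 1 x.1 x.2) ++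
  ((pairs P₁).map (fun x => nearFace 1 2 (x.2 + -(f + e + g)) (x.1 + -(f + e + g))) ++
  ((pairs P₀).map (fun x => farFace 2 0 x.2 x.1) ++
  [((0, 0), (g, 1), (-e, 2)), ((0, 0), (-g, 2), (f, 1))])))

/-- The triangles generating the second graph. -/
def closedFaces (Q₁ Q₂ : List (ZMod m)) (a b o τ : ZMod m) :
    List ((ZMod m × Fin 3) × (ZMod m × Fin 3) × (ZMod m × Fin 3)) :=
  (pairs Q₁).map (fun x => farFace 0 1 x.2 x.1) ++
  ((pairs Q₁).map (fun x => nearFace 1 2 (x.1 + o) (x.2 + o)) ++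
  ((pairs Q₂).map (fun x => farFace 1 2 (x.2 + o) (x.1 + o)) ++
  ((pairs Q₂).map (fun x => nearFace 2 0 (x.1 + τ) (x.2 + τ)) ++
  [nearFace 0 1 a b, farFace 2 0 (b + τ) (a + τ)])))

theorem length_openFaces (P₀ P₁ : List (ZMod m)) (e f g : ZMod m) :
    (openFaces P₀ P₁ e f g).length = 2 * (P₀.length - 1) + 2 * (P₁.length - 1) + 2 := by
  simp [openFaces, length_pairs]; ring

theorem length_closedFaces (Q₁ Q₂ : List (ZMod m)) (a b o τ : ZMod m) :
    (closedFaces Q₁ Q₂ a b o τ).length = 2 * (Q₁.length - 1) + 2 * (Q₂.length - 1) + 2 := by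
  simp [closedFaces, length_pairs]; ring

/-- The labels and differences of the first graph. -/
def OpenSpec (P₀ P₁ : List (ZMod m)) (o : ZMod m) : Fin 3 → ZMod m → Fin 3 → Prop :=
  ArcSpec (fun p => p ∈ P₀ ∨ p ∈ P₁) (fun p => p - o ∈ P₁) (fun p => p ∈ P₀)
    (fun c x => c = 0 ∧ IsRung P₀ x ∨ c = 1 ∧ IsRung P₁ x)

/-- The labels and differences of the second graph. -/
def ClosedSpec (Q₁ Q₂ : List (ZMod m)) (a b o τ : ZMod m) : Fin 3 → ZMod m → Fin 3 → Prop :=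
  ArcSpec (fun p => p ∈ Q₁) (fun p => p - o ∈ Q₁ ∨ p - o ∈ Q₂) (fun p => p - τ ∈ Q₂)
    (fun c x => c = 0 ∧ x = b - a ∨ c = 1 ∧ IsRung Q₁ x ∨ c = 2 ∧ IsRung Q₂ x)

/-! ### The first graph: label paths with free ends. -/

section Open

variable {P₀ P₁ : List (ZMod m)} {e f g : ZMod m}

theorem openFaces_mem :
    (∀ p q, (p, q) ∈ pairs P₁ → farFace 0 1 p q ∈ openFaces P₀ P₁ e f g ∧
      nearFace 1 2 (q + -(f + e + g)) (p + -(f + e + g)) ∈ openFaces P₀ P₁ e f g) ∧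
    (∀ p q, (p, q) ∈ pairs P₀ → nearFace 0 1 p q ∈ openFaces P₀ P₁ e f g ∧
      farFace 2 0 q p ∈ openFaces P₀ P₁ e f g) ∧
    ((0, 0), (g, 1), (-e, 2)) ∈ openFaces P₀ P₁ e f g ∧
    ((0, 0), (-g, 2), (f, 1)) ∈ openFaces P₀ P₁ e f g := by
  simp only [openFaces, List.mem_append, List.mem_map, List.mem_cons]
  refine ⟨fun p q h => ⟨Or.inl ⟨_, h, rfl⟩, ?_⟩, fun p q h => ⟨?_, ?_⟩, ?_, ?_⟩
  · exact Or.inr (Or.inr (Or.inl ⟨_, h, rfl⟩))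
  · exact Or.inr (Or.inl ⟨_, h, rfl⟩)
  · exact Or.inr (Or.inr (Or.inr (Or.inl ⟨_, h, rfl⟩)))
  · simp
  · simp

/-- A pair covers one of its labels in one direction and the other in the opposite direction.
Between classes 0 and 1 the labels form a single path f, …, e, …, g, namely P₁ followed by P₀;
between the other classes P₁ and P₀ run backwards. The directions missing at the ends are supplied
by the two triangles meeting all three classes. The shift −(f + e + g) makes the labels around both
of them sum to zero. -/
theorem arcs_openFaces (h0e : P₀.head? = some e) (h0g : P₀.getLast? = some g)
    (h1f : P₁.head? = some f) (h1e : P₁.getLast? = some e) (c x d) :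
    (c, x, d) ∈ arcs (openFaces P₀ P₁ e f g) ↔ OpenSpec P₀ P₁ (-(f + e + g)) c x d := by
  obtain ⟨hP1, hP0, hc1, hc2⟩ := openFaces_mem (P₀ := P₀) (P₁ := P₁) (e := e) (f := f) (g := g)
  have he0 := mem_of_head h0e
  have hg0 := mem_of_last h0g
  have hf1 := mem_of_head h1f
  have he1 := mem_of_last h1e
  have a1 := arcs_of_mem hc1
  have a2 := arcs_of_mem hc2
  simp only [arcOf, sub_zero, zero_sub, neg_neg] at a1 a2
  constructor
  · intro h
    obtain ⟨X, Y, Z, hm, ho⟩ := mem_arcs_iff.1 h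
    simp only [openFaces, List.mem_append, List.mem_map, List.mem_cons, Prod.exists,
      List.not_mem_nil, or_false, farFace, nearFace, Prod.mk.injEq] at hm
    have key : ∀ {c x d c' x' d'}, (c, x, d) = (c', x', d') → OpenSpec P₀ P₁ (-(f + e + g)) c' x' d' →
        OpenSpec P₀ P₁ (-(f + e + g)) c x d := by
      intro c x d c' x' d' h h'
      simp only [Prod.mk.injEq] at h
      rw [h.1, h.2.1, h.2.2]; exact h'
    rcases hm with ⟨p, q, hpq, rfl, rfl, rfl⟩ | ⟨p, q, hpq, rfl, rfl, rfl⟩ |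
      ⟨p, q, hpq, rfl, rfl, rfl⟩ | ⟨p, q, hpq, rfl, rfl, rfl⟩ | ⟨rfl, rfl, rfl⟩ | ⟨rfl, rfl, rfl⟩
    · obtain ⟨hp, hq⟩ := mem_of_mem_pairs hpq
      rcases ho with ho | ho | ho <;> refine key ho ?_ <;> simp only [sub_zero, zero_sub]
      · exact .a01 (Or.inr hp)
      · exact .rung (Or.inr ⟨rfl, p, q, hpq, rfl⟩)
      · exact .a10 (Or.inr hq)
    · obtain ⟨hp, hq⟩ := mem_of_mem_pairs hpq
      rcases ho with ho | ho | ho <;> refine key ho ?_ <;> simp only [sub_zero, zero_sub]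
      · exact .a01 (Or.inl hp)
      · rw [sub_sub_cancel_left]; exact .a10 (Or.inl hq)
      · exact .rung (Or.inl ⟨rfl, p, q, hpq, by ring⟩)
    · obtain ⟨hp, hq⟩ := mem_of_mem_pairs hpq
      rcases ho with ho | ho | ho <;> refine key ho ?_ <;> simp only [sub_zero, zero_sub]
      · exact .a12 (by simpa using hq)
      · rw [sub_sub_cancel_left]; exact .a21 (by simpa using hp)
      · rw [show -(q + -(f + e + g) - (p + -(f + e + g))) = -(q - p) by ring]
        exact .rung' (Or.inr ⟨rfl, p, q, hpq, rfl⟩)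
    · obtain ⟨hp, hq⟩ := mem_of_mem_pairs hpq
      rcases ho with ho | ho | ho <;> refine key ho ?_ <;> simp only [sub_zero, zero_sub]
      · exact .a20 hq
      · rw [← neg_sub]
        exact .rung' (Or.inl ⟨rfl, p, q, hpq, rfl⟩)
      · exact .a02 hp
    · rcases ho with ho | ho | ho <;> refine key ho ?_ <;> simp only [sub_zero, zero_sub, neg_neg]
      · exact .a01 (Or.inl hg0)
      · exact .a12 (by rw [show -e - g - -(f + e + g) = f by ring]; exact hf1)
      · exact .a20 he0
    · rcases ho with ho | ho | ho <;> refine key ho ?_ <;> simp only [sub_zero, zero_sub]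
      · exact .a02 hg0
      · have : f - -g = -(e + -(f + e + g)) := by ring
        rw [this]
        exact .a21 (by simpa using he1)
      · exact .a10 (Or.inr hf1)
  · intro h
    cases h with
    | a01 h =>
      rcases h with h | h
      · rcases eq_or_pairs_fst h0g h with rfl | ⟨q, hq⟩
        · exact a1.1
        · exact (arcs_nearFace (hP0 _ _ hq).1).1
      · rcases eq_or_pairs_fst h1e h with h | ⟨q, hq⟩
        -- The label e ends P₁ and begins P₀, so its arc lies on a triangle of P₀, or on the joining
        -- triangle if e = g.
        · rcases eq_or_pairs_fst h0g he0 with h3 | ⟨q, hq⟩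
          · rw [h.trans h3]; exact a1.1
          · rw [h]; exact (arcs_nearFace (hP0 _ _ hq).1).1
        · exact (arcs_farFace (hP1 _ _ hq).1).1
    | a10 h =>
      have h1 : ∀ x ∈ P₁, ((1, -x, 0) : Fin 3 × ZMod m × Fin 3) ∈ arcs (openFaces P₀ P₁ e f g) := by
        intro x h
        rcases eq_or_pairs_snd h1f h with rfl | ⟨p, hp⟩
        · exact a2.2.2
        · exact (arcs_farFace (hP1 _ _ hp).1).2.2
      rcases h with h | h
      · rcases eq_or_pairs_snd h0e h with rfl | ⟨p, hp⟩
        · exact h1 _ he1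
        · exact (arcs_nearFace (hP0 _ _ hp).1).2.1
      · exact h1 _ h
    | a12 h =>
      rcases eq_or_pairs_snd h1f h with h | ⟨p, hp⟩
      · have : x = -e - g := by linear_combination h
        rw [this]; exact a1.2.1
      · have := (arcs_nearFace (hP1 _ _ hp).2).1
        rwa [sub_add_cancel] at this
    | @a21 p h =>
      rcases eq_or_pairs_fst h1e h with h | ⟨q, hq⟩
      · have : -p = f - -g := by linear_combination -h
        rw [this]; exact a2.2.1
      · have := (arcs_nearFace (hP1 _ _ hq).2).2.1
        rwa [sub_add_cancel] at this
    | a20 h =>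
      rcases eq_or_pairs_snd h0e h with rfl | ⟨p, hp⟩
      · exact a1.2.2
      · exact (arcs_farFace (hP0 _ _ hp).2).1
    | a02 h =>
      rcases eq_or_pairs_fst h0g h with rfl | ⟨q, hq⟩
      · exact a2.1
      · exact (arcs_farFace (hP0 _ _ hq).2).2.2
    | rung h =>
      rcases h with ⟨rfl, p, q, hpq, rfl⟩ | ⟨rfl, p, q, hpq, rfl⟩
      · exact (arcs_nearFace (hP0 _ _ hpq).1).2.2
      · exact (arcs_farFace (hP1 _ _ hpq).1).2.1
    | rung' h =>
      rcases h with ⟨rfl, p, q, hpq, rfl⟩ | ⟨rfl, p, q, hpq, rfl⟩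
      · rw [neg_sub]; exact (arcs_farFace (hP0 _ _ hpq).2).2.1
      · have := (arcs_nearFace (hP1 _ _ hpq).2).2.2
        rwa [show p + -(f + e + g) - (q + -(f + e + g)) = -(q - p) by ring] at this

/-- In class 0 the path P₀ is a ladder and P₁ a chain, and in class 1 the reverse. As the ladder has
odd length, each of its strands ends on the side where it started, so a joining triangle between
opposite ends ties the two strands together. The chain shares the label e with the ladder. -/
theorem link_openFaces (h0e : P₀.head? = some e) (h0g : P₀.getLast? = some g)
    (h1f : P₁.head? = some f) (h1e : P₁.getLast? = some e)
    (h0 : Odd P₀.length) (h1 : Odd P₁.length) (k : Fin 3) :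
    ∃ u, ∀ x d, OpenSpec P₀ P₁ (-(f + e + g)) k x d →
      Relation.EqvGen (LinkStep (openFaces P₀ P₁ e f g) k) (x, d) u := by
  obtain ⟨hP1, hP0, hc1, hc2⟩ := openFaces_mem (P₀ := P₀) (P₁ := P₁) (e := e) (f := f) (g := g)
  have l1 := link_of_mem hc1
  have l2 := link_of_mem hc2
  simp only [sub_zero, zero_sub, neg_neg] at l1 l2
  have he0 := mem_of_head h0e
  have hg0 := mem_of_last h0g
  have hf1 := mem_of_head h1f
  have he1 := mem_of_last h1e
  have hk : k = 0 ∨ k = 1 ∨ k = 2 := by revert k; decide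
  have E := Relation.EqvGen.is_equivalence (LinkStep (openFaces P₀ P₁ e f g) k)
  generalize hr : Relation.EqvGen (LinkStep (openFaces P₀ P₁ e f g) k) = r at E ⊢
  rcases hk with rfl | rfl | rfl
  · have hn := fun p q (hpq : (p, q) ∈ pairs P₀) => link_nearFace (hP0 p q hpq).1
    have hf := fun p q (hpq : (p, q) ∈ pairs P₀) => link_farFace (hP0 p q hpq).2
    have hU1 := fun p q (hpq : (p, q) ∈ pairs P₁) => (link_farFace (hP1 p q hpq).1).1
    replace l1 := l1.1
    replace l2 := l2.1
    simp only [hr] at hn hf hU1 l1 l2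
    have hl : ∀ p q, (p, q) ∈ pairs P₀ → r (p, 1) (-q, 2) ∧ r (q, 1) (-p, 2) := fun p q hpq =>
      ⟨E.trans (E.symm (hn p q hpq).2.1) (E.symm (hf p q hpq).2.1),
        E.trans (hn p q hpq).2.2 (hf p q hpq).2.2⟩
    have hge := (ladder_last E (U := fun p => (p, 1)) (D := fun p => (-p, 2)) hl h0e h0g).1 h0
    have hDe : r (-e, 2) (e, 1) := E.trans l1 hge.1
    have hP : ∀ x ∈ P₀, r (x, 1) (e, 1) ∧ r (-x, 2) (e, 1) := by
      intro x hx
      rcases ladder_rel E (U := fun p => (p, 1)) (D := fun p => (-p, 2)) hl h0e hx with h | h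
      · exact ⟨h.1, E.trans h.2 hDe⟩
      · exact ⟨E.trans h.1 hDe, h.2⟩
    have hP' : ∀ x ∈ P₁, r (x, 1) (e, 1) := by
      intro x hx
      have h2 := fun {x} hx => chain_rel E (x := x) (U := fun p => (p, 1)) hU1 h1f hx
      exact E.trans (h2 hx) (E.symm (h2 he1))
    refine ⟨(e, 1), fun x d h => ?_⟩
    cases h with
    | a01 h => exact h.elim (fun h => (hP _ h).1) (hP' _)
    | a02 h => exact (hP _ h).2
    | rung h =>
      rcases h with ⟨-, p, q, hpq, rfl⟩ | ⟨h, -⟩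
      · exact E.trans (E.symm (hn p q hpq).2.2) (hP q (mem_of_mem_pairs hpq).2).1
      · exact absurd h (by decide)
    | rung' h =>
      rcases h with ⟨-, p, q, hpq, rfl⟩ | ⟨h, -⟩
      · rw [neg_sub]
        exact E.trans (hn p q hpq).2.1 (hP p (mem_of_mem_pairs hpq).1).1
      · exact absurd h (by decide)
  · have hn := fun p q (hpq : (p, q) ∈ pairs P₁) => link_nearFace (hP1 p q hpq).2
    have hf := fun p q (hpq : (p, q) ∈ pairs P₁) => link_farFace (hP1 p q hpq).1
    have hD0 := fun p q (hpq : (p, q) ∈ pairs P₀) => (link_nearFace (hP0 p q hpq).1).1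
    replace l1 := l1.2.1
    replace l2 := l2.2.2
    simp only [hr, add_sub_add_right_eq_sub] at hn hf hD0 l1 l2
    have hl : ∀ p q, (p, q) ∈ pairs P₁ →
        r (p + -(f + e + g), 2) (-q, 0) ∧ r (q + -(f + e + g), 2) (-p, 0) := fun p q hpq =>
      ⟨E.trans (hn p q hpq).2.2 (hf p q hpq).2.2,
        E.trans (E.symm (hn p q hpq).2.1) (E.symm (hf p q hpq).2.1)⟩
    have hfe := (ladder_last E (U := fun p => (p + -(f + e + g), 2)) (D := fun p => (-p, 0))
      hl h1f h1e).1 h1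
    have hDf : r (-f, 0) (f + -(f + e + g), 2) := by
      rw [show -g - f = e + -(f + e + g) by ring] at l2
      exact E.trans (E.symm l2) hfe.1
    have hP : ∀ x ∈ P₁, r (x + -(f + e + g), 2) (-f, 0) ∧ r (-x, 0) (-f, 0) := by
      intro x hx
      rcases ladder_rel E (U := fun p => (p + -(f + e + g), 2)) (D := fun p => (-p, 0)) hl h1f hx
        with h | h
      · exact ⟨E.trans h.1 (E.symm hDf), h.2⟩
      · exact ⟨h.1, E.trans h.2 (E.symm hDf)⟩
    have hP' : ∀ x ∈ P₀, r (-x, 0) (-f, 0) := by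
      intro x hx
      have h2 := chain_rel E (x := x) (U := fun p => (-p, 0)) hD0 h0e hx
      exact E.trans h2 hfe.2
    refine ⟨(-f, 0), fun x d h => ?_⟩
    cases h with
    | a10 h => exact h.elim (hP' _) (fun h => (hP _ h).2)
    | a12 h =>
      have := (hP _ h).1
      rwa [sub_add_cancel] at this
    | rung h =>
      rcases h with ⟨h, -⟩ | ⟨-, p, q, hpq, rfl⟩
      · exact absurd h (by decide)
      · exact E.trans (E.symm (hf p q hpq).2.1) (hP p (mem_of_mem_pairs hpq).1).2
    | rung' h =>
      rcases h with ⟨h, -⟩ | ⟨-, p, q, hpq, rfl⟩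
      · exact absurd h (by decide)
      · rw [neg_sub]
        exact E.trans (hf p q hpq).2.2 (hP q (mem_of_mem_pairs hpq).2).2
  -- Class 2 has no rungs in this graph; its link consists of two chains connected through a joining
  -- triangle.
  · have hU := fun p q (hpq : (p, q) ∈ pairs P₀) => (link_farFace (hP0 p q hpq).2).1
    have hD := fun p q (hpq : (p, q) ∈ pairs P₁) => (link_nearFace (hP1 p q hpq).2).1
    replace l1 := l1.2.2
    simp only [hr] at hU hD l1
    have hfe : r (-(f + -(f + e + g)), 1) (e, 0) := by
      rwa [show g - -e = -(f + -(f + e + g)) by ring] at l1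
    refine ⟨(e, 0), fun x d h => ?_⟩
    cases h with
    | a20 h =>
      exact chain_rel E (U := fun p => (p, 0)) (fun p q hpq => E.symm (hU p q hpq)) h0e h
    | a21 h =>
      have := chain_rel E (U := fun p => (-(p + -(f + e + g)), 1))
        (fun p q hpq => E.symm (hD p q hpq)) h1f h
      simp only [sub_add_cancel] at this
      exact E.trans this hfe
    | rung h => rcases h with ⟨h, -⟩ | ⟨h, -⟩ <;> exact absurd h (by decide)
    | rung' h => rcases h with ⟨h, -⟩ | ⟨h, -⟩ <;> exact absurd h (by decide)

end Open

/-! ### The second graph: label paths closed into cycles. -/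

section Closed

variable {Q₁ Q₂ : List (ZMod m)} {a b o τ : ZMod m}

theorem closedFaces_mem :
    (∀ p q, (p, q) ∈ pairs Q₁ → farFace 0 1 q p ∈ closedFaces Q₁ Q₂ a b o τ ∧
      nearFace 1 2 (p + o) (q + o) ∈ closedFaces Q₁ Q₂ a b o τ) ∧
    (∀ p q, (p, q) ∈ pairs Q₂ → farFace 1 2 (q + o) (p + o) ∈ closedFaces Q₁ Q₂ a b o τ ∧
      nearFace 2 0 (p + τ) (q + τ) ∈ closedFaces Q₁ Q₂ a b o τ) ∧
    nearFace 0 1 a b ∈ closedFaces Q₁ Q₂ a b o τ ∧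
    farFace 2 0 (b + τ) (a + τ) ∈ closedFaces Q₁ Q₂ a b o τ := by
  simp only [closedFaces, List.mem_append, List.mem_map, List.mem_cons]
  refine ⟨fun p q h => ⟨Or.inl ⟨_, h, rfl⟩, ?_⟩, fun p q h => ⟨?_, ?_⟩, ?_, ?_⟩
  · exact Or.inr (Or.inl ⟨_, h, rfl⟩)
  · exact Or.inr (Or.inr (Or.inl ⟨_, h, rfl⟩))
  · exact Or.inr (Or.inr (Or.inr (Or.inl ⟨_, h, rfl⟩)))
  · simp
  · simp

/-- Each of the three label sets is arranged in a closed cycle, so every label occurs in both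
directions. Q₁ is closed by the extra rung b − a of class 0, as is Q₂, and between classes 1 and 2
the path Q₁ returns along Q₂. Length at least two gives each of the ends a, b a pair in both paths.
-/
theorem arcs_closedFaces (h1a : Q₁.head? = some a) (h1b : Q₁.getLast? = some b)
    (h2a : Q₂.head? = some a) (h2b : Q₂.getLast? = some b) (h1 : 2 ≤ Q₁.length)
    (h2 : 2 ≤ Q₂.length) (c x d) :
    (c, x, d) ∈ arcs (closedFaces Q₁ Q₂ a b o τ) ↔ ClosedSpec Q₁ Q₂ a b o τ c x d := by
  obtain ⟨hQ1, hQ2, hc1, hc2⟩ := closedFaces_mem (Q₁ := Q₁) (Q₂ := Q₂) (a := a) (b := b)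
    (o := o) (τ := τ)
  have ha1 := mem_of_head h1a
  have hb1 := mem_of_last h1b
  have ha2 := mem_of_head h2a
  have hb2 := mem_of_last h2b
  have a1 := arcs_nearFace hc1
  have a2 := arcs_farFace hc2
  constructor
  · intro h
    obtain ⟨X, Y, Z, hm, ho⟩ := mem_arcs_iff.1 h
    simp only [closedFaces, List.mem_append, List.mem_map, List.mem_cons, Prod.exists,
      List.not_mem_nil, or_false, farFace, nearFace, Prod.mk.injEq] at hm
    have key : ∀ {c x d c' x' d'}, (c, x, d) = (c', x', d') → ClosedSpec Q₁ Q₂ a b o τ c' x' d' →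
        ClosedSpec Q₁ Q₂ a b o τ c x d := by
      intro c x d c' x' d' h h'
      simp only [Prod.mk.injEq] at h
      rw [h.1, h.2.1, h.2.2]; exact h'
    rcases hm with ⟨p, q, hpq, rfl, rfl, rfl⟩ | ⟨p, q, hpq, rfl, rfl, rfl⟩ |
      ⟨p, q, hpq, rfl, rfl, rfl⟩ | ⟨p, q, hpq, rfl, rfl, rfl⟩ | ⟨rfl, rfl, rfl⟩ | ⟨rfl, rfl, rfl⟩
    · obtain ⟨hp, hq⟩ := mem_of_mem_pairs hpq
      rcases ho with ho | ho | ho <;> refine key ho ?_ <;> simp only [sub_zero, zero_sub]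
      · exact .a01 hq
      · rw [← neg_sub]
        exact .rung' (Or.inr (Or.inl ⟨rfl, p, q, hpq, rfl⟩))
      · exact .a10 hp
    · obtain ⟨hp, hq⟩ := mem_of_mem_pairs hpq
      rcases ho with ho | ho | ho <;> refine key ho ?_ <;> simp only [sub_zero, zero_sub]
      · exact .a12 (Or.inl (by simpa using hp))
      · rw [sub_sub_cancel_left]; exact .a21 (Or.inl (by simpa using hq))
      · rw [show -(p + o - (q + o)) = q - p by ring]
        exact .rung (Or.inr (Or.inl ⟨rfl, p, q, hpq, rfl⟩))
    · obtain ⟨hp, hq⟩ := mem_of_mem_pairs hpq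
      rcases ho with ho | ho | ho <;> refine key ho ?_ <;> simp only [sub_zero, zero_sub]
      · exact .a12 (Or.inr (by simpa using hq))
      · rw [show p + o - (q + o) = -(q - p) by ring]
        exact .rung' (Or.inr (Or.inr ⟨rfl, p, q, hpq, rfl⟩))
      · exact .a21 (Or.inr (by simpa using hp))
    · obtain ⟨hp, hq⟩ := mem_of_mem_pairs hpq
      rcases ho with ho | ho | ho <;> refine key ho ?_ <;> simp only [sub_zero, zero_sub]
      · exact .a20 (by simpa using hp)
      · rw [sub_sub_cancel_left]; exact .a02 (by simpa using hq)
      · rw [show -(p + τ - (q + τ)) = q - p by ring]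
        exact .rung (Or.inr (Or.inr ⟨rfl, p, q, hpq, rfl⟩))
    · rcases ho with ho | ho | ho <;> refine key ho ?_ <;> simp only [sub_zero, zero_sub]
      · exact .a01 ha1
      · rw [sub_sub_cancel_left]; exact .a10 hb1
      · rw [neg_sub]; exact .rung (Or.inl ⟨rfl, rfl⟩)
    · rcases ho with ho | ho | ho <;> refine key ho ?_ <;> simp only [sub_zero, zero_sub]
      · exact .a20 (by simpa using hb2)
      · rw [show a + τ - (b + τ) = -(b - a) by ring]; exact .rung' (Or.inl ⟨rfl, rfl⟩)
      · exact .a02 (by simpa using ha2)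
  · intro h
    cases h with
    | a01 h =>
      rcases eq_or_pairs_snd h1a h with rfl | ⟨p, hp⟩
      · exact a1.1
      · exact (arcs_farFace (hQ1 _ _ hp).1).1
    | a10 h =>
      rcases eq_or_pairs_fst h1b h with rfl | ⟨q, hq⟩
      · exact a1.2.1
      · exact (arcs_farFace (hQ1 _ _ hq).1).2.2
    | a12 h =>
      have key : ∀ y ∈ Q₂, y ≠ a → ((1, y + o, 2) : Fin 3 × ZMod m × Fin 3) ∈
          arcs (closedFaces Q₁ Q₂ a b o τ) := by
        intro y hy hya
        rcases eq_or_pairs_snd h2a hy with h | ⟨p, hp⟩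
        · exact absurd h hya
        · exact (arcs_farFace (hQ2 _ _ hp).1).1
      have key' : ∀ y q, (y, q) ∈ pairs Q₁ → ((1, y + o, 2) : Fin 3 × ZMod m × Fin 3) ∈
          arcs (closedFaces Q₁ Q₂ a b o τ) := fun y q hq => (arcs_nearFace (hQ1 _ _ hq).2).1
      have hb : ((1, b + o, 2) : Fin 3 × ZMod m × Fin 3) ∈ arcs (closedFaces Q₁ Q₂ a b o τ) := by
        obtain ⟨p, hp⟩ := exists_pairs_of_getLast h2b h2
        exact (arcs_farFace (hQ2 _ _ hp).1).1
      have ha : ((1, a + o, 2) : Fin 3 × ZMod m × Fin 3) ∈ arcs (closedFaces Q₁ Q₂ a b o τ) := by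
        obtain ⟨q, hq⟩ := exists_pairs_of_head h1a h1
        exact key' a q hq
      rw [← sub_add_cancel x o]
      rcases h with h | h
      · rcases eq_or_pairs_fst h1b h with h | ⟨q, hq⟩
        · rw [h]; exact hb
        · exact key' _ q hq
      · by_cases hxa : x - o = a
        · rw [hxa]; exact ha
        · exact key _ h hxa
    | @a21 x h =>
      have key' : ∀ y p, (p, y) ∈ pairs Q₁ → ((2, -(y + o), 1) : Fin 3 × ZMod m × Fin 3) ∈
          arcs (closedFaces Q₁ Q₂ a b o τ) := fun y q hq => (arcs_nearFace (hQ1 _ _ hq).2).2.1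
      have key : ∀ y q, (y, q) ∈ pairs Q₂ → ((2, -(y + o), 1) : Fin 3 × ZMod m × Fin 3) ∈
          arcs (closedFaces Q₁ Q₂ a b o τ) := fun y q hq => (arcs_farFace (hQ2 _ _ hq).1).2.2
      rw [← sub_add_cancel x o]
      rcases h with h | h
      · rcases eq_or_pairs_snd h1a h with h | ⟨q, hq⟩
        · rw [h]
          obtain ⟨q, hq⟩ := exists_pairs_of_head h2a h2
          exact key _ q hq
        · exact key' _ q hq
      · rcases eq_or_pairs_fst h2b h with h | ⟨q, hq⟩
        · rw [h]
          obtain ⟨p, hp⟩ := exists_pairs_of_getLast h1b h1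
          exact key' _ p hp
        · exact key _ q hq
    | a20 h =>
      rw [← sub_add_cancel x τ]
      rcases eq_or_pairs_fst h2b h with h | ⟨q, hq⟩
      · rw [h]; exact a2.1
      · exact (arcs_nearFace (hQ2 _ _ hq).2).1
    | @a02 x h =>
      rw [← sub_add_cancel x τ]
      rcases eq_or_pairs_snd h2a h with h | ⟨q, hq⟩
      · rw [h]; exact a2.2.2
      · exact (arcs_nearFace (hQ2 _ _ hq).2).2.1
    | rung h =>
      rcases h with ⟨rfl, rfl⟩ | ⟨rfl, p, q, hpq, rfl⟩ | ⟨rfl, p, q, hpq, rfl⟩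
      · exact a1.2.2
      · have := (arcs_nearFace (hQ1 _ _ hpq).2).2.2
        rwa [add_sub_add_right_eq_sub] at this
      · have := (arcs_nearFace (hQ2 _ _ hpq).2).2.2
        rwa [add_sub_add_right_eq_sub] at this
    | rung' h =>
      rcases h with ⟨rfl, rfl⟩ | ⟨rfl, p, q, hpq, rfl⟩ | ⟨rfl, p, q, hpq, rfl⟩
      · have := a2.2.1
        rwa [add_sub_add_right_eq_sub, ← neg_sub] at this
      · rw [neg_sub]; exact (arcs_farFace (hQ1 _ _ hpq).1).2.1
      · have := (arcs_farFace (hQ2 _ _ hpq).1).2.1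
        rwa [add_sub_add_right_eq_sub, ← neg_sub] at this

/-- Even length makes each strand of a ladder change sides from a to b. In class 1 the strands of Q₁
are then tied by the chain of Q₂, in class 2 those of Q₂ by the extra triangle on a and b. In class
0 two chains are connected through the extra rung. -/
theorem link_closedFaces (h1a : Q₁.head? = some a) (h1b : Q₁.getLast? = some b)
    (h2a : Q₂.head? = some a) (h2b : Q₂.getLast? = some b)
    (h1 : Even Q₁.length) (h2 : Even Q₂.length) (k : Fin 3) :
    ∃ u, ∀ x d, ClosedSpec Q₁ Q₂ a b o τ k x d →
      Relation.EqvGen (LinkStep (closedFaces Q₁ Q₂ a b o τ) k) (x, d) u := by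
  obtain ⟨hQ1, hQ2, hc1, hc2⟩ := closedFaces_mem (Q₁ := Q₁) (Q₂ := Q₂) (a := a) (b := b)
    (o := o) (τ := τ)
  have l1 := link_nearFace hc1
  have l2 := link_farFace hc2
  have hb1 := mem_of_last h1b
  have hb2 := mem_of_last h2b
  have hk : k = 0 ∨ k = 1 ∨ k = 2 := by revert k; decide
  have E := Relation.EqvGen.is_equivalence (LinkStep (closedFaces Q₁ Q₂ a b o τ) k)
  generalize hr : Relation.EqvGen (LinkStep (closedFaces Q₁ Q₂ a b o τ) k) = r at E ⊢
  rcases hk with rfl | rfl | rfl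
  · have hU := fun p q (hpq : (p, q) ∈ pairs Q₁) => (link_farFace (hQ1 p q hpq).1).1
    have hD := fun p q (hpq : (p, q) ∈ pairs Q₂) => (link_nearFace (hQ2 p q hpq).2).1
    replace l1 := l1.2
    replace l2 := l2.2
    simp only [hr, add_sub_add_right_eq_sub] at hU hD l1 l2
    have hUa : ∀ x ∈ Q₁, r (x, 1) (a, 1) := fun x hx =>
      chain_rel E (U := fun p => (p, 1)) (fun p q hpq => E.symm (hU p q hpq)) h1a hx
    have hDa : ∀ x ∈ Q₂, r (-(x + τ), 2) (-(a + τ), 2) := fun x hx =>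
      chain_rel E (U := fun p => (-(p + τ), 2)) hD h2a hx
    have hab : r (-(b + τ), 2) (a, 1) := E.trans l2.1 l1.1
    refine ⟨(a, 1), fun x d h => ?_⟩
    cases h with
    | a01 h => exact hUa _ h
    | a02 h =>
      have h3 := hDa _ h
      rw [sub_add_cancel] at h3
      exact E.trans h3 (E.trans (E.symm (hDa b hb2)) hab)
    | rung h =>
      rcases h with ⟨-, rfl⟩ | ⟨h, -⟩ | ⟨h, -⟩
      · exact E.trans (E.symm l1.2) (hUa b hb1)
      · exact absurd h (by decide)
      · exact absurd h (by decide)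
    | rung' h =>
      rcases h with ⟨-, rfl⟩ | ⟨h, -⟩ | ⟨h, -⟩
      · rw [neg_sub]; exact l1.1
      · exact absurd h (by decide)
      · exact absurd h (by decide)
  · have hn := fun p q (hpq : (p, q) ∈ pairs Q₁) => link_nearFace (hQ1 p q hpq).2
    have hf := fun p q (hpq : (p, q) ∈ pairs Q₁) => link_farFace (hQ1 p q hpq).1
    have hU := fun p q (hpq : (p, q) ∈ pairs Q₂) => (link_farFace (hQ2 p q hpq).1).1
    replace l1 := l1.1
    simp only [hr, add_sub_add_right_eq_sub] at hn hf hU l1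
    have hl : ∀ p q, (p, q) ∈ pairs Q₁ → r (p + o, 2) (-q, 0) ∧ r (q + o, 2) (-p, 0) :=
      fun p q hpq => ⟨E.trans (E.symm (hn p q hpq).2.1) (E.symm (hf p q hpq).2.1),
        E.trans (hn p q hpq).2.2 (hf p q hpq).2.2⟩
    have hlast := (ladder_last E (U := fun p => (p + o, 2)) (D := fun p => (-p, 0)) hl h1a h1b).2 h1
    have hUa : ∀ x ∈ Q₂, r (x + o, 2) (a + o, 2) := fun x hx =>
      chain_rel E (U := fun p => (p + o, 2)) (fun p q hpq => E.symm (hU p q hpq)) h2a hx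
    have hDa : r (-a, 0) (a + o, 2) := E.trans (E.symm hlast.1) (hUa b hb2)
    have hQ : ∀ x ∈ Q₁, r (x + o, 2) (a + o, 2) ∧ r (-x, 0) (a + o, 2) := by
      intro x hx
      rcases ladder_rel E (U := fun p => (p + o, 2)) (D := fun p => (-p, 0)) hl h1a hx with h | h
      · exact ⟨h.1, E.trans h.2 hDa⟩
      · exact ⟨E.trans h.1 hDa, h.2⟩
    refine ⟨(a + o, 2), fun x d h => ?_⟩
    cases h with
    | a10 h => exact (hQ _ h).2
    | a12 h =>
      rcases h with h | h
      · have := (hQ _ h).1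
        rwa [sub_add_cancel] at this
      · have := hUa _ h
        rwa [sub_add_cancel] at this
    | rung h =>
      rcases h with ⟨h, -⟩ | ⟨-, p, q, hpq, rfl⟩ | ⟨h, -⟩
      · exact absurd h (by decide)
      · exact E.trans (hf p q hpq).2.2 (hQ p (mem_of_mem_pairs hpq).1).2
      · exact absurd h (by decide)
    | rung' h =>
      rcases h with ⟨h, -⟩ | ⟨-, p, q, hpq, rfl⟩ | ⟨h, -⟩
      · exact absurd h (by decide)
      · rw [neg_sub]
        exact E.trans (E.symm (hf p q hpq).2.1) (hQ q (mem_of_mem_pairs hpq).2).2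
      · exact absurd h (by decide)
  · have hn := fun p q (hpq : (p, q) ∈ pairs Q₂) => link_nearFace (hQ2 p q hpq).2
    have hf := fun p q (hpq : (p, q) ∈ pairs Q₂) => link_farFace (hQ2 p q hpq).1
    have hD := fun p q (hpq : (p, q) ∈ pairs Q₁) => (link_nearFace (hQ1 p q hpq).2).1
    replace l2 := l2.1
    simp only [hr, add_sub_add_right_eq_sub] at hn hf hD l2
    have hl : ∀ p q, (p, q) ∈ pairs Q₂ → r (p + τ, 0) (-(q + o), 1) ∧ r (q + τ, 0) (-(p + o), 1) :=
      fun p q hpq => ⟨E.trans (E.symm (hn p q hpq).2.1) (E.symm (hf p q hpq).2.1),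
        E.trans (hn p q hpq).2.2 (hf p q hpq).2.2⟩
    have hlast := (ladder_last E (U := fun p => (p + τ, 0)) (D := fun p => (-(p + o), 1))
      hl h2a h2b).2 h2
    have hDa : r (-(a + o), 1) (a + τ, 0) := E.trans (E.symm hlast.1) l2
    have hQ : ∀ x ∈ Q₂, r (x + τ, 0) (a + τ, 0) ∧ r (-(x + o), 1) (a + τ, 0) := by
      intro x hx
      rcases ladder_rel E (U := fun p => (p + τ, 0)) (D := fun p => (-(p + o), 1)) hl h2a hx
        with h | h
      · exact ⟨h.1, E.trans h.2 hDa⟩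
      · exact ⟨E.trans h.1 hDa, h.2⟩
    have hQ' : ∀ x ∈ Q₁, r (-(x + o), 1) (a + τ, 0) := fun x hx =>
      E.trans (chain_rel E (U := fun p => (-(p + o), 1)) hD h1a hx) hDa
    refine ⟨(a + τ, 0), fun x d h => ?_⟩
    cases h with
    | a20 h =>
      have := (hQ _ h).1
      rwa [sub_add_cancel] at this
    | a21 h =>
      rcases h with h | h
      · have := hQ' _ h
        rwa [sub_add_cancel] at this
      · have := (hQ _ h).2
        rwa [sub_add_cancel] at this
    | rung h =>
      rcases h with ⟨h, -⟩ | ⟨h, -⟩ | ⟨-, p, q, hpq, rfl⟩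
      · exact absurd h (by decide)
      · exact absurd h (by decide)
      · exact E.trans (E.symm (hn p q hpq).2.2) (hQ q (mem_of_mem_pairs hpq).2).1
    | rung' h =>
      rcases h with ⟨h, -⟩ | ⟨h, -⟩ | ⟨-, p, q, hpq, rfl⟩
      · exact absurd h (by decide)
      · exact absurd h (by decide)
      · rw [neg_sub]
        exact E.trans (hn p q hpq).2.1 (hQ p (mem_of_mem_pairs hpq).1).1

end Closed

end Template

/-! ### Reduction to four label paths. -/

theorem natCast_length_pred {α : Type*} {l : List α} {x : α} (h : l.head? = some x) :
    ((l.length - 1 : ℕ) : ℤ) = l.length - 1 := by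
  cases l with
  | nil => simp at h
  | cons a l => simp

/-- Four label paths which cover all labels and all differences give a triangular biembedding. -/
theorem hasTriangularBiembedding_of_paths {m : ℕ} (hm : 1 < m) {W : Type*}
    (φ : W ≃ ZMod m × Fin 3) (P₀ P₁ Q₁ Q₂ : List (ZMod m)) {a b e f g τ : ZMod m}
    (h0e : P₀.head? = some e) (h0g : P₀.getLast? = some g)
    (h1f : P₁.head? = some f) (h1e : P₁.getLast? = some e)
    (h1a : Q₁.head? = some a) (h1b : Q₁.getLast? = some b)
    (h2a : Q₂.head? = some a) (h2b : Q₂.getLast? = some b)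
    (hP₀ : Odd P₀.length) (hP₁ : Odd P₁.length) (hQ₁ : Even Q₁.length) (hQ₂ : Even Q₂.length)
    (hab : b - a ≠ 1) (hab' : b - a ≠ -1)
    (hA : ∀ x, x ∈ P₀ ∨ x ∈ P₁ ∨ x ∈ Q₁)
    (hB : ∀ x, x ∈ P₁ ∨ x ∈ Q₁ ∨ x ∈ Q₂)
    (hC : ∀ x, x ∈ P₀ ∨ x - τ ∈ Q₂)
    (hR₀ : ∀ x, x ≠ 0 → IsRung P₀ x ∨ IsRung P₀ (-x) ∨ x = b - a ∨ x = -(b - a))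
    (hR₁ : ∀ x, x ≠ 0 → IsRung P₁ x ∨ IsRung P₁ (-x) ∨ IsRung Q₁ x ∨ IsRung Q₁ (-x))
    (hR₂ : ∀ x, x ≠ 0 → IsRung Q₂ x ∨ IsRung Q₂ (-x))
    (hlen : 2 * (P₀.length + P₁.length + Q₁.length + Q₂.length) = 3 * m + 3)
    {g₁ g₂ : ℕ}
    (hg₁ : (m * (P₀.length + P₁.length) : ℤ) = 4 * m + 2 * g₁ - 2)
    (hg₂ : (m * (Q₁.length + Q₂.length) : ℤ) = 4 * m + 2 * g₂ - 2) :
    HasTriangularBiembedding (SimpleGraph.completeGraph W) g₁ g₂ := by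
  have : NeZero m := ⟨by omega⟩
  have : Fact (1 < m) := ⟨hm⟩
  have one_ne : (1 : ZMod m) ≠ 0 := one_ne_zero
  have hQ₁2 : 2 ≤ Q₁.length := by
    have : Q₁.length ≠ 0 := by rintro h; rw [List.length_eq_zero_iff] at h; simp [h] at h1a
    obtain ⟨r, hr⟩ := hQ₁
    omega
  have hQ₂2 : 2 ≤ Q₂.length := by
    have : Q₂.length ≠ 0 := by rintro h; rw [List.length_eq_zero_iff] at h; simp [h] at h2a
    obtain ⟨r, hr⟩ := hQ₂
    omega
  set o := -(f + e + g)
  have hs₁ := arcs_openFaces h0e h0g h1f h1e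
  have hs₂ := arcs_closedFaces (o := o) (τ := τ) h1a h1b h2a h2b hQ₁2 hQ₂2
  have hP₀1 : 1 ≤ P₀.length := hP₀.pos
  have hP₁1 : 1 ≤ P₁.length := hP₁.pos
  refine hasTriangularBiembedding_of_lists (L₁ := openFaces P₀ P₁ e f g)
    (L₂ := closedFaces Q₁ Q₂ a b o τ) φ ?_ ?_ ?_ ?_ ?_ ?_ ?_ ?_ ?_ ?_
  -- Altogether there are twice the number of path entries minus 4, that is 3m − 1, triangles.
  · rw [length_openFaces, length_closedFaces]
    omega
  · intro c x d hne
    simp only [hs₁, hs₂]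
    by_cases hcd : c = d
    · subst hcd
      have hx : x ≠ 0 := fun h => hne ⟨rfl, h⟩
      have hc : c = 0 ∨ c = 1 ∨ c = 2 := by clear * -; revert c; decide
      rcases hc with rfl | rfl | rfl
      · rcases hR₀ x hx with h | h | h | h
        · exact Or.inl (.rung (Or.inl ⟨rfl, h⟩))
        · rw [← neg_neg x]; exact Or.inl (.rung' (Or.inl ⟨rfl, h⟩))
        · exact Or.inr (.rung (Or.inl ⟨rfl, h⟩))
        · rw [h]; exact Or.inr (.rung' (Or.inl ⟨rfl, rfl⟩))
      · rcases hR₁ x hx with h | h | h | h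
        · exact Or.inl (.rung (Or.inr ⟨rfl, h⟩))
        · rw [← neg_neg x]; exact Or.inl (.rung' (Or.inr ⟨rfl, h⟩))
        · exact Or.inr (.rung (Or.inr (Or.inl ⟨rfl, h⟩)))
        · rw [← neg_neg x]; exact Or.inr (.rung' (Or.inr (Or.inl ⟨rfl, h⟩)))
      · rcases hR₂ x hx with h | h
        · exact Or.inr (.rung (Or.inr (Or.inr ⟨rfl, h⟩)))
        · rw [← neg_neg x]; exact Or.inr (.rung' (Or.inr (Or.inr ⟨rfl, h⟩)))
    · have a01 : ∀ x, OpenSpec P₀ P₁ o 0 x 1 ∨ ClosedSpec Q₁ Q₂ a b o τ 0 x 1 := by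
        intro x
        rcases hA x with h | h | h
        · exact Or.inl (.a01 (Or.inl h))
        · exact Or.inl (.a01 (Or.inr h))
        · exact Or.inr (.a01 h)
      have a12 : ∀ x, OpenSpec P₀ P₁ o 1 x 2 ∨ ClosedSpec Q₁ Q₂ a b o τ 1 x 2 := by
        intro x
        rcases hB (x - o) with h | h | h
        · exact Or.inl (.a12 h)
        · exact Or.inr (.a12 (Or.inl h))
        · exact Or.inr (.a12 (Or.inr h))
      have a20 : ∀ x, OpenSpec P₀ P₁ o 2 x 0 ∨ ClosedSpec Q₁ Q₂ a b o τ 2 x 0 := by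
        intro x
        rcases hC x with h | h
        · exact Or.inl (.a20 h)
        · exact Or.inr (.a20 h)
      have hrev : ∀ {c d}, (∀ x, OpenSpec P₀ P₁ o c x d ∨ ClosedSpec Q₁ Q₂ a b o τ c x d) →
          ∀ x, OpenSpec P₀ P₁ o d x c ∨ ClosedSpec Q₁ Q₂ a b o τ d x c := by
        intro c d h x
        rw [← neg_neg x]
        exact (h (-x)).imp ArcSpec.reverse ArcSpec.reverse
      have hcd' : (c = 0 ∧ d = 1) ∨ (c = 1 ∧ d = 0) ∨ (c = 1 ∧ d = 2) ∨ (c = 2 ∧ d = 1) ∨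
          (c = 2 ∧ d = 0) ∨ (c = 0 ∧ d = 2) := by
        clear * - hcd
        revert c d
        decide
      rcases hcd' with ⟨rfl, rfl⟩ | ⟨rfl, rfl⟩ | ⟨rfl, rfl⟩ | ⟨rfl, rfl⟩ | ⟨rfl, rfl⟩ | ⟨rfl, rfl⟩
      · exact a01 x
      · exact hrev a01 x
      · exact a12 x
      · exact hrev a12 x
      · exact a20 x
      · exact hrev a20 x
  · intro c x d h
    exact (hs₁ _ _ _).2 ((hs₁ _ _ _).1 h).reverse
  · intro c x d h
    exact (hs₂ _ _ _).2 ((hs₂ _ _ _).1 h).reverse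
  · intro k
    obtain ⟨u, hu⟩ := link_openFaces h0e h0g h1f h1e hP₀ hP₁ k
    exact ⟨u, fun x d h => hu x d ((hs₁ _ _ _).1 h)⟩
  · intro k
    obtain ⟨u, hu⟩ := link_closedFaces (o := o) (τ := τ) h1a h1b h2a h2b hQ₁ hQ₂ k
    exact ⟨u, fun x d h => hu x d ((hs₂ _ _ _).1 h)⟩
  · intro h
    have he : e ∈ P₀ := mem_of_head h0e
    -- In class 0 the second graph has only the differences ±(b − a), which are not ±1. Hence the
    -- difference 1 lies in the first graph and connects this class.
    have h1 : OpenSpec P₀ P₁ o 0 1 0 := by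
      rcases hR₀ 1 one_ne with h | h | h | h
      · exact .rung (Or.inl ⟨rfl, h⟩)
      · rw [← neg_neg (1 : ZMod m)]; exact .rung' (Or.inl ⟨rfl, h⟩)
      · exact absurd h.symm hab
      · exact absurd (by rw [h, neg_neg]) hab'
    exact connected_of_arcs h (c := 0) (d := 1) (e := 2) (by decide) (Or.inl rfl)
      ((hs₁ _ _ _).2 h1) ((hs₁ _ _ _).2 (.a01 (Or.inl he))) ((hs₁ _ _ _).2 (.a02 he))
  · intro h
    have ha₁ : a ∈ Q₁ := mem_of_head h1a
    have ha₂ : a ∈ Q₂ := mem_of_head h2a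
    have h1 : ClosedSpec Q₁ Q₂ a b o τ 2 1 2 := by
      rcases hR₂ 1 one_ne with h | h
      · exact .rung (Or.inr (Or.inr ⟨rfl, h⟩))
      · rw [← neg_neg (1 : ZMod m)]; exact .rung' (Or.inr (Or.inr ⟨rfl, h⟩))
    exact connected_of_arcs h (c := 2) (d := 0) (e := 1) (by decide) (Or.inl rfl)
      ((hs₂ _ _ _).2 h1) ((hs₂ _ _ _).2 (.a20 (p := a + τ) (by simpa using ha₂)))
      ((hs₂ _ _ _).2 (.a21 (p := a + o) (by simpa using Or.inl ha₁)))
  · rw [length_openFaces]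
    push_cast
    rw [natCast_length_pred h0e, natCast_length_pred h1f]
    linear_combination (-6) * hg₁
  · rw [length_closedFaces]
    push_cast
    rw [natCast_length_pred h1a, natCast_length_pred h2a]
    linear_combination (-6) * hg₂

/-! ### Zigzag sequences of integers and their differences. -/

section IntLists

/-- The zigzag sequence `a, b, a - d, b + d, a - 2 d, …`. -/
def strand (a b d : ℤ) (i : ℕ) : ℤ :=
  if i % 2 = 0 then a - d * ((i / 2 : ℕ) : ℤ) else b + d * ((i / 2 : ℕ) : ℤ)

/-- The entries of a sequence with indices from `lo` to `hi - 1`. -/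
def seg (f : ℕ → ℤ) (lo hi : ℕ) : List ℤ := (List.range' lo (hi - lo)).map f

/-- Two consecutive entries of `l` differ by `t`, up to sign and modulo `m`. -/
def HasStep (m : ℤ) (l : List ℤ) (t : ℤ) : Prop :=
  ∃ p q, (p, q) ∈ pairs l ∧ (q - p = t ∨ p - q = t ∨ q - p = m - t ∨ p - q = m - t)

variable {f : ℕ → ℤ} {lo hi i : ℕ} {m t : ℤ} {A B : List ℤ}

theorem length_seg : (seg f lo hi).length = hi - lo := by simp [seg]

theorem mem_seg (h1 : lo ≤ i) (h2 : i < hi) : f i ∈ seg f lo hi := by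
  simp only [seg, List.mem_map, List.mem_range'_1]
  exact ⟨i, ⟨h1, by omega⟩, rfl⟩

theorem head_seg (h : lo < hi) : (seg f lo hi).head? = some (f lo) := by
  obtain ⟨n, rfl⟩ := Nat.exists_eq_add_of_lt h
  rw [seg, show lo + n + 1 - lo = n + 1 by omega, List.range'_succ]
  simp

theorem getLast_seg (h : lo < hi) : (seg f lo hi).getLast? = some (f (hi - 1)) := by
  obtain ⟨n, rfl⟩ := Nat.exists_eq_add_of_lt h
  rw [seg, show lo + n + 1 - lo = n + 1 by omega, List.range'_concat]
  simp

theorem mem_pairs_append_left {α : Type*} {A B : List α} {x : α × α} (h : x ∈ pairs A) :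
    x ∈ pairs (A ++ B) := by
  induction A with
  | nil => simp at h
  | cons a A ih =>
    cases A with
    | nil => simp at h
    | cons b A =>
      simp only [List.cons_append, pairs_cons_cons, List.mem_cons] at h ih ⊢
      exact h.imp_right ih

theorem mem_pairs_append_right {α : Type*} {A B : List α} {x : α × α} (h : x ∈ pairs B) :
    x ∈ pairs (A ++ B) := by
  induction A with
  | nil => exact h
  | cons a A ih =>
    match A, B, ih, h with
    | [], b :: B, _, h => exact List.mem_cons_of_mem _ h
    | [], [], _, h => simp at h
    | c :: A, B, ih, _ => exact List.mem_cons_of_mem _ ih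

theorem mem_pairs_append_mid {α : Type*} {A B : List α} {p q : α} (hA : A.getLast? = some p)
    (hB : B.head? = some q) : (p, q) ∈ pairs (A ++ B) := by
  induction A with
  | nil => simp at hA
  | cons a A ih =>
    cases A with
    | nil =>
      cases B with
      | nil => simp at hB
      | cons b B =>
        have h1 : a = p := by simpa using hA
        have h2 : b = q := by simpa using hB
        simp [h1, h2]
    | cons c A => exact List.mem_cons_of_mem _ (ih (by simpa using hA))

theorem mem_pairs_reverse {α : Type*} {A : List α} {p q : α} (h : (p, q) ∈ pairs A) :
    (q, p) ∈ pairs A.reverse := by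
  induction A with
  | nil => simp at h
  | cons a A ih =>
    cases A with
    | nil => simp at h
    | cons b A =>
      rw [List.reverse_cons]
      rw [pairs_cons_cons, List.mem_cons] at h
      rcases h with h | h
      · simp only [Prod.mk.injEq] at h
        rw [h.1, h.2]
        exact mem_pairs_append_mid (by simp) (by simp)
      · exact mem_pairs_append_left (ih h)

theorem mem_pairs_map {α β : Type*} (g : α → β) {A : List α} {p q : α} (h : (p, q) ∈ pairs A) :
    (g p, g q) ∈ pairs (A.map g) := by
  induction A with
  | nil => simp at h
  | cons a A ih =>
    cases A with
    | nil => simp at h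
    | cons b A =>
      simp only [List.map_cons, pairs_cons_cons, List.mem_cons, Prod.mk.injEq] at h ih ⊢
      rcases h with ⟨rfl, rfl⟩ | h
      · exact Or.inl ⟨rfl, rfl⟩
      · exact Or.inr (ih h)

theorem mem_pairs_seg (h1 : lo ≤ i) (h2 : i + 1 < hi) : (f i, f (i + 1)) ∈ pairs (seg f lo hi) := by
  have e : seg f lo hi = seg f lo (i + 1) ++ seg f (i + 1) hi := by
    simp only [seg]
    rw [← List.map_append]
    congr 1
    have := List.range'_append_1 (s := lo) (m := i + 1 - lo) (n := hi - (i + 1))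
    rw [show lo + (i + 1 - lo) = i + 1 by omega] at this
    rw [this]
    congr 1
    omega
  rw [e]
  exact mem_pairs_append_mid (getLast_seg (by omega)) (head_seg h2)

theorem HasStep.append_left (h : HasStep m A t) : HasStep m (A ++ B) t := by
  obtain ⟨p, q, hpq, h⟩ := h
  exact ⟨p, q, mem_pairs_append_left hpq, h⟩

theorem HasStep.append_right (h : HasStep m B t) : HasStep m (A ++ B) t := by
  obtain ⟨p, q, hpq, h⟩ := h
  exact ⟨p, q, mem_pairs_append_right hpq, h⟩

theorem HasStep.append_mid {p q : ℤ} (hA : A.getLast? = some p) (hB : B.head? = some q)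
    (h : q - p = t ∨ p - q = t ∨ q - p = m - t ∨ p - q = m - t) : HasStep m (A ++ B) t :=
  ⟨p, q, mem_pairs_append_mid hA hB, h⟩

theorem HasStep.reverse (h : HasStep m A t) : HasStep m A.reverse t := by
  obtain ⟨p, q, hpq, h⟩ := h
  exact ⟨q, p, mem_pairs_reverse hpq, by tauto⟩

theorem hasStep_pair {p q : ℤ} (h : q - p = t ∨ p - q = t ∨ q - p = m - t ∨ p - q = m - t) :
    HasStep m [p, q] t := ⟨p, q, by simp, h⟩

/-- Up to sign the differences of a zigzag are b − a + d i. Two progressions of labels thus yield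
one progression of differences, indexed by position. -/
theorem hasStep_strand {a b d : ℤ} (i : ℕ) (h1 : lo ≤ i) (h2 : i + 1 < hi)
    (h : b - a + d * i = t ∨ b - a + d * i = -t) : HasStep m (seg (strand a b d) lo hi) t := by
  refine ⟨_, _, mem_pairs_seg h1 h2, ?_⟩
  have key : strand a b d (i + 1) - strand a b d i = b - a + d * i ∨
      strand a b d i - strand a b d (i + 1) = b - a + d * i := by
    rcases Nat.even_or_odd' i with ⟨k, rfl | rfl⟩
    · left
      simp only [strand]
      rw [if_neg (by omega), if_pos (by omega), show (2 * k + 1) / 2 = k by omega,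
        show 2 * k / 2 = k by omega]
      push_cast
      ring
    · right
      simp only [strand]
      rw [if_neg (by omega), if_pos (by omega), show (2 * k + 1) / 2 = k by omega,
        show (2 * k + 1 + 1) / 2 = k + 1 by omega]
      push_cast
      ring
  omega

theorem mem_strand_even {a b d y : ℤ} (k : ℕ) (h1 : lo ≤ 2 * k) (h2 : 2 * k < hi)
    (hy : y = a - d * k) : y ∈ seg (strand a b d) lo hi := by
  have : y = strand a b d (2 * k) := by
    rw [hy, strand, if_pos (by omega), show 2 * k / 2 = k by omega]
  rw [this]
  exact mem_seg h1 h2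

theorem mem_strand_odd {a b d y : ℤ} (k : ℕ) (h1 : lo ≤ 2 * k + 1) (h2 : 2 * k + 1 < hi)
    (hy : y = b + d * k) : y ∈ seg (strand a b d) lo hi := by
  have : y = strand a b d (2 * k + 1) := by
    rw [hy, strand, if_neg (by omega), show (2 * k + 1) / 2 = k by omega]
  rw [this]
  exact mem_seg h1 h2

/-- Both pieces of a cut zigzag are used somewhere, so a label need not be located relative to the
cut. -/
theorem split_strand_even {a b d y : ℤ} (j N k : ℕ) (h2 : 2 * k < N)
    (hy : y = a - d * k) : y ∈ seg (strand a b d) 0 j ∨ y ∈ seg (strand a b d) j N := by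
  by_cases h : 2 * k < j
  · exact Or.inl (mem_strand_even k (Nat.zero_le _) h hy)
  · exact Or.inr (mem_strand_even k (by omega) h2 hy)

theorem split_strand_odd {a b d y : ℤ} (j N k : ℕ) (h2 : 2 * k + 1 < N)
    (hy : y = b + d * k) : y ∈ seg (strand a b d) 0 j ∨ y ∈ seg (strand a b d) j N := by
  by_cases h : 2 * k + 1 < j
  · exact Or.inl (mem_strand_odd k (Nat.zero_le _) h hy)
  · exact Or.inr (mem_strand_odd k (by omega) h2 hy)

end IntLists

/-! ### The fixed paths P₀ and Q₂. -/

section OuterPaths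

/-- The path of class `0`. -/
def firstPath (s : ℕ) : List ℤ :=
  seg (strand (4 * s + 1) (4 * s + 4) 1) 0 (2 * s - 2) ++ ([5 * (s : ℤ) + 4, 5 * s + 3] ++
    (seg (strand (3 * s + 2) (5 * s + 5) 1) 0 (2 * s + 1) ++ [4 * (s : ℤ) + 2, -1]))

/-- The path of class `2`. -/
def lastPath (s : ℕ) : List ℤ :=
  [0, 4 * (s : ℤ) + 5] ++ ([4 * (s : ℤ) + 4] ++
    (seg (strand (6 * s + 4) (2 * s + 3) 1) 0 (2 * s - 2) ++ ([3 * (s : ℤ) + 4, 3 * s + 2] ++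
    ([5 * (s : ℤ) + 5, 3 * s + 3] ++ (seg (strand (5 * s + 4) (3 * s + 5) 1) 0 (2 * s - 3) ++
    [2 * (s : ℤ) + 2, -2 * s - 2])))))

variable {s : ℕ}

theorem length_firstPath (hs : 2 ≤ s) : (firstPath s).length = 4 * s + 3 := by
  simp [firstPath, length_seg]; omega

theorem length_lastPath (hs : 2 ≤ s) : (lastPath s).length = 4 * s + 4 := by
  simp [lastPath, length_seg]; omega

theorem head_firstPath (hs : 2 ≤ s) : (firstPath s).head? = some (4 * (s : ℤ) + 1) := by
  rw [firstPath, List.head?_append, head_seg (by omega)]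
  simp [strand]

theorem getLast_firstPath : (firstPath s).getLast? = some (-1) := by
  simp only [firstPath, List.getLast?_append]
  simp

theorem head_lastPath : (lastPath s).head? = some 0 := by
  simp [lastPath]

theorem getLast_lastPath : (lastPath s).getLast? = some (-2 * (s : ℤ) - 2) := by
  simp only [lastPath, List.getLast?_append]
  simp

/-- The two zigzags cover four intervals of labels; the gaps between them are 4s + 2, 5s + 3 and 5s
+ 4, inserted by hand, and the midpoint 4s + 3. -/
theorem mem_firstPath {y : ℤ} (h1 : 2 * s + 2 ≤ y) (h2 : y ≤ 6 * s + 4) (h3 : y ≠ 4 * s + 3) :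
    y ∈ firstPath s := by
  simp only [firstPath, List.mem_append, List.mem_cons, List.not_mem_nil, or_false]
  by_cases c1 : y ≤ 3 * s + 2
  · exact Or.inr (Or.inr (Or.inl (mem_strand_even (3 * s + 2 - y).toNat (by omega) (by omega)
      (by omega))))
  by_cases c2 : y ≤ 4 * s + 1
  · exact Or.inl (mem_strand_even (4 * s + 1 - y).toNat (by omega) (by omega) (by omega))
  by_cases c3 : y ≤ 4 * s + 2
  · exact Or.inr (Or.inr (Or.inr (Or.inl (by omega))))
  by_cases c4 : y ≤ 5 * s + 2
  · exact Or.inl (mem_strand_odd (y - (4 * s + 4)).toNat (by omega) (by omega) (by omega))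
  by_cases c5 : y ≤ 5 * s + 4
  · exact Or.inr (Or.inl (by omega))
  · exact Or.inr (Or.inr (Or.inl (mem_strand_odd (y - (5 * s + 5)).toNat (by omega) (by omega)
      (by omega))))

theorem mem_lastPath (hs : 2 ≤ s) {y : ℤ} (h1 : 2 * s + 2 ≤ y) (h2 : y ≤ 6 * s + 4)
    (h3 : y ≠ 4 * s + 3) : y ∈ lastPath s := by
  simp only [lastPath, List.mem_append, List.mem_cons, List.not_mem_nil, or_false]
  by_cases c1 : y = 2 * s + 2 ∨ y = 3 * s + 2 ∨ y = 3 * s + 3 ∨ y = 3 * s + 4 ∨ y = 5 * s + 5 ∨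
      y = 4 * s + 4 ∨ y = 4 * s + 5
  · omega
  by_cases c2 : y ≤ 3 * s + 1
  · exact Or.inr (Or.inr (Or.inl (mem_strand_odd (y - (2 * s + 3)).toNat (by omega) (by omega)
      (by omega))))
  by_cases c3 : y ≤ 4 * s + 2
  · exact Or.inr (Or.inr (Or.inr (Or.inr (Or.inr (Or.inl (mem_strand_odd
      (y - (3 * s + 5)).toNat (by omega) (by omega) (by omega)))))))
  by_cases c4 : y ≤ 5 * s + 4
  · exact Or.inr (Or.inr (Or.inr (Or.inr (Or.inr (Or.inl (mem_strand_even
      (5 * s + 4 - y).toNat (by omega) (by omega) (by omega)))))))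
  · exact Or.inr (Or.inr (Or.inl (mem_strand_even (6 * s + 4 - y).toNat (by omega) (by omega)
      (by omega))))

/-- The zigzags give 3, …, 2s − 1 and 2s + 3, …, 4s + 2; junctions and inserted pairs give the
others. The difference 2s + 2 is left for the extra rung b − a. -/
theorem hasStep_firstPath (hs : 2 ≤ s) {t : ℤ} (h1 : 1 ≤ t) (h2 : t ≤ 4 * s + 3)
    (h3 : t ≠ 2 * s + 2) : HasStep (8 * s + 7) (firstPath s) t := by
  have last₁ := getLast_seg (f := strand (4 * s + 1) (4 * s + 4) 1) (lo := 0) (hi := 2 * s - 2)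
    (by omega)
  have head₂ := head_seg (f := strand (3 * s + 2) (5 * s + 5) 1) (lo := 0) (hi := 2 * s + 1)
    (by omega)
  have last₂ := getLast_seg (f := strand (3 * s + 2) (5 * s + 5) 1) (lo := 0) (hi := 2 * s + 1)
    (by omega)
  rw [strand, if_neg (by omega)] at last₁
  rw [strand, if_pos (by omega)] at head₂ last₂
  rw [firstPath]
  by_cases c1 : t = 1
  · exact .append_right (.append_left (hasStep_pair (by omega)))
  by_cases c2 : t = 2
  · exact .append_mid last₁ (by simp; rfl) (by omega)
  by_cases c3 : t ≤ 2 * s - 1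
  · exact .append_left (hasStep_strand (t - 3).toNat (by omega) (by omega) (by omega))
  by_cases c4 : t = 2 * s
  · exact .append_right (.append_right (.append_mid last₂ rfl (by omega)))
  by_cases c5 : t = 2 * s + 1
  · exact .append_right (.append_mid (p := 5 * s + 3) rfl
      (by rw [List.head?_append, head₂]; rfl) (by omega))
  by_cases c6 : t = 4 * s + 3
  · exact .append_right (.append_right (.append_right (hasStep_pair (by omega))))
  · exact .append_right (.append_right (.append_left (hasStep_strand (t - (2 * s + 3)).toNat
      (by omega) (by omega) (by omega))))

/-- The zigzags give 4, …, 2s − 1 and 2s + 5, …, 4s + 1, each in decreasing order. The last step of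
the path has length 4s + 4, which counts as 4s + 3 modulo 8s + 7. -/
theorem hasStep_lastPath (hs : 2 ≤ s) {t : ℤ} (h1 : 1 ≤ t) (h2 : t ≤ 4 * s + 3) :
    HasStep (8 * s + 7) (lastPath s) t := by
  have head₁ := head_seg (f := strand (6 * s + 4) (2 * s + 3) 1) (lo := 0) (hi := 2 * s - 2)
    (by omega)
  have last₁ := getLast_seg (f := strand (6 * s + 4) (2 * s + 3) 1) (lo := 0) (hi := 2 * s - 2)
    (by omega)
  have head₂ := head_seg (f := strand (5 * s + 4) (3 * s + 5) 1) (lo := 0) (hi := 2 * s - 3)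
    (by omega)
  have last₂ := getLast_seg (f := strand (5 * s + 4) (3 * s + 5) 1) (lo := 0) (hi := 2 * s - 3)
    (by omega)
  rw [strand, if_neg (by omega)] at last₁
  rw [strand, if_pos (by omega)] at head₁ head₂ last₂
  rw [lastPath]
  by_cases c1 : t = 1
  · exact .append_mid (p := 4 * s + 5) (q := 4 * s + 4) rfl rfl (by omega)
  by_cases c2 : t = 2
  · exact .append_right (.append_right (.append_right (.append_left (hasStep_pair (by omega)))))
  by_cases c3 : t = 3
  · exact .append_right (.append_right (.append_mid last₁ rfl (by omega)))
  by_cases c4 : t ≤ 2 * s - 1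
  · exact .append_right (.append_right (.append_right (.append_right (.append_right
      (.append_left (hasStep_strand (2 * s - 1 - t).toNat (by omega) (by omega) (by omega)))))))
  by_cases c5 : t = 2 * s
  · exact .append_right (.append_mid (p := 4 * s + 4) rfl
      (by rw [List.head?_append, head₁]; rfl) (by omega))
  by_cases c6 : t = 2 * s + 1
  · exact .append_right (.append_right (.append_right (.append_right (.append_mid (p := 3 * s + 3) rfl
      (by rw [List.head?_append, head₂]; rfl) (by omega)))))
  by_cases c7 : t = 2 * s + 2
  · exact .append_right (.append_right (.append_right (.append_right (.append_left
      (hasStep_pair (by omega))))))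
  by_cases c8 : t = 2 * s + 3
  · exact .append_right (.append_right (.append_right (.append_mid (p := 3 * s + 2)
      (q := 5 * s + 5) rfl rfl (by omega))))
  by_cases c9 : t = 2 * s + 4
  · exact .append_right (.append_right (.append_right (.append_right (.append_right
      (.append_mid last₂ rfl (by omega))))))
  by_cases c10 : t ≤ 4 * s + 1
  · exact .append_right (.append_right (.append_left (hasStep_strand (4 * s + 1 - t).toNat
      (by omega) (by omega) (by omega))))
  by_cases c11 : t = 4 * s + 2
  · exact .append_left (hasStep_pair (by omega))
  · exact .append_right (.append_right (.append_right (.append_right (.append_right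
      (.append_right (hasStep_pair (by omega)))))))

end OuterPaths

/-! ### The varying paths P₁ and Q₁. -/

section MiddlePaths

theorem head_append {α : Type*} {A B : List α} {q : α} (h : A.head? = some q) :
    (A ++ B).head? = some q := by
  rw [List.head?_append, h]; rfl

theorem head_seg_reverse {f : ℕ → ℤ} {lo hi : ℕ} (h : lo < hi) :
    (seg f lo hi).reverse.head? = some (f (hi - 1)) := by
  rw [List.head?_reverse, getLast_seg h]

theorem getLast_seg_reverse {f : ℕ → ℤ} {lo hi : ℕ} (h : lo < hi) :
    (seg f lo hi).reverse.getLast? = some (f lo) := by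
  rw [List.getLast?_reverse, head_seg h]

theorem getLast_append {α : Type*} {A B : List α} {q : α} (h : B.getLast? = some q) :
    (A ++ B).getLast? = some q := by
  rw [List.getLast?_append, h]; rfl

/-- Two paths for class `1`: together they use every label from `-2s-2` to `2s+1`, the
label `4s+3`, and every difference. -/
structure IsMiddlePair (s j : ℕ) (P Q : List ℤ) : Prop where
  length_left : P.length = 2 * j + 1
  length_right : Q.length + 2 * j = 4 * s + 4
  head_left : ∃ f, P.head? = some f
  last_left : P.getLast? = some (-1)
  head_right : Q.head? = some 0
  last_right : Q.getLast? = some (-2 * (s : ℤ) - 2)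
  label : ∀ y : ℤ, -2 * s - 2 ≤ y → y ≤ 2 * s + 1 ∨ y = 4 * s + 3 → y ≤ 4 * s + 3 → y ∈ P ∨ y ∈ Q
  step : ∀ t : ℤ, 1 ≤ t → t ≤ 4 * s + 3 → HasStep (8 * s + 7) P t ∨ HasStep (8 * s + 7) Q t

/-- The zigzags 1, −2, 4, …; −1, 3, −4, …; 0, 2, −3, … share out the labels from −2s − 2 to 2s + 1,
with differences 3 + 3i, 4 + 3i, 2 + 3i. Cutting all three at index j destroys 3j, 3j + 1 and 3j −
1. The junctions at the cuts restore exactly these, whichever way the pieces are divided between P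
and Q. The differences 1 and 12r + 10 come from the junction of two far ends and from the step 12r +
11 → 1. -/
theorem exists_isMiddlePair_two {r j : ℕ} (hj : 1 ≤ j) (hr : j < 4 * r + 3) :
    ∃ P Q, IsMiddlePair (3 * r + 2) j P Q := by
  refine ⟨[12 * (r : ℤ) + 11] ++ (seg (strand 1 (-2) (-3)) 0 j ++ (seg (strand (-1) 3 3) 0 j).reverse),
    seg (strand 0 2 3) 0 j ++ (seg (strand (-1) 3 3) j (4 * r + 3) ++ ((seg (strand 1 (-2) (-3)) j (4 * r + 4)).reverse ++ seg (strand 0 2 3) j (4 * r + 5))), ?_, ?_, ?_, ?_, ?_, ?_, ?_, ?_⟩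
  · (simp [length_seg]; omega)
  · simp [length_seg]; omega
  · exact ⟨_, rfl⟩
  · exact getLast_append (getLast_append (getLast_seg_reverse (by omega)))
  · exact head_append (head_seg (by omega))
  · have : -2 * ((3 * r + 2 : ℕ) : ℤ) - 2 = strand 0 2 3 ((4 * r + 5) - 1) := by
      simp only [strand]; split_ifs <;> omega
    rw [this]
    exact getLast_append (getLast_append (getLast_append ((getLast_seg (by omega)))))
  · intro y h1 h2 h3
    push_cast at h1 h2 h3
    simp only [List.mem_append, List.mem_reverse, List.mem_cons, List.not_mem_nil, or_false]
    by_cases e0 : y = 12 * r + 11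
    · exact Or.inl (Or.inl e0)
    by_cases e1 : y % 3 = 0 ∧ y ≤ 0
    · have := split_strand_even (y := y) (a := 0) (b := 2) (d := 3) (j) (4 * r + 5) ((0 - y) / 3).toNat (by omega) (by omega)
      rcases this with h | h <;> simp only [h, true_or, or_true]
    by_cases e2 : y % 3 = 0
    · have := split_strand_odd (y := y) (a := (-1)) (b := 3) (d := 3) (j) (4 * r + 3) ((y - 3) / 3).toNat (by omega) (by omega)
      rcases this with h | h <;> simp only [h, true_or, or_true]
    by_cases e3 : y % 3 = 1 ∧ 0 ≤ y
    · have := split_strand_even (y := y) (a := 1) (b := (-2)) (d := (-3)) (j) (4 * r + 4) ((y - 1) / 3).toNat (by omega) (by omega)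
      rcases this with h | h <;> simp only [h, true_or, or_true]
    by_cases e4 : y % 3 = 1
    · have := split_strand_odd (y := y) (a := 1) (b := (-2)) (d := (-3)) (j) (4 * r + 4) ((-2 - y) / 3).toNat (by omega) (by omega)
      rcases this with h | h <;> simp only [h, true_or, or_true]
    by_cases e5 : 0 ≤ y
    · have := split_strand_odd (y := y) (a := 0) (b := 2) (d := 3) (j) (4 * r + 5) ((y - 2) / 3).toNat (by omega) (by omega)
      rcases this with h | h <;> simp only [h, true_or, or_true]
    · have := split_strand_even (y := y) (a := (-1)) (b := 3) (d := 3) (j) (4 * r + 3) ((-1 - y) / 3).toNat (by omega) (by omega)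
      rcases this with h | h <;> simp only [h, true_or, or_true]
  · intro t h1 h2
    push_cast at h1 h2 ⊢
    by_cases c0 : t = 1
    · exact Or.inr (.append_right (.append_mid (getLast_seg (by omega)) (head_append (head_seg_reverse (by omega))) (by simp only [strand]; split_ifs <;> omega)))
    by_cases c1 : t = 12 * r + 10
    · clear c0
      exact Or.inl (.append_mid (p := 12 * (r : ℤ) + 11) rfl (head_append (head_seg (by omega))) (by simp only [strand]; split_ifs <;> omega))
    by_cases c2 : t = 3 * j
    · clear c0 c1
      exact Or.inr (.append_mid (getLast_seg (by omega)) (head_append (head_seg (by omega))) (by simp only [strand]; split_ifs <;> omega))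
    by_cases c3 : t = 3 * j + 1
    · clear c0 c1 c2
      exact Or.inr (.append_right (.append_right (.append_mid (getLast_seg_reverse (by omega)) (head_seg (by omega)) (by simp only [strand]; split_ifs <;> omega))))
    by_cases c4 : t = 3 * j - 1
    · clear c0 c1 c2 c3
      exact Or.inl (.append_right (.append_mid (getLast_seg (by omega)) (head_seg_reverse (by omega)) (by simp only [strand]; split_ifs <;> omega)))
    by_cases c5 : t % 3 = 0 ∧ t < 3 * j
    · exact Or.inl (.append_right (.append_left (hasStep_strand ((t - 3) / 3).toNat (by omega) (by omega) (by omega))))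
    by_cases c6 : t % 3 = 0
    · exact Or.inr (.append_right (.append_right (.append_left (HasStep.reverse (hasStep_strand ((t - 3) / 3).toNat (by omega) (by omega) (by omega))))))
    by_cases c7 : t % 3 = 1 ∧ t < 3 * j
    · exact Or.inl (.append_right (.append_right (HasStep.reverse (hasStep_strand ((t - 4) / 3).toNat (by omega) (by omega) (by omega)))))
    by_cases c8 : t % 3 = 1
    · exact Or.inr (.append_right (.append_left (hasStep_strand ((t - 4) / 3).toNat (by omega) (by omega) (by omega))))
    by_cases c9 : t < 3 * j
    · exact Or.inr (.append_left (hasStep_strand ((t - 2) / 3).toNat (by omega) (by omega) (by omega)))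
    · exact Or.inr (.append_right (.append_right (.append_right (hasStep_strand ((t - 2) / 3).toNat (by omega) (by omega) (by omega)))))

/-- The same three zigzags serve, but now −2s − 2 ends the one that starts at 1, so the last two
pieces of Q change places. -/
theorem exists_isMiddlePair_zero {r j : ℕ} (hj : 1 ≤ j) (hr : j < 4 * r + 1) :
    ∃ P Q, IsMiddlePair (3 * r) j P Q := by
  refine ⟨[12 * (r : ℤ) + 3] ++ (seg (strand 1 (-2) (-3)) 0 j ++ (seg (strand (-1) 3 3) 0 j).reverse),
    seg (strand 0 2 3) 0 j ++ (seg (strand (-1) 3 3) j (4 * r + 1) ++ ((seg (strand 0 2 3) j (4 * r + 1)).reverse ++ seg (strand 1 (-2) (-3)) j (4 * r + 2))), ?_, ?_, ?_, ?_, ?_, ?_, ?_, ?_⟩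
  · (simp [length_seg]; omega)
  · simp [length_seg]; omega
  · exact ⟨_, rfl⟩
  · exact getLast_append (getLast_append (getLast_seg_reverse (by omega)))
  · exact head_append (head_seg (by omega))
  · have : -2 * ((3 * r : ℕ) : ℤ) - 2 = strand 1 (-2) (-3) ((4 * r + 2) - 1) := by
      simp only [strand]; split_ifs <;> omega
    rw [this]
    exact getLast_append (getLast_append (getLast_append ((getLast_seg (by omega)))))
  · intro y h1 h2 h3
    push_cast at h1 h2 h3
    simp only [List.mem_append, List.mem_reverse, List.mem_cons, List.not_mem_nil, or_false]
    by_cases e0 : y = 12 * r + 3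
    · exact Or.inl (Or.inl e0)
    by_cases e1 : y % 3 = 0 ∧ y ≤ 0
    · have := split_strand_even (y := y) (a := 0) (b := 2) (d := 3) (j) (4 * r + 1) ((0 - y) / 3).toNat (by omega) (by omega)
      rcases this with h | h <;> simp only [h, true_or, or_true]
    by_cases e2 : y % 3 = 0
    · have := split_strand_odd (y := y) (a := (-1)) (b := 3) (d := 3) (j) (4 * r + 1) ((y - 3) / 3).toNat (by omega) (by omega)
      rcases this with h | h <;> simp only [h, true_or, or_true]
    by_cases e3 : y % 3 = 1 ∧ 0 ≤ y
    · have := split_strand_even (y := y) (a := 1) (b := (-2)) (d := (-3)) (j) (4 * r + 2) ((y - 1) / 3).toNat (by omega) (by omega)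
      rcases this with h | h <;> simp only [h, true_or, or_true]
    by_cases e4 : y % 3 = 1
    · have := split_strand_odd (y := y) (a := 1) (b := (-2)) (d := (-3)) (j) (4 * r + 2) ((-2 - y) / 3).toNat (by omega) (by omega)
      rcases this with h | h <;> simp only [h, true_or, or_true]
    by_cases e5 : 0 ≤ y
    · have := split_strand_odd (y := y) (a := 0) (b := 2) (d := 3) (j) (4 * r + 1) ((y - 2) / 3).toNat (by omega) (by omega)
      rcases this with h | h <;> simp only [h, true_or, or_true]
    · have := split_strand_even (y := y) (a := (-1)) (b := 3) (d := 3) (j) (4 * r + 1) ((-1 - y) / 3).toNat (by omega) (by omega)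
      rcases this with h | h <;> simp only [h, true_or, or_true]
  · intro t h1 h2
    push_cast at h1 h2 ⊢
    by_cases c0 : t = 1
    · exact Or.inr (.append_right (.append_mid (getLast_seg (by omega)) (head_append (head_seg_reverse (by omega))) (by simp only [strand]; split_ifs <;> omega)))
    by_cases c1 : t = 12 * r + 2
    · clear c0
      exact Or.inl (.append_mid (p := 12 * (r : ℤ) + 3) rfl (head_append (head_seg (by omega))) (by simp only [strand]; split_ifs <;> omega))
    by_cases c2 : t = 3 * j
    · clear c0 c1
      exact Or.inr (.append_mid (getLast_seg (by omega)) (head_append (head_seg (by omega))) (by simp only [strand]; split_ifs <;> omega))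
    by_cases c3 : t = 3 * j + 1
    · clear c0 c1 c2
      exact Or.inr (.append_right (.append_right (.append_mid (getLast_seg_reverse (by omega)) (head_seg (by omega)) (by simp only [strand]; split_ifs <;> omega))))
    by_cases c4 : t = 3 * j - 1
    · clear c0 c1 c2 c3
      exact Or.inl (.append_right (.append_mid (getLast_seg (by omega)) (head_seg_reverse (by omega)) (by simp only [strand]; split_ifs <;> omega)))
    by_cases c5 : t % 3 = 0 ∧ t < 3 * j
    · exact Or.inl (.append_right (.append_left (hasStep_strand ((t - 3) / 3).toNat (by omega) (by omega) (by omega))))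
    by_cases c6 : t % 3 = 0
    · exact Or.inr (.append_right (.append_right (.append_right (hasStep_strand ((t - 3) / 3).toNat (by omega) (by omega) (by omega)))))
    by_cases c7 : t % 3 = 1 ∧ t < 3 * j
    · exact Or.inl (.append_right (.append_right (HasStep.reverse (hasStep_strand ((t - 4) / 3).toNat (by omega) (by omega) (by omega)))))
    by_cases c8 : t % 3 = 1
    · exact Or.inr (.append_right (.append_left (hasStep_strand ((t - 4) / 3).toNat (by omega) (by omega) (by omega))))
    by_cases c9 : t < 3 * j
    · exact Or.inr (.append_left (hasStep_strand ((t - 2) / 3).toNat (by omega) (by omega) (by omega)))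
    · exact Or.inr (.append_right (.append_right (.append_left (HasStep.reverse (hasStep_strand ((t - 2) / 3).toNat (by omega) (by omega) (by omega))))))

/-- Here the zigzags start 2, −3; −1, 3; 1, −2, and the cuts lose and restore 3j + 2, 3j + 1, 3j.
The label 0 stands apart at the head of Q, and the last three entries of Q supply the differences 2,
12r + 6 and 12r + 7. -/
theorem exists_isMiddlePair_one {r j : ℕ} (hj : 1 ≤ j) (hr : j < 4 * r + 1) :
    ∃ P Q, IsMiddlePair (3 * r + 1) j P Q := by
  refine ⟨[12 * (r : ℤ) + 7] ++ (seg (strand 2 (-3) (-3)) 0 j ++ (seg (strand (-1) 3 3) 0 j).reverse),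
    [0] ++ (seg (strand 1 (-2) (-3)) 0 j ++ (seg (strand 2 (-3) (-3)) j (4 * r + 1) ++ ((seg (strand 1 (-2) (-3)) j (4 * r + 2)).reverse ++ (seg (strand (-1) 3 3) j (4 * r + 1) ++ [-6 * (r : ℤ) - 3, 6 * r + 3, -6 * r - 4])))), ?_, ?_, ?_, ?_, ?_, ?_, ?_, ?_⟩
  · (simp [length_seg]; omega)
  · simp [length_seg]; omega
  · exact ⟨_, rfl⟩
  · exact getLast_append (getLast_append (getLast_seg_reverse (by omega)))
  · rfl
  · rw [show -2 * ((3 * r + 1 : ℕ) : ℤ) - 2 = -6 * r - 4 by push_cast; ring]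
    exact getLast_append (getLast_append (getLast_append (getLast_append (getLast_append (rfl)))))
  · intro y h1 h2 h3
    push_cast at h1 h2 h3
    simp only [List.mem_append, List.mem_reverse, List.mem_cons, List.not_mem_nil, or_false]
    by_cases e0 : y = 12 * r + 7 ∨ y = 0 ∨ y = -6 * r - 3 ∨ y = 6 * r + 3 ∨ y = -6 * r - 4
    · rcases e0 with h | h | h | h | h <;> simp only [h, true_or, or_true]
    by_cases e1 : y % 3 = 0 ∧ y ≤ 0
    · have := split_strand_odd (y := y) (a := 2) (b := (-3)) (d := (-3)) (j) (4 * r + 1) ((-3 - y) / 3).toNat (by omega) (by omega)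
      rcases this with h | h <;> simp only [h, true_or, or_true]
    by_cases e2 : y % 3 = 0
    · have := split_strand_odd (y := y) (a := (-1)) (b := 3) (d := 3) (j) (4 * r + 1) ((y - 3) / 3).toNat (by omega) (by omega)
      rcases this with h | h <;> simp only [h, true_or, or_true]
    by_cases e3 : y % 3 = 1 ∧ 0 ≤ y
    · have := split_strand_even (y := y) (a := 1) (b := (-2)) (d := (-3)) (j) (4 * r + 2) ((y - 1) / 3).toNat (by omega) (by omega)
      rcases this with h | h <;> simp only [h, true_or, or_true]
    by_cases e4 : y % 3 = 1
    · have := split_strand_odd (y := y) (a := 1) (b := (-2)) (d := (-3)) (j) (4 * r + 2) ((-2 - y) / 3).toNat (by omega) (by omega)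
      rcases this with h | h <;> simp only [h, true_or, or_true]
    by_cases e5 : 0 ≤ y
    · have := split_strand_even (y := y) (a := 2) (b := (-3)) (d := (-3)) (j) (4 * r + 1) ((y - 2) / 3).toNat (by omega) (by omega)
      rcases this with h | h <;> simp only [h, true_or, or_true]
    · have := split_strand_even (y := y) (a := (-1)) (b := 3) (d := 3) (j) (4 * r + 1) ((-1 - y) / 3).toNat (by omega) (by omega)
      rcases this with h | h <;> simp only [h, true_or, or_true]
  · intro t h1 h2
    push_cast at h1 h2 ⊢
    by_cases c0 : t = 1
    · exact Or.inr (.append_mid (p := 0) rfl (head_append (head_seg (by omega))) (by simp only [strand]; split_ifs <;> omega))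
    by_cases c1 : t = 2
    · clear c0
      exact Or.inr (.append_right (.append_right (.append_right (.append_right (.append_mid (q := -6 * (r : ℤ) - 3) (getLast_seg (by omega)) rfl (by simp only [strand]; split_ifs <;> omega))))))
    by_cases c2 : t = 12 * r + 5
    · clear c0 c1
      exact Or.inl (.append_mid (p := 12 * (r : ℤ) + 7) rfl (head_append (head_seg (by omega))) (by simp only [strand]; split_ifs <;> omega))
    by_cases c3 : t = 12 * r + 6
    · clear c0 c1 c2
      exact Or.inr (.append_right (.append_right (.append_right (.append_right (.append_right (⟨-6 * (r : ℤ) - 3, 6 * r + 3, by simp, by omega⟩))))))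
    by_cases c4 : t = 12 * r + 7
    · clear c0 c1 c2 c3
      exact Or.inr (.append_right (.append_right (.append_right (.append_right (.append_right (⟨6 * r + 3, -6 * r - 4, by simp, by omega⟩))))))
    by_cases c5 : t = 12 * r + 4
    · clear c0 c1 c2 c3 c4
      exact Or.inr (.append_right (.append_right (.append_mid (getLast_seg (by omega)) (head_append (head_seg_reverse (by omega))) (by simp only [strand]; split_ifs <;> omega))))
    by_cases c6 : t = 3 * j
    · clear c0 c1 c2 c3 c4 c5
      exact Or.inl (.append_right (.append_mid (getLast_seg (by omega)) (head_seg_reverse (by omega)) (by simp only [strand]; split_ifs <;> omega)))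
    by_cases c7 : t = 3 * j + 1
    · clear c0 c1 c2 c3 c4 c5 c6
      exact Or.inr (.append_right (.append_mid (getLast_seg (by omega)) (head_append (head_seg (by omega))) (by simp only [strand]; split_ifs <;> omega)))
    by_cases c8 : t = 3 * j + 2
    · clear c0 c1 c2 c3 c4 c5 c6 c7
      exact Or.inr (.append_right (.append_right (.append_right (.append_mid (getLast_seg_reverse (by omega)) (head_append (head_seg (by omega))) (by simp only [strand]; split_ifs <;> omega)))))
    by_cases c9 : t % 3 = 0 ∧ t < 3 * j
    · exact Or.inr (.append_right (.append_left (hasStep_strand ((t - 3) / 3).toNat (by omega) (by omega) (by omega))))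
    by_cases c10 : t % 3 = 0
    · exact Or.inr (.append_right (.append_right (.append_right (.append_left (HasStep.reverse (hasStep_strand ((t - 3) / 3).toNat (by omega) (by omega) (by omega)))))))
    by_cases c11 : t % 3 = 1 ∧ t < 3 * j
    · exact Or.inl (.append_right (.append_right (HasStep.reverse (hasStep_strand ((t - 4) / 3).toNat (by omega) (by omega) (by omega)))))
    by_cases c12 : t % 3 = 1
    · exact Or.inr (.append_right (.append_right (.append_right (.append_right (.append_left (hasStep_strand ((t - 4) / 3).toNat (by omega) (by omega) (by omega)))))))
    by_cases c13 : t < 3 * j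
    · exact Or.inl (.append_right (.append_left (hasStep_strand ((t - 5) / 3).toNat (by omega) (by omega) (by omega))))
    · exact Or.inr (.append_right (.append_right (.append_left (hasStep_strand ((t - 5) / 3).toNat (by omega) (by omega) (by omega)))))

/-- For j = 0 the path P is the single label −1, so Q must take 4s + 3 as well; the step 0 → 4s + 3
gives the largest difference. The zigzags avoid 0 and −1 and stay uncut. -/
theorem exists_isMiddlePair_two_zero (r : ℕ) :
    ∃ P Q, IsMiddlePair (3 * r + 2) 0 P Q := by
  refine ⟨[-1],
    [0, 12 * (r : ℤ) + 11] ++ (seg (strand 2 (-4) (-3)) 0 (4 * r + 2) ++ ((seg (strand 1 (-3) (-3)) 0 (4 * r + 3)).reverse ++ (seg (strand (-2) 3 3) 0 (4 * r + 2) ++ [6 * (r : ℤ) + 5, -6 * r - 5, -6 * r - 6]))), ?_, ?_, ?_, ?_, ?_, ?_, ?_, ?_⟩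
  · simp
  · simp [length_seg]; omega
  · exact ⟨-1, rfl⟩
  · rfl
  · rfl
  · rw [show -2 * ((3 * r + 2 : ℕ) : ℤ) - 2 = -6 * r - 6 by push_cast; ring]
    exact getLast_append (getLast_append (getLast_append (getLast_append (rfl))))
  · intro y h1 h2 h3
    push_cast at h1 h2 h3
    simp only [List.mem_append, List.mem_reverse, List.mem_cons, List.not_mem_nil, or_false]
    by_cases e0 : y = -1 ∨ y = 0 ∨ y = 12 * r + 11 ∨ y = 6 * r + 5 ∨ y = -6 * r - 5 ∨ y = -6 * r - 6
    · rcases e0 with h | h | h | h | h | h <;> simp only [h, true_or, or_true]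
    by_cases e1 : y % 3 = 0 ∧ y ≤ 0
    · have := mem_strand_odd (y := y) (a := 1) (b := (-3)) (d := (-3)) (lo := 0) (hi := (4 * r + 3)) ((-3 - y) / 3).toNat (by omega) (by omega) (by omega)
      simp only [this, true_or, or_true]
    by_cases e2 : y % 3 = 0
    · have := mem_strand_odd (y := y) (a := (-2)) (b := 3) (d := 3) (lo := 0) (hi := (4 * r + 2)) ((y - 3) / 3).toNat (by omega) (by omega) (by omega)
      simp only [this, true_or, or_true]
    by_cases e3 : y % 3 = 1 ∧ 0 ≤ y
    · have := mem_strand_even (y := y) (a := 1) (b := (-3)) (d := (-3)) (lo := 0) (hi := (4 * r + 3)) ((y - 1) / 3).toNat (by omega) (by omega) (by omega)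
      simp only [this, true_or, or_true]
    by_cases e4 : y % 3 = 1
    · have := mem_strand_even (y := y) (a := (-2)) (b := 3) (d := 3) (lo := 0) (hi := (4 * r + 2)) ((-2 - y) / 3).toNat (by omega) (by omega) (by omega)
      simp only [this, true_or, or_true]
    by_cases e5 : 0 ≤ y
    · have := mem_strand_even (y := y) (a := 2) (b := (-4)) (d := (-3)) (lo := 0) (hi := (4 * r + 2)) ((y - 2) / 3).toNat (by omega) (by omega) (by omega)
      simp only [this, true_or, or_true]
    · have := mem_strand_odd (y := y) (a := 2) (b := (-4)) (d := (-3)) (lo := 0) (hi := (4 * r + 2)) ((-4 - y) / 3).toNat (by omega) (by omega) (by omega)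
      simp only [this, true_or, or_true]
  · intro t h1 h2
    push_cast at h1 h2 ⊢
    by_cases c0 : t = 1
    · exact Or.inr (.append_right (.append_right (.append_right (.append_right (⟨-6 * r - 5, -6 * r - 6, by simp, by omega⟩)))))
    by_cases c1 : t = 2
    · clear c0
      exact Or.inr (.append_right (.append_right (.append_right (.append_mid (q := 6 * (r : ℤ) + 5) (getLast_seg (by omega)) rfl (by simp only [strand]; split_ifs <;> omega)))))
    by_cases c2 : t = 3
    · clear c0 c1
      exact Or.inr (.append_right (.append_right (.append_mid (getLast_seg_reverse (by omega)) (head_append (head_seg (by omega))) (by simp only [strand]; split_ifs <;> omega))))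
    by_cases c3 : t = 12 * r + 8
    · clear c0 c1 c2
      exact Or.inr (.append_right (.append_mid (getLast_seg (by omega)) (head_append (head_seg_reverse (by omega))) (by simp only [strand]; split_ifs <;> omega)))
    by_cases c4 : t = 12 * r + 9
    · clear c0 c1 c2 c3
      exact Or.inr (.append_mid (p := 12 * (r : ℤ) + 11) rfl (head_append (head_seg (by omega))) (by simp only [strand]; split_ifs <;> omega))
    by_cases c5 : t = 12 * r + 10
    · clear c0 c1 c2 c3 c4
      exact Or.inr (.append_right (.append_right (.append_right (.append_right (⟨6 * (r : ℤ) + 5, -6 * r - 5, by simp, by omega⟩)))))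
    by_cases c6 : t = 12 * r + 11
    · clear c0 c1 c2 c3 c4 c5
      exact Or.inr (.append_left (hasStep_pair (by omega)))
    by_cases c7 : t % 3 = 0
    · exact Or.inr (.append_right (.append_left (hasStep_strand ((t - 6) / 3).toNat (by omega) (by omega) (by omega))))
    by_cases c8 : t % 3 = 1
    · exact Or.inr (.append_right (.append_right (.append_left (HasStep.reverse (hasStep_strand ((t - 4) / 3).toNat (by omega) (by omega) (by omega))))))
    · exact Or.inr (.append_right (.append_right (.append_right (.append_left (hasStep_strand ((t - 5) / 3).toNat (by omega) (by omega) (by omega))))))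

theorem exists_isMiddlePair_one_zero (r : ℕ) :
    ∃ P Q, IsMiddlePair (3 * r + 1) 0 P Q := by
  refine ⟨[-1],
    [0, 12 * (r : ℤ) + 7] ++ (seg (strand 2 (-4) (-3)) 0 (4 * r + 1) ++ ((seg (strand (-2) 3 3) 0 (4 * r + 1)).reverse ++ (seg (strand 1 (-3) (-3)) 0 (4 * r + 1) ++ [6 * (r : ℤ) + 3, -6 * r - 3, -6 * r - 4]))), ?_, ?_, ?_, ?_, ?_, ?_, ?_, ?_⟩
  · simp
  · simp [length_seg]; omega
  · exact ⟨-1, rfl⟩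
  · rfl
  · rfl
  · rw [show -2 * ((3 * r + 1 : ℕ) : ℤ) - 2 = -6 * r - 4 by push_cast; ring]
    exact getLast_append (getLast_append (getLast_append (getLast_append (rfl))))
  · intro y h1 h2 h3
    push_cast at h1 h2 h3
    simp only [List.mem_append, List.mem_reverse, List.mem_cons, List.not_mem_nil, or_false]
    by_cases e0 : y = -1 ∨ y = 0 ∨ y = 12 * r + 7 ∨ y = 6 * r + 3 ∨ y = -6 * r - 3 ∨ y = -6 * r - 4
    · rcases e0 with h | h | h | h | h | h <;> simp only [h, true_or, or_true]
    by_cases e1 : y % 3 = 0 ∧ y ≤ 0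
    · have := mem_strand_odd (y := y) (a := 1) (b := (-3)) (d := (-3)) (lo := 0) (hi := (4 * r + 1)) ((-3 - y) / 3).toNat (by omega) (by omega) (by omega)
      simp only [this, true_or, or_true]
    by_cases e2 : y % 3 = 0
    · have := mem_strand_odd (y := y) (a := (-2)) (b := 3) (d := 3) (lo := 0) (hi := (4 * r + 1)) ((y - 3) / 3).toNat (by omega) (by omega) (by omega)
      simp only [this, true_or, or_true]
    by_cases e3 : y % 3 = 1 ∧ 0 ≤ y
    · have := mem_strand_even (y := y) (a := 1) (b := (-3)) (d := (-3)) (lo := 0) (hi := (4 * r + 1)) ((y - 1) / 3).toNat (by omega) (by omega) (by omega)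
      simp only [this, true_or, or_true]
    by_cases e4 : y % 3 = 1
    · have := mem_strand_even (y := y) (a := (-2)) (b := 3) (d := 3) (lo := 0) (hi := (4 * r + 1)) ((-2 - y) / 3).toNat (by omega) (by omega) (by omega)
      simp only [this, true_or, or_true]
    by_cases e5 : 0 ≤ y
    · have := mem_strand_even (y := y) (a := 2) (b := (-4)) (d := (-3)) (lo := 0) (hi := (4 * r + 1)) ((y - 2) / 3).toNat (by omega) (by omega) (by omega)
      simp only [this, true_or, or_true]
    · have := mem_strand_odd (y := y) (a := 2) (b := (-4)) (d := (-3)) (lo := 0) (hi := (4 * r + 1)) ((-4 - y) / 3).toNat (by omega) (by omega) (by omega)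
      simp only [this, true_or, or_true]
  · intro t h1 h2
    push_cast at h1 h2 ⊢
    by_cases c0 : t = 1
    · exact Or.inr (.append_right (.append_right (.append_right (.append_right (⟨-6 * r - 3, -6 * r - 4, by simp, by omega⟩)))))
    by_cases c1 : t = 2
    · clear c0
      exact Or.inr (.append_right (.append_right (.append_right (.append_mid (q := 6 * (r : ℤ) + 3) (getLast_seg (by omega)) rfl (by simp only [strand]; split_ifs <;> omega)))))
    by_cases c2 : t = 3
    · clear c0 c1
      exact Or.inr (.append_right (.append_right (.append_mid (getLast_seg_reverse (by omega)) (head_append (head_seg (by omega))) (by simp only [strand]; split_ifs <;> omega))))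
    by_cases c3 : t = 12 * r + 4
    · clear c0 c1 c2
      exact Or.inr (.append_right (.append_mid (getLast_seg (by omega)) (head_append (head_seg_reverse (by omega))) (by simp only [strand]; split_ifs <;> omega)))
    by_cases c4 : t = 12 * r + 5
    · clear c0 c1 c2 c3
      exact Or.inr (.append_mid (p := 12 * (r : ℤ) + 7) rfl (head_append (head_seg (by omega))) (by simp only [strand]; split_ifs <;> omega))
    by_cases c5 : t = 12 * r + 6
    · clear c0 c1 c2 c3 c4
      exact Or.inr (.append_right (.append_right (.append_right (.append_right (⟨6 * (r : ℤ) + 3, -6 * r - 3, by simp, by omega⟩)))))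
    by_cases c6 : t = 12 * r + 7
    · clear c0 c1 c2 c3 c4 c5
      exact Or.inr (.append_left (hasStep_pair (by omega)))
    by_cases c7 : t % 3 = 0
    · exact Or.inr (.append_right (.append_left (hasStep_strand ((t - 6) / 3).toNat (by omega) (by omega) (by omega))))
    by_cases c8 : t % 3 = 1
    · exact Or.inr (.append_right (.append_right (.append_right (.append_left (hasStep_strand ((t - 4) / 3).toNat (by omega) (by omega) (by omega))))))
    · exact Or.inr (.append_right (.append_right (.append_left (HasStep.reverse (hasStep_strand ((t - 5) / 3).toNat (by omega) (by omega) (by omega))))))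

/-- For r = 0 the zigzags would be empty and the junctions meaningless. -/
theorem exists_isMiddlePair_zero_zero {r : ℕ} (hr : 1 ≤ r) :
    ∃ P Q, IsMiddlePair (3 * r) 0 P Q := by
  refine ⟨[-1],
    [0, 12 * (r : ℤ) + 3] ++ (seg (strand 2 (-4) (-3)) 0 (4 * r) ++ ([6 * (r : ℤ) + 1] ++ ((seg (strand (-2) 3 3) 0 (4 * r)).reverse ++ (seg (strand 1 (-3) (-3)) 0 (4 * r) ++ [-6 * (r : ℤ) - 2])))), ?_, ?_, ?_, ?_, ?_, ?_, ?_, ?_⟩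
  · simp
  · simp [length_seg]; omega
  · exact ⟨-1, rfl⟩
  · rfl
  · rfl
  · rw [show -2 * ((3 * r : ℕ) : ℤ) - 2 = -6 * (r : ℤ) - 2 by push_cast; ring]
    exact getLast_append (getLast_append (getLast_append (getLast_append (getLast_append (rfl)))))
  · intro y h1 h2 h3
    push_cast at h1 h2 h3
    simp only [List.mem_append, List.mem_reverse, List.mem_cons, List.not_mem_nil, or_false]
    by_cases e0 : y = -1 ∨ y = 0 ∨ y = 12 * r + 3 ∨ y = 6 * r + 1 ∨ y = -6 * r - 2
    · rcases e0 with h | h | h | h | h <;> simp only [h, true_or, or_true]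
    by_cases e1 : y % 3 = 0 ∧ y ≤ 0
    · have := mem_strand_odd (y := y) (a := 1) (b := (-3)) (d := (-3)) (lo := 0) (hi := (4 * r)) ((-3 - y) / 3).toNat (by omega) (by omega) (by omega)
      simp only [this, true_or, or_true]
    by_cases e2 : y % 3 = 0
    · have := mem_strand_odd (y := y) (a := (-2)) (b := 3) (d := 3) (lo := 0) (hi := (4 * r)) ((y - 3) / 3).toNat (by omega) (by omega) (by omega)
      simp only [this, true_or, or_true]
    by_cases e3 : y % 3 = 1 ∧ 0 ≤ y
    · have := mem_strand_even (y := y) (a := 1) (b := (-3)) (d := (-3)) (lo := 0) (hi := (4 * r)) ((y - 1) / 3).toNat (by omega) (by omega) (by omega)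
      simp only [this, true_or, or_true]
    by_cases e4 : y % 3 = 1
    · have := mem_strand_even (y := y) (a := (-2)) (b := 3) (d := 3) (lo := 0) (hi := (4 * r)) ((-2 - y) / 3).toNat (by omega) (by omega) (by omega)
      simp only [this, true_or, or_true]
    by_cases e5 : 0 ≤ y
    · have := mem_strand_even (y := y) (a := 2) (b := (-4)) (d := (-3)) (lo := 0) (hi := (4 * r)) ((y - 2) / 3).toNat (by omega) (by omega) (by omega)
      simp only [this, true_or, or_true]
    · have := mem_strand_odd (y := y) (a := 2) (b := (-4)) (d := (-3)) (lo := 0) (hi := (4 * r)) ((-4 - y) / 3).toNat (by omega) (by omega) (by omega)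
      simp only [this, true_or, or_true]
  · intro t h1 h2
    push_cast at h1 h2 ⊢
    by_cases c0 : t = 1
    · exact Or.inr (.append_right (.append_right (.append_mid (p := 6 * (r : ℤ) + 1) rfl (head_append (head_seg_reverse (by omega))) (by simp only [strand]; split_ifs <;> omega))))
    by_cases c1 : t = 2
    · clear c0
      exact Or.inr (.append_right (.append_right (.append_right (.append_right (.append_mid (q := -6 * (r : ℤ) - 2) (getLast_seg (by omega)) rfl (by simp only [strand]; split_ifs <;> omega))))))
    by_cases c2 : t = 3
    · clear c0 c1
      exact Or.inr (.append_right (.append_right (.append_right (.append_mid (getLast_seg_reverse (by omega)) (head_append (head_seg (by omega))) (by simp only [strand]; split_ifs <;> omega)))))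
    by_cases c3 : t = 12 * r + 1
    · clear c0 c1 c2
      exact Or.inr (.append_mid (p := 12 * (r : ℤ) + 3) rfl (head_append (head_seg (by omega))) (by simp only [strand]; split_ifs <;> omega))
    by_cases c4 : t = 12 * r + 2
    · clear c0 c1 c2 c3
      exact Or.inr (.append_right (.append_mid (q := 6 * (r : ℤ) + 1) (getLast_seg (by omega)) (head_append rfl) (by simp only [strand]; split_ifs <;> omega)))
    by_cases c5 : t = 12 * r + 3
    · clear c0 c1 c2 c3 c4
      exact Or.inr (.append_left (hasStep_pair (by omega)))
    by_cases c6 : t % 3 = 0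
    · exact Or.inr (.append_right (.append_left (hasStep_strand ((t - 6) / 3).toNat (by omega) (by omega) (by omega))))
    by_cases c7 : t % 3 = 1
    · exact Or.inr (.append_right (.append_right (.append_right (.append_right (.append_left (hasStep_strand ((t - 4) / 3).toNat (by omega) (by omega) (by omega)))))))
    · exact Or.inr (.append_right (.append_right (.append_right (.append_left (HasStep.reverse (hasStep_strand ((t - 5) / 3).toNat (by omega) (by omega) (by omega)))))))

end MiddlePaths

/-! ### From integer paths to paths modulo 8s + 7. -/

section Family

variable {s j : ℕ} {P Q : List ℤ}

theorem HasStep.isRung {m : ℕ} {l : List ℤ} {t : ℤ} (h : HasStep m l t) :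
    IsRung (l.map ((↑) : ℤ → ZMod m)) t ∨ IsRung (l.map ((↑) : ℤ → ZMod m)) (-t) := by
  obtain ⟨p, q, hpq, h⟩ := h
  have h' := mem_pairs_map ((↑) : ℤ → ZMod m) hpq
  have hm : ((m : ℤ) : ZMod m) = 0 := by simp
  rcases h with h | h | h | h
  · refine Or.inl ⟨_, _, h', ?_⟩
    rw [← h]; push_cast; ring
  · refine Or.inr ⟨_, _, h', ?_⟩
    rw [← h]; push_cast; ring
  · refine Or.inr ⟨_, _, h', ?_⟩
    rw [← Int.cast_sub, h, Int.cast_sub, hm, zero_sub]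
  · refine Or.inl ⟨_, _, h', ?_⟩
    rw [← neg_sub, ← Int.cast_sub, h, Int.cast_sub, hm, zero_sub, neg_neg]

/-- This window of representatives consists of the middle labels up to 2s + 1 and an interval
centred at 4s + 3. -/
theorem exists_intCast_eq (x : ZMod (8 * s + 7)) :
    ∃ y : ℤ, -2 * s - 2 ≤ y ∧ y ≤ 6 * s + 4 ∧ (y : ZMod (8 * s + 7)) = x := by
  have h := x.val_lt
  by_cases c : x.val ≤ 6 * s + 4
  · exact ⟨x.val, by omega, by omega, by simp⟩
  · refine ⟨x.val - (8 * s + 7 : ℕ), by omega, by omega, ?_⟩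
    rw [Int.cast_sub, Int.cast_natCast, Int.cast_natCast]
    simp

theorem exists_intCast_eq_or_neg (x : ZMod (8 * s + 7)) (hx : x ≠ 0) :
    ∃ t : ℤ, 1 ≤ t ∧ t ≤ 4 * s + 3 ∧ (x = t ∨ x = -(t : ZMod (8 * s + 7))) := by
  have h := x.val_lt
  have h0 : x.val ≠ 0 := by rwa [ne_eq, ZMod.val_eq_zero]
  by_cases c : x.val ≤ 4 * s + 3
  · exact ⟨x.val, by omega, by omega, Or.inl (by simp)⟩
  · refine ⟨(8 * s + 7 : ℕ) - x.val, by omega, by omega, Or.inr ?_⟩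
    rw [Int.cast_sub, Int.cast_natCast, Int.cast_natCast]
    simp

theorem intCast_eq_of_eq_add {m : ℕ} {x y : ℤ} (h : x = y ∨ x = y + m ∨ x + m = y) :
    (x : ZMod m) = y := by
  rcases h with rfl | rfl | rfl <;> simp

theorem intCast_ne_of_lt {m : ℕ} {x y : ℤ} (h1 : x < y) (h2 : y < x + m) :
    (x : ZMod m) ≠ y := by
  rw [ne_eq, ZMod.intCast_eq_intCast_iff_dvd_sub]
  intro h
  have := Int.le_of_dvd (by omega) h
  omega

/-- The outer paths use the window's upper interval without its midpoint; the middle pair uses the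
rest. The ends are the only overlaps: −1 lies on both P₀ and P₁, and 0 and −2s − 2 on both Q₁ and
Q₂. -/
theorem IsMiddlePair.hasTriangularBiembedding (hs : 2 ≤ s)
    (h : IsMiddlePair s j P Q) {W : Type*} (φ : W ≃ ZMod (8 * s + 7) × Fin 3) {g₁ g₂ : ℕ}
    (hg₁ : (g₁ : ℤ) = 1 + (8 * s + 7) * (2 * s + j))
    (hg₂ : (g₂ : ℤ) = 1 + (8 * s + 7) * (4 * s + 2 - j)) :
    HasTriangularBiembedding (SimpleGraph.completeGraph W) g₁ g₂ := by
  obtain ⟨f, hf⟩ := h.head_left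
  have hmem : ∀ {l : List ℤ} {y z : ℤ}, z ∈ l → (y = z ∨ y = z + (8 * s + 7 : ℕ) ∨
      y + (8 * s + 7 : ℕ) = z) → (y : ZMod (8 * s + 7)) ∈ l.map ((↑) : ℤ → ZMod (8 * s + 7)) := by
    intro l y z hz hyz
    rw [intCast_eq_of_eq_add hyz]
    exact List.mem_map_of_mem hz
  have hstep : ∀ {l : List ℤ} {t : ℤ}, HasStep (8 * s + 7) l t → ∀ x : ZMod (8 * s + 7),
      (x = t ∨ x = -(t : ZMod (8 * s + 7))) →
      IsRung (l.map ((↑) : ℤ → ZMod (8 * s + 7))) x ∨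
      IsRung (l.map ((↑) : ℤ → ZMod (8 * s + 7))) (-x) := by
    intro l t ht x hx
    have := HasStep.isRung (m := 8 * s + 7) (l := l) (t := t) (by exact_mod_cast ht)
    rcases hx with rfl | rfl
    · exact this
    · rw [neg_neg]; exact this.symm
  have lenP := h.length_left
  have lenQ := h.length_right
  have len₀ := length_firstPath hs
  have len₂ := length_lastPath hs
  refine hasTriangularBiembedding_of_paths (m := 8 * s + 7) (by omega) φ
    ((firstPath s).reverse.map (↑)) (P.map (↑)) (Q.map (↑)) ((lastPath s).map (↑))
    (a := ((0 : ℤ) : ZMod _)) (b := ((-2 * (s : ℤ) - 2 : ℤ) : ZMod _))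
    (e := ((-1 : ℤ) : ZMod _)) (f := (f : ZMod _)) (g := ((4 * (s : ℤ) + 1 : ℤ) : ZMod _))
    -- Translation by 4s + 3 carries the outer labels to −2s − 2, …, 2s without −1, and the labels
    -- 0, −2s − 2 to 4s + 3, 2s + 1. This is exactly the complement of the labels of P₀.
    (τ := ((4 * (s : ℤ) + 3 : ℤ) : ZMod _))
    ?_ ?_ ?_ ?_ ?_ ?_ ?_ ?_ ?_ ?_ ?_ ?_ ?_ ?_ ?_ ?_ ?_ ?_ ?_ ?_ ?_ ?_ ?_
  · rw [List.head?_map, List.head?_reverse, getLast_firstPath]; rfl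
  · rw [List.getLast?_map, List.getLast?_reverse, head_firstPath hs]; rfl
  · rw [List.head?_map, hf]; rfl
  · rw [List.getLast?_map, h.last_left]; rfl
  · rw [List.head?_map, h.head_right]; rfl
  · rw [List.getLast?_map, h.last_right]; rfl
  · rw [List.head?_map, head_lastPath]; rfl
  · rw [List.getLast?_map, getLast_lastPath]; rfl
  · rw [List.length_map, List.length_reverse, len₀]; exact ⟨2 * s + 1, by ring⟩
  · rw [List.length_map, lenP]; exact ⟨j, rfl⟩
  · rw [List.length_map]; exact ⟨2 * s + 2 - j, by omega⟩
  · rw [List.length_map, len₂]; exact ⟨2 * s + 2, by ring⟩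
  · rw [← Int.cast_sub, ← Int.cast_one]
    exact intCast_ne_of_lt (by omega) (by omega)
  · rw [← Int.cast_sub, ← Int.cast_one, ← Int.cast_neg]
    exact intCast_ne_of_lt (by omega) (by omega)
  · intro x
    obtain ⟨y, h1, h2, rfl⟩ := exists_intCast_eq x
    by_cases c : y ≤ 2 * s + 1 ∨ y = 4 * s + 3
    · exact Or.inr ((h.label y h1 c (by omega)).imp List.mem_map_of_mem List.mem_map_of_mem)
    · exact Or.inl (List.mem_map_of_mem
        (List.mem_reverse.2 (mem_firstPath (by omega) h2 (by omega))))
  · intro x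
    obtain ⟨y, h1, h2, rfl⟩ := exists_intCast_eq x
    by_cases c : y ≤ 2 * s + 1 ∨ y = 4 * s + 3
    · rcases h.label y h1 c (by omega) with h | h
      · exact Or.inl (List.mem_map_of_mem h)
      · exact Or.inr (Or.inl (List.mem_map_of_mem h))
    · exact Or.inr (Or.inr (List.mem_map_of_mem (mem_lastPath hs (by omega) h2 (by omega))))
  · intro x
    obtain ⟨y, h1, h2, rfl⟩ := exists_intCast_eq x
    rw [← Int.cast_sub]
    by_cases c1 : 2 * s + 2 ≤ y ∧ y ≠ 4 * s + 3
    · exact Or.inl (List.mem_map_of_mem (List.mem_reverse.2 (mem_firstPath c1.1 h2 c1.2)))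
    by_cases c2 : y = -1
    · exact Or.inl (hmem (List.mem_reverse.2 (mem_of_last getLast_firstPath)) (Or.inl c2))
    by_cases c3 : y = 4 * s + 3
    · exact Or.inr (hmem (mem_of_head head_lastPath) (by omega))
    by_cases c4 : y = 2 * s + 1
    · exact Or.inr (hmem (mem_of_last getLast_lastPath) (by omega))
    · exact Or.inr (hmem (mem_lastPath hs (y := y + 4 * s + 4) (by omega) (by omega) (by omega))
        (by omega))
  · intro x hx
    obtain ⟨t, h1, h2, h3⟩ := exists_intCast_eq_or_neg x hx
    -- The one difference missing from P₀ is that of the ends of Q₁, since b − a = −(2s + 2).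
    by_cases c : t = 2 * s + 2
    · have hb : ((-2 * (s : ℤ) - 2 : ℤ) : ZMod (8 * s + 7)) - ((0 : ℤ) : ZMod (8 * s + 7)) =
          -(t : ZMod (8 * s + 7)) := by
        rw [c]; push_cast; ring
      rw [hb, neg_neg]
      exact Or.inr (Or.inr h3.symm)
    · have := hstep (HasStep.reverse (hasStep_firstPath hs h1 h2 c)) x h3
      tauto
  · intro x hx
    obtain ⟨t, h1, h2, h3⟩ := exists_intCast_eq_or_neg x hx
    rcases h.step t h1 h2 with h | h
    · have := hstep h x h3
      tauto
    · have := hstep h x h3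
      tauto
  · intro x hx
    obtain ⟨t, h1, h2, h3⟩ := exists_intCast_eq_or_neg x hx
    exact hstep (hasStep_lastPath hs h1 h2) x h3
  · simp only [List.length_map, List.length_reverse]
    omega
  · simp only [List.length_map, List.length_reverse, lenP, len₀]
    rw [hg₁]
    push_cast
    ring
  · have : (Q.length : ℤ) = 4 * s + 4 - 2 * j := by omega
    simp only [List.length_map, len₂]
    rw [hg₂]
    push_cast
    rw [this]
    ring

end Family

/-! ### Explicit paths for the exceptional parameters. -/

section SmallCases

/-- Makes the coverage of differences by an explicit path decidable. -/
theorem isRung_iff {m : ℕ} {l : List (ZMod m)} {x : ZMod m} :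
    IsRung l x ↔ x ∈ (pairs l).map fun r => r.2 - r.1 := by
  simp only [IsRung, List.mem_map, Prod.exists, eq_comm (a := x)]

instance {m : ℕ} (l : List (ZMod m)) (x : ZMod m) : Decidable (IsRung l x) :=
  decidable_of_iff _ isRung_iff.symm

/-- For s ≤ 1 the outer paths built from zigzags are not available; the label conditions of explicit
paths are checked by evaluation. -/
theorem hasTriangularBiembedding_zero_zero {W : Type*} (φ : W ≃ ZMod 7 × Fin 3) :
    HasTriangularBiembedding (SimpleGraph.completeGraph W) 1 15 :=
  hasTriangularBiembedding_of_paths (by norm_num) φ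
    [6, 5, 1]
    [6]
    [0, 3, 4, 2]
    [0, 5, 1, 2]
    (a := 0) (b := 2) (e := 6) (f := 6) (g := 1) (τ := 2)
    rfl rfl rfl rfl rfl rfl rfl rfl (by decide) (by decide) (by decide) (by decide)
    (by decide) (by decide) (by decide +kernel) (by decide +kernel) (by decide +kernel)
    (by decide +kernel) (by decide +kernel) (by decide +kernel) rfl (by norm_num) (by norm_num)

theorem hasTriangularBiembedding_zero_one {W : Type*} (φ : W ≃ ZMod 7 × Fin 3) :
    HasTriangularBiembedding (SimpleGraph.completeGraph W) 8 8 :=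
  hasTriangularBiembedding_of_paths (by norm_num) φ
    [6, 5, 1]
    [4, 3, 6]
    [0, 2]
    [0, 5, 1, 2]
    (a := 0) (b := 2) (e := 6) (f := 4) (g := 1) (τ := 2)
    rfl rfl rfl rfl rfl rfl rfl rfl (by decide) (by decide) (by decide) (by decide)
    (by decide) (by decide) (by decide +kernel) (by decide +kernel) (by decide +kernel)
    (by decide +kernel) (by decide +kernel) (by decide +kernel) rfl (by norm_num) (by norm_num)

theorem hasTriangularBiembedding_one_zero {W : Type*} (φ : W ≃ ZMod 15 × Fin 3) :
    HasTriangularBiembedding (SimpleGraph.completeGraph W) 31 91 :=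
  hasTriangularBiembedding_of_paths (by norm_num) φ
    [14, 0, 2, 8, 4, 11, 6]
    [14]
    [9, 10, 1, 13, 3, 7, 5, 12]
    [9, 4, 2, 6, 0, 8, 11, 12]
    (a := 9) (b := 12) (e := 14) (f := 14) (g := 6) (τ := 1)
    rfl rfl rfl rfl rfl rfl rfl rfl (by decide) (by decide) (by decide) (by decide)
    (by decide) (by decide) (by decide +kernel) (by decide +kernel) (by decide +kernel)
    (by decide +kernel) (by decide +kernel) (by decide +kernel) rfl (by norm_num) (by norm_num)

theorem hasTriangularBiembedding_one_one {W : Type*} (φ : W ≃ ZMod 15 × Fin 3) :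
    HasTriangularBiembedding (SimpleGraph.completeGraph W) 46 76 :=
  hasTriangularBiembedding_of_paths (by norm_num) φ
    [14, 0, 9, 6, 2, 4, 11]
    [10, 1, 14]
    [7, 3, 8, 5, 13, 12]
    [7, 6, 4, 9, 2, 11, 0, 12]
    (a := 7) (b := 12) (e := 14) (f := 10) (g := 11) (τ := 1)
    rfl rfl rfl rfl rfl rfl rfl rfl (by decide) (by decide) (by decide) (by decide)
    (by decide) (by decide) (by decide +kernel) (by decide +kernel) (by decide +kernel)
    (by decide +kernel) (by decide +kernel) (by decide +kernel) rfl (by norm_num) (by norm_num)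

theorem hasTriangularBiembedding_one_two {W : Type*} (φ : W ≃ ZMod 15 × Fin 3) :
    HasTriangularBiembedding (SimpleGraph.completeGraph W) 61 61 :=
  hasTriangularBiembedding_of_paths (by norm_num) φ
    [14, 0, 2, 8, 12, 5, 10]
    [9, 4, 13, 1, 14]
    [3, 11, 7, 6]
    [3, 2, 10, 12, 8, 5, 0, 6]
    (a := 3) (b := 6) (e := 14) (f := 9) (g := 10) (τ := 1)
    rfl rfl rfl rfl rfl rfl rfl rfl (by decide) (by decide) (by decide) (by decide)
    (by decide) (by decide) (by decide +kernel) (by decide +kernel) (by decide +kernel)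
    (by decide +kernel) (by decide +kernel) (by decide +kernel) rfl (by norm_num) (by norm_num)

/-- Here j equals the length of the shortest zigzag of the middle construction, so the cut would
leave an empty tail. The same happens for s = 4, j = 5. -/
theorem hasTriangularBiembedding_two_three {W : Type*} (φ : W ≃ ZMod 23 × Fin 3) :
    HasTriangularBiembedding (SimpleGraph.completeGraph W) 162 162 :=
  hasTriangularBiembedding_of_paths (by norm_num) φ
    [22, 1, 18, 6, 2, 15, 7, 14, 11, 10, 19]
    [13, 16, 9, 4, 17, 0, 22]
    [21, 12, 8, 20, 5, 3]
    [21, 2, 19, 7, 10, 18, 11, 6, 15, 14, 1, 3]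
    (a := 21) (b := 3) (e := 22) (f := 13) (g := 19) (τ := 2)
    rfl rfl rfl rfl rfl rfl rfl rfl (by decide) (by decide) (by decide) (by decide)
    (by decide) (by decide) (by decide +kernel) (by decide +kernel) (by decide +kernel)
    (by decide +kernel) (by decide +kernel) (by decide +kernel) rfl (by norm_num) (by norm_num)

theorem hasTriangularBiembedding_four_five {W : Type*} (φ : W ≃ ZMod 39 × Fin 3) :
    HasTriangularBiembedding (SimpleGraph.completeGraph W) 508 508 :=
  hasTriangularBiembedding_of_paths (by norm_num) φ
    [38, 0, 34, 6, 24, 8, 22, 16, 36, 4, 2, 32, 10, 20, 28, 13, 26, 30, 18]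
    [15, 17, 21, 27, 12, 33, 5, 35, 1, 37, 38]
    [11, 31, 23, 9, 25, 3, 29, 19, 7, 14]
    [11, 30, 8, 32, 6, 34, 4, 18, 0, 36, 2, 10, 26, 16, 28, 22, 24, 20, 13, 14]
    (a := 11) (b := 14) (e := 38) (f := 15) (g := 18) (τ := 1)
    rfl rfl rfl rfl rfl rfl rfl rfl (by decide) (by decide) (by decide) (by decide)
    (by decide) (by decide) (by decide +kernel) (by decide +kernel) (by decide +kernel)
    (by decide +kernel) (by decide +kernel) (by decide +kernel) rfl (by norm_num) (by norm_num)

end SmallCases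

/-! ### Assembly of all cases. -/

/-- For positive j the cut must fall inside the shortest zigzag, of length 4r + 1 or 4r + 3 with r =
⌊s/3⌋. For s ≥ 2 and j ≤ s + 1 this fails only at the two excluded pairs. -/
theorem exists_isMiddlePair {s j : ℕ} (hs : 2 ≤ s) (hj : j ≤ s + 1) (h23 : ¬(s = 2 ∧ j = 3))
    (h45 : ¬(s = 4 ∧ j = 5)) : ∃ P Q, IsMiddlePair s j P Q := by
  obtain ⟨r, rfl | rfl | rfl⟩ : ∃ r, s = 3 * r ∨ s = 3 * r + 1 ∨ s = 3 * r + 2 :=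
    ⟨s / 3, by omega⟩
  · rcases Nat.eq_zero_or_pos j with rfl | h
    · exact exists_isMiddlePair_zero_zero (by omega)
    · exact exists_isMiddlePair_zero h (by omega)
  · rcases Nat.eq_zero_or_pos j with rfl | h
    · exact exists_isMiddlePair_one_zero r
    · exact exists_isMiddlePair_one h (by omega)
  · rcases Nat.eq_zero_or_pos j with rfl | h
    · exact exists_isMiddlePair_two_zero r
    · exact exists_isMiddlePair_two h (by omega)

theorem hasTriangularBiembedding_completeGraph {s j g₁ g₂ : ℕ} (hj : j ≤ s + 1)
    (hg₁ : (g₁ : ℤ) = 1 + (8 * s + 7) * (2 * s + j))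
    (hg₂ : (g₂ : ℤ) = 1 + (8 * s + 7) * (4 * s + 2 - j)) :
    HasTriangularBiembedding (SimpleGraph.completeGraph (Fin (24 * s + 21))) g₁ g₂ := by
  have φ : Fin (24 * s + 21) ≃ ZMod (8 * s + 7) × Fin 3 := Fintype.equivOfCardEq (by
    rw [Fintype.card_prod, ZMod.card, Fintype.card_fin, Fintype.card_fin]; ring)
  by_cases h : 2 ≤ s ∧ ¬(s = 2 ∧ j = 3) ∧ ¬(s = 4 ∧ j = 5)
  · obtain ⟨P, Q, hPQ⟩ := exists_isMiddlePair h.1 hj h.2.1 h.2.2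
    exact hPQ.hasTriangularBiembedding h.1 φ hg₁ hg₂
  · have key : (s = 0 ∧ j = 0) ∨ (s = 0 ∧ j = 1) ∨ (s = 1 ∧ j = 0) ∨ (s = 1 ∧ j = 1) ∨
        (s = 1 ∧ j = 2) ∨ (s = 2 ∧ j = 3) ∨ (s = 4 ∧ j = 5) := by omega
    rcases key with ⟨rfl, rfl⟩ | ⟨rfl, rfl⟩ | ⟨rfl, rfl⟩ | ⟨rfl, rfl⟩ | ⟨rfl, rfl⟩ | ⟨rfl, rfl⟩ |
      ⟨rfl, rfl⟩
    · obtain rfl : g₁ = 1 := by omega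
      obtain rfl : g₂ = 15 := by omega
      exact hasTriangularBiembedding_zero_zero φ
    · obtain rfl : g₁ = 8 := by omega
      obtain rfl : g₂ = 8 := by omega
      exact hasTriangularBiembedding_zero_one φ
    · obtain rfl : g₁ = 31 := by omega
      obtain rfl : g₂ = 91 := by omega
      exact hasTriangularBiembedding_one_zero φ
    · obtain rfl : g₁ = 46 := by omega
      obtain rfl : g₂ = 76 := by omega
      exact hasTriangularBiembedding_one_one φ
    · obtain rfl : g₁ = 61 := by omega
      obtain rfl : g₂ = 61 := by omega
      exact hasTriangularBiembedding_one_two φ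
    · obtain rfl : g₁ = 162 := by omega
      obtain rfl : g₂ = 162 := by omega
      exact hasTriangularBiembedding_two_three φ
    · obtain rfl : g₁ = 508 := by omega
      obtain rfl : g₂ = 508 := by omega
      exact hasTriangularBiembedding_four_five φ

end GraphSurface

theorem mainTheorem2 (s : ℕ) :
    GraphSurface.bigenus (SimpleGraph.completeGraph (Fin (24 * s + 21))) = 24 * s ^ 2 + 29 * s + 8 ∧
    ∀ k : ℕ, k ≤ s + 1 →
      ∃ g h : ℕ,
        (g : ℤ) = (24 * s ^ 2 + 29 * s + 8 : ℤ) - (8 * s + 7) * k ∧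
        (h : ℤ) = (24 * s ^ 2 + 29 * s + 8 : ℤ) + (8 * s + 7) * k ∧
        GraphSurface.IsBiembeddable (SimpleGraph.completeGraph (Fin (24 * s + 21))) g h ∧
        GraphSurface.HasTriangularBiembedding (SimpleGraph.completeGraph (Fin (24 * s + 21))) g h := by
  have H : ∀ k : ℕ, k ≤ s + 1 → ∃ g h : ℕ,
      (g : ℤ) = (24 * s ^ 2 + 29 * s + 8 : ℤ) - (8 * s + 7) * k ∧
      (h : ℤ) = (24 * s ^ 2 + 29 * s + 8 : ℤ) + (8 * s + 7) * k ∧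
      GraphSurface.HasTriangularBiembedding
        (SimpleGraph.completeGraph (Fin (24 * s + 21))) g h := by
    intro k hk
    have hk' : ((s + 1 - k : ℕ) : ℤ) = s + 1 - k := by omega
    -- Since b(s) = 1 + (8s + 7)(3s + 1), descending k steps of 8s + 7 corresponds to j = s + 1 − k.
    refine ⟨1 + (8 * s + 7) * (2 * s + (s + 1 - k)), 1 + (8 * s + 7) * (3 * s + 1 + k), ?_, ?_,
      GraphSurface.hasTriangularBiembedding_completeGraph (j := s + 1 - k) (by omega) ?_ ?_⟩
    · push_cast [hk']; ring
    · push_cast; ring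
    · push_cast; ring
    · push_cast [hk']; ring
  refine ⟨GraphSurface.bigenus_completeGraph s ?_, fun k hk => ?_⟩
  -- The balanced case k = 0 attains the lower bound for the bigenus.
  · obtain ⟨g, h, hg, hh, H⟩ := H 0 (Nat.zero_le _)
    obtain rfl : g = 24 * s ^ 2 + 29 * s + 8 := by zify; rw [hg]; simp
    obtain rfl : h = 24 * s ^ 2 + 29 * s + 8 := by zify; rw [hh]; simp
    exact H.isBiembeddable
  · obtain ⟨g, h, hg, hh, H⟩ := H k hk
    exact ⟨g, h, hg, hh, H.isBiembeddable, H⟩
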